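/- **Setting.** Let $d\ge 1$, $\Theta=[\theta_{inf},\theta_{sup}]^p$ and $\theta_0$ an interior point of $\Theta$. Let $\{K_\theta,\theta\in\Theta\}$ be real functions on $\mathbb R^d$ such that: - each $K_\theta$ is a stationary covariance function; - $K_\theta(t)$ is three times differentiable in $\theta$, and for all $q\in\{0,\dots,3\}$ and $i_1,\dots,i_q\in\{1,\dots,p\}$ there is a finite constant $C_{i_1,\dots,i_q}$ with $\left|\frac{\partial}{\partial\theta_{i_1}}\cdots\frac{\partial}{\partial\theta_{i_q}}K_\theta(t)\right|\le \frac{C_{i_1,\dots,i_q}}{1+|t|^{d+1}}$ for all $\theta\in\Theta$, $t\in\mathbb R^d$ (Euclidean norm); - with $\hat K_\theta(f)=(2\pi)^{-d}\int_{\mathbb R^d}K_\theta(t)e^{-\mathrm i f\cdot t}dt$, one has $K_\theta(t)=\int_{\mathbb R^d}\hat K_\theta(f)e^{\mathrm i f\cdot t}df$ (an absolutely convergent integral), and $(f,\theta)\mapsto\hat K_\theta(f)$ is continuous and positive on $\mathbb R^d\times\Theta$. Let $\mathcal L_X$ be a symmetric probability distribution on $\mathbb R^d$ with support $S_X\subset[-1,1]^d$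 and with a probability density that is positive on $S_X$. Let $(v_i)_{i\ge1}$ be points of $\{1,2,\dots\}^d$ with $\{v_i,1\le i\le N^d\}=\{1,\dots,N\}^d$ for all $N\ge1$, and let $\epsilon\in[0,\frac12)$. Let $(X_i)_{i\ge1}$ be i.i.d. with law $\mathcal L_X$ on a probability space $(\Omega_X,P_X)$ and let $Y$ be a (jointly measurable) centered Gaussian process on $\mathbb R^d$ with covariance function $K_{\theta_0}$, on a probability space $(\Omega_Y,P_Y)$; all variables live on the product space. For $n\ge1$ put $X=(X_1,\dots,X_n)$, $y=(Y(v_i+\epsilon X_i))_{1\le i\le n}$, $(R_\theta)_{k,l}=K_\theta(v_k-v_l+\epsilon(X_k-X_l))$, let $\mathrm{diag}(A)$ be the matrix $A$ with its off-diagonal entries set to $0$, and $$CV_\theta=\frac1n\,y^tR_\theta^{-1}\,\mathrm{diag}(R_\theta^{-1})^{-2}R_\theta^{-1}y .$$ **Proposition.** For $1\le i\le p$ let $$M^i_\theta=R_\theta^{-1}\mathrm{diag}(R_\theta^{-1})^{-2}\left\{\mathrm{diag}\Big(R_\theta^{-1}\frac{\partial R_\theta}{\partial\theta_i}R_\theta^{-1}\Big)\mathrm{diag}(R_\theta^{-1})^{-1}-R_\theta^{-1}\frac{\partial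 R_\theta}{\partial\theta_i}\right\}R_\theta^{-1}.$$ 1. For all $n\ge 1$, $\theta\in\Theta$, all values of $X$ in $S_X^n$ and all values of $y$ in $\mathbb R^n$, the matrices $R_\theta$ and $\mathrm{diag}(R_\theta^{-1})$ are invertible, $CV_\theta$ has all first and second order partial derivatives in $\theta$ (one-sided at the boundary of $\Theta$), and for all $1\le i\le p$ $$\frac{\partial}{\partial\theta_i}CV_\theta=\frac2n\,y^tM^i_\theta y .$$ 2. Let $M_{CV,1}^{i,j}=2\{M^i_{\theta_0}+(M^i_{\theta_0})^t\}R_{\theta_0}\{M^j_{\theta_0}+(M^j_{\theta_0})^t\}R_{\theta_0}$. For all $n\ge1$ and $1\le i,j\le p$, the variables $\sqrt n\frac{\partial}{\partial\theta_i}CV_{\theta_0}$ are square integrable and almost surely $$\mathrm{cov}\Big(\sqrt n\frac{\partial}{\partial\theta_i}CV_{\theta_0},\sqrt n\frac{\partial}{\partial\theta_j}CV_{\theta_0}\,\Big|\,X\Big)=\frac1n\mathrm{Tr}\big(M_{CV,1}^{i,j}\big).$$ 3. Let $$\begin{aligned}M_{CV,2}^{i,j}={}&-8\,\mathrm{diag}(R_{\theta_0}^{-1})^{-3}\mathrm{diag}\Big(R_{\theta_0}^{-1}\frac{\partial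 R_{\theta_0}}{\partial\theta_i}R_{\theta_0}^{-1}\Big)R_{\theta_0}^{-1}\frac{\partial R_{\theta_0}}{\partial\theta_j}R_{\theta_0}^{-1}\\&+2\,\mathrm{diag}(R_{\theta_0}^{-1})^{-2}R_{\theta_0}^{-1}\frac{\partial R_{\theta_0}}{\partial\theta_i}R_{\theta_0}^{-1}\frac{\partial R_{\theta_0}}{\partial\theta_j}R_{\theta_0}^{-1}\\&+6\,\mathrm{diag}(R_{\theta_0}^{-1})^{-4}\mathrm{diag}\Big(R_{\theta_0}^{-1}\frac{\partial R_{\theta_0}}{\partial\theta_i}R_{\theta_0}^{-1}\Big)\mathrm{diag}\Big(R_{\theta_0}^{-1}\frac{\partial R_{\theta_0}}{\partial\theta_j}R_{\theta_0}^{-1}\Big)R_{\theta_0}^{-1}.\end{aligned}$$ For all $n\ge1$ and $1\le i,j\le p$, $\frac{\partial^2}{\partial\theta_i\partial\theta_j}CV_{\theta_0}$ is integrable and almost surely $$\mathbb E\Big(\frac{\partial^2}{\partial\theta_i\partial\theta_j}CV_{\theta_0}\,\Big|\,X\Big)=\frac1n\mathrm{Tr}\big(M_{CV,2}^{i,j}\big).$$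 4. There are deterministic $p\times p$ matrices $\Sigma_{CV,1}$ and $\Sigma_{CV,2}$ such that for all $1\le i,j\le p$, $P_X$-almost surely as $n\to+\infty$, $$\frac1n\mathrm{Tr}\big(M_{CV,1}^{i,j}\big)\to(\Sigma_{CV,1})_{i,j},\qquad \frac1n\mathrm{Tr}\big(M_{CV,2}^{i,j}\big)\to(\Sigma_{CV,2})_{i,j}.$$ For a given model $(d,p,\Theta,\{K_\theta\},\theta_0,\mathcal L_X)$ they depend only on $\epsilon$ (and not on the choice of the enumeration $(v_i)$, of the probability spaces or of the variables). -/

import Mathlib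

open MeasureTheory ProbabilityTheory Filter Topology

noncomputable section

namespace KrigingCV

/-- The parameter set `Θ = [a, b]^p`. -/
def paramSet {p : ℕ} (a b : ℝ) : Set (Fin p → ℝ) := {θ | ∀ i, θ i ∈ Set.Icc a b}

/-- The partial derivative `∂F/∂θ_i` on the cube `[a, b]^p` (one-sided at the faces). -/
def partialDeriv {p : ℕ} (a b : ℝ) (i : Fin p) (F : (Fin p → ℝ) → ℝ) (θ : Fin p → ℝ) : ℝ :=
  derivWithin (fun s => F (Function.update θ i s)) (Set.Icc a b) (θ i)

/-- The iterated partial derivative `∂/∂θ_{i₁} … ∂/∂θ_{i_q} F` for the list `[i₁, …, i_q]`. -/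
def iterPartialDeriv {p : ℕ} (a b : ℝ) : List (Fin p) → ((Fin p → ℝ) → ℝ) → (Fin p → ℝ) → ℝ
  | [], F => F
  | i :: I, F => partialDeriv a b i (iterPartialDeriv a b I F)

/-- `k` is a stationary covariance function on `ℝ^d`: all the matrices `(k (s_i - s_j))` are
symmetric and nonnegative. -/
def IsStationaryCovariance {d : ℕ} (k : EuclideanSpace ℝ (Fin d) → ℝ) : Prop :=
  ∀ (m : ℕ) (s : Fin m → EuclideanSpace ℝ (Fin d)),
    (Matrix.of fun i j => k (s i - s j)).PosSemidef

/-- The Fourier transform `(2π)^{-d} ∫ h(t) e^{-i f·t} dt`. -/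
def fourierHat {d : ℕ} (h : EuclideanSpace ℝ (Fin d) → ℝ) (f : EuclideanSpace ℝ (Fin d)) : ℂ :=
  ((2 * Real.pi : ℝ) : ℂ)⁻¹ ^ d *
    ∫ t, (h t : ℂ) * Complex.exp (-(Complex.I * ((inner ℝ f t : ℝ) : ℂ)))

/-- The regularity condition on the parametric family `{K_θ : θ ∈ [a, b]^p}` of covariance
functions. Since `K_θ` is even, its Fourier transform is real valued; it is represented by the
real part of `fourierHat`. -/
structure IsRegularFamily {d p : ℕ} (a b : ℝ)
    (K : (Fin p → ℝ) → EuclideanSpace ℝ (Fin d) → ℝ) : Prop where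
  stationary : ∀ θ ∈ paramSet a b, IsStationaryCovariance (K θ)
  /-- `K_θ(t)` is three times differentiable in `θ`. -/
  differentiable : ∀ I : List (Fin p), I.length < 3 → ∀ (i : Fin p), ∀ θ ∈ paramSet a b,
    ∀ t : EuclideanSpace ℝ (Fin d),
      DifferentiableWithinAt ℝ
        (fun s => iterPartialDeriv a b I (fun ϑ => K ϑ t) (Function.update θ i s))
        (Set.Icc a b) (θ i)
  decay : ∀ I : List (Fin p), I.length ≤ 3 → ∃ C : ℝ, ∀ θ ∈ paramSet a b,
    ∀ t : EuclideanSpace ℝ (Fin d),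
      |iterPartialDeriv a b I (fun ϑ => K ϑ t) θ| ≤ C / (1 + ‖t‖ ^ (d + 1))
  fourier_integrable : ∀ θ ∈ paramSet a b, Integrable (fourierHat (K θ))
  fourier_inversion : ∀ θ ∈ paramSet a b, ∀ t : EuclideanSpace ℝ (Fin d),
    (K θ t : ℂ) = ∫ f, fourierHat (K θ) f * Complex.exp (Complex.I * ((inner ℝ f t : ℝ) : ℂ))
  fourier_continuous :
    ContinuousOn (fun q : (Fin p → ℝ) × EuclideanSpace ℝ (Fin d) => (fourierHat (K q.1) q.2).re)
      (paramSet a b ×ˢ Set.univ)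
  fourier_pos : ∀ θ ∈ paramSet a b, ∀ f : EuclideanSpace ℝ (Fin d), 0 < (fourierHat (K θ) f).re

/-- The law of the perturbations: a probability distribution on `ℝ^d`, symmetric, with support
contained in `[-1, 1]^d`, and with a density that is positive on the support. -/
structure IsPerturbationLaw {d : ℕ} (L : Measure (EuclideanSpace ℝ (Fin d))) : Prop where
  prob : IsProbabilityMeasure L
  symm : L.map (fun t => -t) = L
  support_subset : ∀ t ∈ L.support, ∀ k, t k ∈ Set.Icc (-1 : ℝ) 1
  density : ∃ g : EuclideanSpace ℝ (Fin d) → ENNReal, Measurable g ∧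
    L = volume.withDensity g ∧ ∀ t ∈ L.support, 0 < g t

/-- `v` enumerates `{1, 2, …}^d` (with indices starting from `0`) so that, for all `N ≥ 1`, its
first `N^d` values are the points of `{1, …, N}^d`. -/
def IsGridEnumeration {d : ℕ} (v : ℕ → Fin d → ℕ) : Prop :=
  ∀ N : ℕ, 1 ≤ N → v '' {i | i < N ^ d} = {u | ∀ k, 1 ≤ u k ∧ u k ≤ N}

/-- A point of `ℕ^d` as a point of `ℝ^d`. -/
def gridPoint {d : ℕ} (u : Fin d → ℕ) : EuclideanSpace ℝ (Fin d) :=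
  WithLp.toLp 2 fun k => (u k : ℝ)

/-- `diag(A)`: the matrix `A` with its off-diagonal entries set to `0`. -/
def diagPart {n : ℕ} (A : Matrix (Fin n) (Fin n) ℝ) : Matrix (Fin n) (Fin n) ℝ :=
  Matrix.diagonal A.diag

section Model

variable {d p n : ℕ} (a b : ℝ) (K : (Fin p → ℝ) → EuclideanSpace ℝ (Fin d) → ℝ)
  (v : ℕ → Fin d → ℕ) (ε : ℝ) (x : Fin n → EuclideanSpace ℝ (Fin d))

/-- `R_θ = (K_θ(v_k - v_l + ε (x_k - x_l)))_{k,l}`. -/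
def covMat (θ : Fin p → ℝ) : Matrix (Fin n) (Fin n) ℝ :=
  Matrix.of fun k l => K θ (gridPoint (v k) - gridPoint (v l) + ε • (x k - x l))

/-- `∂R_θ/∂θ_i`, entry by entry. -/
def dCovMat (i : Fin p) (θ : Fin p → ℝ) : Matrix (Fin n) (Fin n) ℝ :=
  Matrix.of fun k l => partialDeriv a b i (fun ϑ => covMat K v ε x ϑ k l) θ

/-- The cross validation criterion
`CV_θ = (1/n) yᵗ R_θ⁻¹ diag(R_θ⁻¹)⁻² R_θ⁻¹ y`. -/
def cv (y : Fin n → ℝ) (θ : Fin p → ℝ) : ℝ :=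
  let A := (covMat K v ε x θ)⁻¹
  (1 / (n : ℝ)) * (y ⬝ᵥ (A * (diagPart A)⁻¹ ^ 2 * A).mulVec y)

/-- `M^i_θ`. -/
def gradMat (i : Fin p) (θ : Fin p → ℝ) : Matrix (Fin n) (Fin n) ℝ :=
  let A := (covMat K v ε x θ)⁻¹
  let D := dCovMat a b K v ε x i θ
  A * (diagPart A)⁻¹ ^ 2 * (diagPart (A * D * A) * (diagPart A)⁻¹ - A * D) * A

/-- `M_{CV,1}^{i,j}` at the parameter `θ`. -/
def mCV1 (θ : Fin p → ℝ) (i j : Fin p) : Matrix (Fin n) (Fin n) ℝ :=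
  let R := covMat K v ε x θ
  let Mi := gradMat a b K v ε x i θ
  let Mj := gradMat a b K v ε x j θ
  (2 : ℝ) • ((Mi + Mi.transpose) * R * (Mj + Mj.transpose) * R)

/-- `M_{CV,2}^{i,j}` at the parameter `θ`. -/
def mCV2 (θ : Fin p → ℝ) (i j : Fin p) : Matrix (Fin n) (Fin n) ℝ :=
  let A := (covMat K v ε x θ)⁻¹
  let Di := dCovMat a b K v ε x i θ
  let Dj := dCovMat a b K v ε x j θ
  (-8 : ℝ) • ((diagPart A)⁻¹ ^ 3 * diagPart (A * Di * A) * A * Dj * A)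
    + (2 : ℝ) • ((diagPart A)⁻¹ ^ 2 * A * Di * A * Dj * A)
    + (6 : ℝ) • ((diagPart A)⁻¹ ^ 4 * diagPart (A * Di * A) * diagPart (A * Dj * A) * A)

end Model

/-- The conditional covariance `E[(U - E[U|m]) (V - E[V|m]) | m]`. -/
def condCov {Ω : Type*} (m : MeasurableSpace Ω) {m₀ : MeasurableSpace Ω} (U V : Ω → ℝ)
    (μ : Measure Ω) : Ω → ℝ :=
  μ[(U - μ[U | m]) * (V - μ[V | m]) | m]

/-- The first `n` perturbations. -/
def firstPerturbations {d : ℕ} {ΩX : Type*} (X : ℕ → ΩX → EuclideanSpace ℝ (Fin d)) (n : ℕ)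
    (ω : ΩX) : Fin n → EuclideanSpace ℝ (Fin d) :=
  fun k => X k ω

/-- The `σ`-algebra on the product space that is generated by the first `n` perturbations. -/
@[reducible]
def perturbationSigma {d : ℕ} {ΩX : Type*} (ΩY : Type*)
    (X : ℕ → ΩX → EuclideanSpace ℝ (Fin d)) (n : ℕ) : MeasurableSpace (ΩX × ΩY) :=
  MeasurableSpace.comap (fun ω => firstPerturbations X n ω.1) inferInstance

/-- The observation vector `y_k = Y(v_k + ε X_k)`, `k < n`, on the product space. -/
def observations {d : ℕ} {ΩX ΩY : Type*} (v : ℕ → Fin d → ℕ) (ε : ℝ)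
    (X : ℕ → ΩX → EuclideanSpace ℝ (Fin d)) (Y : EuclideanSpace ℝ (Fin d) → ΩY → ℝ) (n : ℕ)
    (ω : ΩX × ΩY) : Fin n → ℝ :=
  fun k => Y (gridPoint (v k) + ε • X k ω.1) ω.2

/-- The random function `θ ↦ CV_θ`. -/
def randomCV {d p : ℕ} {ΩX ΩY : Type*} (K : (Fin p → ℝ) → EuclideanSpace ℝ (Fin d) → ℝ)
    (v : ℕ → Fin d → ℕ) (ε : ℝ) (X : ℕ → ΩX → EuclideanSpace ℝ (Fin d))
    (Y : EuclideanSpace ℝ (Fin d) → ΩY → ℝ) (n : ℕ) (ω : ΩX × ΩY) : (Fin p → ℝ) → ℝ :=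
  cv K v ε (firstPerturbations X n ω.1) (observations v ε X Y n ω)

end KrigingCV

end

/-! Differentiating the criterion through `R⁻¹` and `diag(R⁻¹)⁻¹` gives the symmetric matrix `M +
Mᵀ`, hence the gradient formula (`hasMatDeriv_criterion`). Given the perturbations, the observations
form a centered Gaussian vector with covariance matrix `R`. The gradient and the Hessian at `θ₀` are
quadratic forms in it, so Fubini and the Gaussian second and fourth moments turn the conditional
moments into traces (`condExp_randomQuad`, `condCov_randomQuad`). For the Hessian a further
cancellation removes the mixed derivative of `R` (`trace_hessOf`).

The almost sure convergence rests on locality. A matrix attached to every finite perturbed set of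
sites is called local if it is uniformly bounded and if each row and column changes little in
Euclidean norm when sites are added far away. Covariance matrices and their parameter derivatives
are local because their entries decay like `1 / (1 + |t|^(d+1))`, which is summable over the
lattice. Local matrices are stable under sums, products, transposition and diagonal parts. They are
stable under inversion as well, provided that they are uniformly coercive, since a Neumann series
then approximates the inverse uniformly. Every matrix whose trace is needed is therefore local.

Uniform coercivity of `R` comes from the spectral density (`exists_coercive`). It dominates a small
multiple of a smooth bump dilated by a large factor. The inverse Fourier transform of such a bump is
so concentrated at the origin that its matrices on separated points are diagonally dominant.
Comparing the two quadratic forms under the Fourier integral gives a lower bound free of the number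
of points.

A normalized trace is an average of diagonal entries. Away from the boundary, locality replaces each
entry by the same function of the perturbations in a window of radius `r`. These window variables
are bounded, identically distributed, and independent when the windows are disjoint, so their
centered sums have variance of order `n` and a strong law follows. Boundary sites have vanishing
proportion. The limit is that of the expected central entry of a box as its radius grows, in which
neither the enumeration nor the probability space appears (`IsLocal.ae_tendsto_trace`). -/

noncomputable section

namespace KrigingCV

/-! ### Extension by zero, Euclidean norms, operator bounds and coercivity of finite matrices. -/

section

section ExtendZero

variable {ι κ : Type*}

/-- Extension by zero of a family along an injection. -/
def extendZero (e : κ → ι) (φ : κ → ℝ) : ι → ℝ := Function.extend e φ 0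

lemma extendZero_apply {e : κ → ι} (he : Function.Injective e) (φ : κ → ℝ) (k : κ) :
    extendZero e φ (e k) = φ k := he.extend_apply _ _ _

lemma extendZero_apply_of_notMem {e : κ → ι} (φ : κ → ℝ) {k : ι} (h : k ∉ Set.range e) :
    extendZero e φ k = 0 := by
  simp only [extendZero]
  rw [Function.extend_apply']
  · rfl
  · simpa using h

lemma extendZero_add (e : κ → ι) (φ ψ : κ → ℝ) :
    extendZero e (φ + ψ) = extendZero e φ + extendZero e ψ := by
  simp only [extendZero]
  rw [← Function.extend_add]; simp

lemma extendZero_smul (e : κ → ι) (a : ℝ) (φ : κ → ℝ) :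
    extendZero e (a • φ) = a • extendZero e φ := by
  simp only [extendZero]
  rw [← Function.extend_smul]; simp

lemma extendZero_sub (e : κ → ι) (φ ψ : κ → ℝ) :
    extendZero e (φ - ψ) = extendZero e φ - extendZero e ψ := by
  have := extendZero_add e φ ((-1 : ℝ) • ψ)
  rw [extendZero_smul] at this
  simpa [sub_eq_add_neg] using this

lemma extendZero_sum {α : Type*} (e : κ → ι) (s : Finset α) (f : α → κ → ℝ) :
    extendZero e (∑ a ∈ s, f a) = ∑ a ∈ s, extendZero e (f a) := by
  classical
  induction s using Finset.induction_on with
  | empty => 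
    have := extendZero_smul e 0 (0 : κ → ℝ)
    simpa using this
  | insert a s ha ih => rw [Finset.sum_insert ha, Finset.sum_insert ha, extendZero_add, ih]

lemma extendZero_single [DecidableEq κ] [DecidableEq ι] {e : κ → ι} (he : Function.Injective e)
    (k : κ) (a : ℝ) : extendZero e (Pi.single k a) = Pi.single (e k) a := by
  ext i
  by_cases hi : i ∈ Set.range e
  · obtain ⟨j, rfl⟩ := hi
    rw [extendZero_apply he]
    by_cases h : j = k
    · subst h; simp
    · simp [h, he.eq_iff]
  · rw [extendZero_apply_of_notMem _ hi]
    have : i ≠ e k := fun h => hi ⟨k, h.symm⟩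
    simp [this]

end ExtendZero

section L2

variable {ι κ : Type*} [Fintype ι] [Fintype κ]

/-- The Euclidean norm of a finite family of reals. -/
def l2 (φ : ι → ℝ) : ℝ := ‖(WithLp.toLp 2 φ : EuclideanSpace ℝ ι)‖

lemma l2_nonneg (φ : ι → ℝ) : 0 ≤ l2 φ := norm_nonneg _

lemma l2_sq (φ : ι → ℝ) : l2 φ ^ 2 = φ ⬝ᵥ φ := by
  rw [l2, EuclideanSpace.norm_sq_eq]
  simp [dotProduct, sq]

lemma l2_add_le (φ ψ : ι → ℝ) : l2 (φ + ψ) ≤ l2 φ + l2 ψ := by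
  simpa [l2] using norm_add_le (WithLp.toLp 2 φ : EuclideanSpace ℝ ι) (WithLp.toLp 2 ψ)

lemma l2_sub_le (φ ψ : ι → ℝ) : l2 (φ - ψ) ≤ l2 φ + l2 ψ := by
  simpa [l2] using norm_sub_le (WithLp.toLp 2 φ : EuclideanSpace ℝ ι) (WithLp.toLp 2 ψ)

lemma l2_smul (a : ℝ) (φ : ι → ℝ) : l2 (a • φ) = |a| * l2 φ := by
  simp [l2, norm_smul]

lemma l2_zero : l2 (0 : ι → ℝ) = 0 := by simp [l2]

lemma l2_sum_le {α : Type*} (s : Finset α) (f : α → ι → ℝ) :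
    l2 (∑ a ∈ s, f a) ≤ ∑ a ∈ s, l2 (f a) := by
  simpa [l2] using norm_sum_le s (fun a => (WithLp.toLp 2 (f a) : EuclideanSpace ℝ ι))

lemma abs_apply_le_l2 (φ : ι → ℝ) (k : ι) : |φ k| ≤ l2 φ := by
  simpa [l2] using PiLp.norm_apply_le (WithLp.toLp 2 φ : EuclideanSpace ℝ ι) k

lemma l2_single [DecidableEq ι] (k : ι) (a : ℝ) : l2 (Pi.single k a : ι → ℝ) = |a| := by
  simp [l2]

lemma abs_dotProduct_le_l2 (φ ψ : ι → ℝ) : |φ ⬝ᵥ ψ| ≤ l2 φ * l2 ψ := by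
  have := abs_real_inner_le_norm (WithLp.toLp 2 φ : EuclideanSpace ℝ ι) (WithLp.toLp 2 ψ)
  simpa [l2, PiLp.inner_apply, dotProduct, mul_comm] using this

lemma l2_le_of_sq_le {φ : ι → ℝ} {C : ℝ} (hC : 0 ≤ C) (h : φ ⬝ᵥ φ ≤ C ^ 2) : l2 φ ≤ C := by
  rw [← l2_sq] at h
  exact (le_abs_self _).trans (abs_le_of_sq_le_sq h hC)

lemma l2_le_sum_abs (φ : ι → ℝ) : l2 φ ≤ ∑ k, |φ k| := by
  classical
  have h : φ = ∑ k, Pi.single k (φ k) := (Finset.univ_sum_single φ).symm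
  calc l2 φ = l2 (∑ k, Pi.single k (φ k)) := by rw [← h]
    _ ≤ ∑ k, l2 (Pi.single k (φ k) : ι → ℝ) := l2_sum_le _ _
    _ = ∑ k, |φ k| := by simp [l2_single]

lemma l2_extendZero {e : κ → ι} (he : Function.Injective e) (φ : κ → ℝ) :
    l2 (extendZero e φ) = l2 φ := by
  have h : l2 (extendZero e φ) ^ 2 = l2 φ ^ 2 := by
    rw [l2_sq, l2_sq]
    simp only [dotProduct]
    have hz : ∀ i, i ∉ Set.range e → extendZero e φ i * extendZero e φ i = 0 := fun i hi => by
      rw [extendZero_apply_of_notMem _ hi, zero_mul]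
    rw [← Fintype.sum_of_injective e he (fun k => φ k * φ k) _ hz]
    intro k
    rw [extendZero_apply he]
  nlinarith [sq_nonneg (l2 (extendZero e φ) - l2 φ), l2_nonneg φ, l2_nonneg (extendZero e φ),
    (sq_eq_sq₀ (l2_nonneg (extendZero e φ)) (l2_nonneg φ)).1 h]

end L2

section OpBound

open Matrix

variable {ι κ : Type*} [Fintype ι] [Fintype κ]

/-- `C` bounds the operator norm of `A` for Euclidean norms. -/
def OpBound (A : Matrix ι ι ℝ) (C : ℝ) : Prop := ∀ φ : ι → ℝ, l2 (A *ᵥ φ) ≤ C * l2 φ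

/-- `A ≥ m` in the sense of quadratic forms. -/
def Coercive (m : ℝ) (A : Matrix ι ι ℝ) : Prop := ∀ φ : ι → ℝ, m * (φ ⬝ᵥ φ) ≤ φ ⬝ᵥ (A *ᵥ φ)

lemma OpBound.mono {A : Matrix ι ι ℝ} {C C' : ℝ} (h : OpBound A C) (hC : C ≤ C') :
    OpBound A C' := fun φ => (h φ).trans (by gcongr; exact l2_nonneg φ)

lemma OpBound.add {A B : Matrix ι ι ℝ} {C C' : ℝ} (hA : OpBound A C) (hB : OpBound B C') :
    OpBound (A + B) (C + C') := fun φ => by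
  rw [add_mulVec, add_mul]
  exact (l2_add_le _ _).trans (add_le_add (hA φ) (hB φ))

lemma OpBound.smul {A : Matrix ι ι ℝ} {C : ℝ} (a : ℝ) (hA : OpBound A C) :
    OpBound (a • A) (|a| * C) := fun φ => by
  rw [smul_mulVec, l2_smul, mul_assoc]
  exact mul_le_mul_of_nonneg_left (hA φ) (abs_nonneg _)

lemma OpBound.mul {A B : Matrix ι ι ℝ} {C C' : ℝ} (hC : 0 ≤ C) (hA : OpBound A C)
    (hB : OpBound B C') : OpBound (A * B) (C * C') := fun φ => by
  rw [← mulVec_mulVec, mul_assoc]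
  exact (hA _).trans (mul_le_mul_of_nonneg_left (hB φ) hC)

lemma OpBound.one [DecidableEq ι] : OpBound (1 : Matrix ι ι ℝ) 1 := fun φ => by simp

lemma OpBound.pow [DecidableEq ι] {A : Matrix ι ι ℝ} {C : ℝ} (hC : 0 ≤ C) (hA : OpBound A C)
    (j : ℕ) : OpBound (A ^ j) (C ^ j) := by
  induction j with
  | zero => simpa using OpBound.one
  | succ j ih => rw [pow_succ, pow_succ]; exact ih.mul (pow_nonneg hC j) hA

lemma OpBound.col [DecidableEq ι] {A : Matrix ι ι ℝ} {C : ℝ} (hA : OpBound A C) (u : ι) :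
    l2 (fun k => A k u) ≤ C := by
  have := hA (Pi.single u 1)
  rw [l2_single, abs_one, mul_one] at this
  rw [mulVec_single_one] at this
  exact this

lemma OpBound.abs_apply_le [DecidableEq ι] {A : Matrix ι ι ℝ} {C : ℝ} (hA : OpBound A C)
    (k l : ι) : |A k l| ≤ C :=
  (abs_apply_le_l2 (fun k => A k l) k).trans (hA.col l)

/-- Cauchy–Schwarz in `|Aᵀφ|² = φ · A(Aᵀφ) ≤ |φ| C |Aᵀφ|`, then division by `|Aᵀφ|`. -/
lemma OpBound.transpose {A : Matrix ι ι ℝ} {C : ℝ} (hC : 0 ≤ C) (hA : OpBound A C) :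
    OpBound Aᵀ C := fun φ => by
  have h1 : l2 (Aᵀ *ᵥ φ) ^ 2 = φ ⬝ᵥ (A *ᵥ (Aᵀ *ᵥ φ)) := by
    rw [l2_sq, dotProduct_comm φ, dotProduct_mulVec, vecMul_transpose, dotProduct_comm]
  have h2 := (le_abs_self _).trans (abs_dotProduct_le_l2 φ (A *ᵥ (Aᵀ *ᵥ φ)))
  have h3 := hA (Aᵀ *ᵥ φ)
  have h4 := l2_nonneg φ
  have h5 := l2_nonneg (Aᵀ *ᵥ φ)
  have h6 : l2 (Aᵀ *ᵥ φ) * l2 (Aᵀ *ᵥ φ) ≤ (C * l2 φ) * l2 (Aᵀ *ᵥ φ) := by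
    rw [← sq, h1]
    nlinarith [mul_le_mul_of_nonneg_left h3 h4]
  rcases h5.eq_or_lt with h | h
  · rw [← h]; positivity
  · exact le_of_mul_le_mul_right h6 h

/-- Schur's test. -/
lemma opBound_of_sum_le {A : Matrix ι ι ℝ} {C : ℝ} (hC : 0 ≤ C) (hrow : ∀ k, ∑ l, |A k l| ≤ C)
    (hcol : ∀ l, ∑ k, |A k l| ≤ C) : OpBound A C := fun φ => by
  refine l2_le_of_sq_le (mul_nonneg hC (l2_nonneg φ)) ?_
  have h1 : ∀ k, (A *ᵥ φ) k * (A *ᵥ φ) k ≤ C * ∑ l, |A k l| * φ l ^ 2 := fun k => by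
    -- Cauchy–Schwarz after splitting `|A k l| |φ l|` as `√|A k l|` times `√|A k l| |φ l|`; the row
    -- sums bound the first factor, and the column sums serve after exchanging the summations.
    have hcs := Finset.sum_mul_sq_le_sq_mul_sq Finset.univ (fun l => √|A k l|)
      (fun l => √|A k l| * |φ l|)
    have e1 : ∀ l, √|A k l| * (√|A k l| * |φ l|) = |A k l * φ l| := fun l => by
      rw [← mul_assoc, Real.mul_self_sqrt (abs_nonneg _), abs_mul]
    have e2 : ∀ l, (√|A k l| * |φ l|) ^ 2 = |A k l| * φ l ^ 2 := fun l => by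
      rw [mul_pow, Real.sq_sqrt (abs_nonneg _), sq_abs]
    simp only [e1, e2, Real.sq_sqrt (abs_nonneg _)] at hcs
    have h0 : |(A *ᵥ φ) k| ≤ ∑ l, |A k l * φ l| := Finset.abs_sum_le_sum_abs _ _
    have h2 : (A *ᵥ φ) k * (A *ᵥ φ) k ≤ (∑ l, |A k l * φ l|) ^ 2 := by
      rw [← sq, ← sq_abs]
      gcongr
    exact h2.trans (hcs.trans (mul_le_mul_of_nonneg_right (hrow k)
      (Finset.sum_nonneg fun l _ => by positivity)))
  calc (A *ᵥ φ) ⬝ᵥ (A *ᵥ φ) ≤ ∑ k, C * ∑ l, |A k l| * φ l ^ 2 := Finset.sum_le_sum fun k _ => h1 k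
    _ = C * ∑ l, (∑ k, |A k l|) * φ l ^ 2 := by
      rw [← Finset.mul_sum, Finset.sum_comm]
      simp only [Finset.sum_mul]
    _ ≤ C * ∑ l, C * φ l ^ 2 := by
      gcongr with l
      exact hcol l
    _ = (C * l2 φ) ^ 2 := by
      rw [mul_pow, l2_sq, ← Finset.mul_sum]
      simp only [dotProduct, sq]; ring

lemma Coercive.mulVec_injective {A : Matrix ι ι ℝ} {m : ℝ} (hm : 0 < m) (h : Coercive m A) :
    Function.Injective A.mulVec := by
  intro φ ψ hφ
  have h1 := h (φ - ψ)
  rw [mulVec_sub, hφ, sub_self, dotProduct_zero] at h1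
  have h2 : (φ - ψ) ⬝ᵥ (φ - ψ) = 0 :=
    le_antisymm (by nlinarith) (by rw [← l2_sq]; positivity)
  exact sub_eq_zero.1 (dotProduct_self_eq_zero.1 h2)

lemma Coercive.l2_le {A : Matrix ι ι ℝ} {m : ℝ} (h : Coercive m A) (φ : ι → ℝ) :
    m * l2 φ ≤ l2 (A *ᵥ φ) := by
  have h1 := (h φ).trans ((le_abs_self _).trans (abs_dotProduct_le_l2 _ _))
  rw [← l2_sq] at h1
  rcases (l2_nonneg φ).eq_or_lt with h0 | h0
  · rw [← h0, mul_zero]; exact l2_nonneg _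
  · refine le_of_mul_le_mul_left ?_ h0
    calc l2 φ * (m * l2 φ) = m * l2 φ ^ 2 := by ring
      _ ≤ _ := h1

variable [DecidableEq ι]

lemma Coercive.isUnit {A : Matrix ι ι ℝ} {m : ℝ} (hm : 0 < m) (h : Coercive m A) : IsUnit A :=
  mulVec_injective_iff_isUnit.1 (h.mulVec_injective hm)

lemma Coercive.mul_inv {A : Matrix ι ι ℝ} {m : ℝ} (hm : 0 < m) (h : Coercive m A) :
    A * A⁻¹ = 1 := mul_nonsing_inv A ((isUnit_iff_isUnit_det A).1 (h.isUnit hm))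

lemma Coercive.inv_mul {A : Matrix ι ι ℝ} {m : ℝ} (hm : 0 < m) (h : Coercive m A) :
    A⁻¹ * A = 1 := nonsing_inv_mul A ((isUnit_iff_isUnit_det A).1 (h.isUnit hm))

lemma Coercive.opBound_inv {A : Matrix ι ι ℝ} {m : ℝ} (hm : 0 < m) (h : Coercive m A) :
    OpBound A⁻¹ (1 / m) := fun φ => by
  have h1 := h.l2_le (A⁻¹ *ᵥ φ)
  rw [mulVec_mulVec, h.mul_inv hm, one_mulVec] at h1
  rw [one_div_mul_eq_div, le_div_iff₀ hm]
  linarith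

/-- With `ψ = A⁻¹φ`, coercivity gives `φ · ψ ≥ m|ψ|²`, while `|φ| = |Aψ| ≤ M|ψ|`. Symmetry of `A`
plays no role. -/
lemma Coercive.inv {A : Matrix ι ι ℝ} {m M : ℝ} (hm : 0 < m) (hM : 0 < M) (h : Coercive m A)
    (hA : OpBound A M) : Coercive (m / M ^ 2) A⁻¹ := fun φ => by
  have h1 := h (A⁻¹ *ᵥ φ)
  have h2 := hA (A⁻¹ *ᵥ φ)
  rw [mulVec_mulVec, h.mul_inv hm, one_mulVec] at h1 h2
  rw [dotProduct_comm _ φ, ← l2_sq] at h1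
  rw [← l2_sq, div_mul_eq_mul_div, div_le_iff₀ (by positivity)]
  have h3 : l2 φ ^ 2 ≤ (M * l2 (A⁻¹ *ᵥ φ)) ^ 2 := by
    gcongr
    exact l2_nonneg φ
  nlinarith [mul_le_mul_of_nonneg_left h3 hm.le, mul_le_mul_of_nonneg_right h1 (sq_nonneg M)]

lemma Coercive.le_apply {A : Matrix ι ι ℝ} {m : ℝ} (h : Coercive m A) (k : ι) : m ≤ A k k := by
  have := h (Pi.single k 1)
  simpa using this

/-- Expanding, `|φ - cAφ|² ≤ (1 - 2cm + c²M²)|φ|²`; the value `c = m / M²` minimizes the factor and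
makes it `1 - m²/M² < 1`. This contraction drives the Neumann series, again without symmetry. -/
lemma OpBound.sub_smul {A : Matrix ι ι ℝ} {m M : ℝ} (hm : 0 < m) (hmM : m ≤ M)
    (h : Coercive m A) (hA : OpBound A M) :
    OpBound (1 - (m / M ^ 2) • A) √(1 - m ^ 2 / M ^ 2) := fun φ => by
  have hM : 0 < M := hm.trans_le hmM
  have hq : 0 ≤ 1 - m ^ 2 / M ^ 2 := by
    rw [sub_nonneg, div_le_one (by positivity)]
    gcongr
  refine l2_le_of_sq_le (mul_nonneg (Real.sqrt_nonneg _) (l2_nonneg _)) ?_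
  have h1 := h φ
  have h2 : (A *ᵥ φ) ⬝ᵥ (A *ᵥ φ) ≤ M ^ 2 * (φ ⬝ᵥ φ) := by
    rw [← l2_sq, ← l2_sq, ← mul_pow]
    have := l2_nonneg (A *ᵥ φ)
    gcongr
    exact hA φ
  rw [mul_pow, Real.sq_sqrt hq, l2_sq, sub_mulVec, one_mulVec, smul_mulVec]
  simp only [dotProduct_sub, sub_dotProduct, smul_dotProduct, dotProduct_smul, smul_eq_mul]
  rw [dotProduct_comm (A *ᵥ φ) φ]
  set c := m / M ^ 2 with hc
  have hc0 : 0 ≤ c := by positivity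
  have e : 1 - m ^ 2 / M ^ 2 = 1 - 2 * c * m + c ^ 2 * M ^ 2 := by
    rw [hc]; field_simp; ring
  rw [e]
  nlinarith [mul_le_mul_of_nonneg_left h1 hc0, mul_le_mul_of_nonneg_left h2 (sq_nonneg c)]

/-- A finite geometric sum with exact remainder, so that no convergence of series is needed. -/
lemma inv_sub_neumann {A : Matrix ι ι ℝ} {m : ℝ} (hm : 0 < m) (h : Coercive m A) (c : ℝ) (J : ℕ) :
    A⁻¹ - c • ∑ j ∈ Finset.range J, (1 - c • A) ^ j = A⁻¹ * (1 - c • A) ^ J := by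
  have h1 : (c • A) * ∑ j ∈ Finset.range J, (1 - c • A) ^ j = 1 - (1 - c • A) ^ J := by
    have := mul_neg_geom_sum (1 - c • A) J
    simpa using this
  calc A⁻¹ - c • ∑ j ∈ Finset.range J, (1 - c • A) ^ j
      = A⁻¹ - A⁻¹ * ((c • A) * ∑ j ∈ Finset.range J, (1 - c • A) ^ j) := by
        rw [← mul_assoc, mul_smul_comm, h.inv_mul hm, smul_mul_assoc, one_mul]
    _ = _ := by rw [h1, mul_sub, mul_one, sub_sub_cancel]

lemma opBound_diagonal {f : ι → ℝ} {C : ℝ} (hC : 0 ≤ C) (h : ∀ k, |f k| ≤ C) :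
    OpBound (diagonal f) C := by
  refine opBound_of_sum_le hC (fun k => ?_) (fun l => ?_)
  · rw [Finset.sum_eq_single k]
    · simpa using h k
    · intro l _ hl; simp [diagonal_apply_ne' _ hl]
    · simp
  · rw [Finset.sum_eq_single l]
    · simpa using h l
    · intro k _ hk; simp [diagonal_apply_ne _ hk]
    · simp

lemma coercive_diagonal {f : ι → ℝ} {m : ℝ} (h : ∀ k, m ≤ f k) : Coercive m (diagonal f) := by
  intro φ
  simp only [dotProduct, mulVec_diagonal, Finset.mul_sum]
  refine Finset.sum_le_sum fun k _ => ?_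
  nlinarith [mul_le_mul_of_nonneg_right (h k) (mul_self_nonneg (φ k))]

end OpBound

end

/-! ### Configurations of perturbed sites and the algebra of local matrices. -/

section

open Matrix

/-- A finite family of lattice sites with perturbations. -/
structure Config (d : ℕ) where
  ι : Type
  [fin : Fintype ι]
  [dec : DecidableEq ι]
  site : ι → Fin d → ℤ
  pt : ι → EuclideanSpace ℝ (Fin d)

attribute [instance] Config.fin Config.dec

namespace Config

variable {d : ℕ}

/-- Distinct sites, and perturbations in `[-1, 1]^d`. -/
structure Valid (c : Config d) : Prop where
  inj : Function.Injective c.site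
  mem : ∀ k j, c.pt k j ∈ Set.Icc (-1 : ℝ) 1

/-- An embedding of configurations, up to a translation of the sites. -/
structure IsEmb {c c' : Config d} (e : c.ι → c'.ι) : Prop where
  inj : Function.Injective e
  site : ∀ k l, c'.site (e k) - c'.site (e l) = c.site k - c.site l
  pt : ∀ k, c'.pt (e k) = c.pt k

/-- The sub-configuration of the sites at distance at most `r` of a given one. -/
def near (c : Config d) (u : c.ι) (r : ℕ) : Config d where
  ι := {k : c.ι // ‖c.site k - c.site u‖ ≤ r}
  fin := Fintype.ofFinite _
  dec := inferInstance
  site := fun k => c.site k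
  pt := fun k => c.pt k

/-- The inclusion of a sub-configuration. -/
def nearVal (c : Config d) (u : c.ι) (r : ℕ) : (c.near u r).ι → c.ι := Subtype.val

lemma nearVal_injective (c : Config d) (u : c.ι) (r : ℕ) : Function.Injective (c.nearVal u r) :=
  Subtype.val_injective

lemma norm_nearVal_le (c : Config d) (u : c.ι) (r : ℕ) (k : (c.near u r).ι) :
    ‖c.site (c.nearVal u r k) - c.site u‖ ≤ r := k.2

lemma Valid.near {c : Config d} (h : c.Valid) (u : c.ι) (r : ℕ) : (c.near u r).Valid :=
  ⟨fun _ _ hk => Subtype.ext (h.inj hk), fun k => h.mem (c.nearVal u r k)⟩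

lemma isEmb_near (c : Config d) (u : c.ι) (r : ℕ) :
    IsEmb (c.nearVal u r) :=
  ⟨c.nearVal_injective u r, fun _ _ => rfl, fun _ => rfl⟩

lemma Valid.card_near_le {c : Config d} (h : c.Valid) (u : c.ι) (r : ℕ) :
    Fintype.card (c.near u r).ι ≤ (2 * r + 1) ^ d := by
  have hmem : ∀ k : (c.near u r).ι, (c.site k.1 - c.site u) ∈
      Fintype.piFinset (fun _ : Fin d => Finset.Icc (-(r : ℤ)) r) := fun k => by
    rw [Fintype.mem_piFinset]
    intro j
    have h1 := (norm_le_pi_norm (c.site k.1 - c.site u) j).trans k.2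
    rw [Finset.mem_Icc, ← abs_le]
    rw [Int.norm_eq_abs] at h1
    exact_mod_cast h1
  have := Finset.card_le_card_of_injOn (s := Finset.univ)
    (fun k : (c.near u r).ι => c.site k.1 - c.site u) (fun k _ => hmem k)
    (fun k _ l _ hkl => Subtype.ext (h.inj (sub_left_injective hkl)))
  refine this.trans (le_of_eq ?_)
  simp
  congr 1
  omega

end Config

variable {d : ℕ}

/-- A square matrix attached to each configuration. -/
abbrev MatFun (d : ℕ) := ∀ c : Config d, Matrix c.ι c.ι ℝ

/-- The columns of the matrices are stable when sites are added far from the column index. -/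
def ColLocal (F : MatFun d) : Prop :=
  ∀ δ > (0 : ℝ), ∃ r : ℕ, ∀ (c c' : Config d) (e : c.ι → c'.ι), c.Valid → c'.Valid →
    Config.IsEmb e → ∀ u : c.ι,
      (∀ k : c'.ι, ‖c'.site k - c'.site (e u)‖ ≤ r → k ∈ Set.range e) →
      l2 ((fun k => F c' k (e u)) - extendZero e (fun k => F c k u)) ≤ δ

/-- The matrices are bounded on valid configurations. -/
def UnifBound (F : MatFun d) (C : ℝ) : Prop := ∀ c : Config d, c.Valid → OpBound (F c) C

lemma ColLocal.add {F G : MatFun d} (hF : ColLocal F) (hG : ColLocal G) :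
    ColLocal (fun c => F c + G c) := fun δ hδ => by
  obtain ⟨r, hr⟩ := hF (δ / 2) (half_pos hδ)
  obtain ⟨r', hr'⟩ := hG (δ / 2) (half_pos hδ)
  refine ⟨max r r', fun c c' e hc hc' he u hu => ?_⟩
  have h1 := hr c c' e hc hc' he u fun k hk => hu k (hk.trans (by simp))
  have h2 := hr' c c' e hc hc' he u fun k hk => hu k (hk.trans (by simp))
  have e1 : ((fun k => (F c' + G c') k (e u)) - extendZero e (fun k => (F c + G c) k u))
      = ((fun k => F c' k (e u)) - extendZero e (fun k => F c k u))
        + ((fun k => G c' k (e u)) - extendZero e (fun k => G c k u)) := by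
    have : (fun k => (F c + G c) k u) = (fun k => F c k u) + (fun k => G c k u) := rfl
    rw [this, extendZero_add]
    ext k
    simp only [Pi.sub_apply, Pi.add_apply, Matrix.add_apply]; ring
  rw [e1]
  linarith [l2_add_le ((fun k => F c' k (e u)) - extendZero e (fun k => F c k u))
    ((fun k => G c' k (e u)) - extendZero e (fun k => G c k u))]

lemma ColLocal.smul {F : MatFun d} (a : ℝ) (hF : ColLocal F) : ColLocal (fun c => a • F c) :=
    fun δ hδ => by
  obtain ⟨r, hr⟩ := hF (δ / (|a| + 1)) (by positivity)
  refine ⟨r, fun c c' e hc hc' he u hu => ?_⟩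
  have h1 := hr c c' e hc hc' he u hu
  have e1 : ((fun k => (a • F c') k (e u)) - extendZero e (fun k => (a • F c) k u))
      = a • ((fun k => F c' k (e u)) - extendZero e (fun k => F c k u)) := by
    have : (fun k => (a • F c) k u) = a • (fun k => F c k u) := rfl
    rw [this, extendZero_smul, smul_sub]
    rfl
  rw [e1, l2_smul]
  rw [le_div_iff₀ (by positivity)] at h1
  nlinarith [l2_nonneg ((fun k => F c' k (e u)) - extendZero e (fun k => F c k u))]

lemma ColLocal.one : ColLocal (d := d) (fun _ => 1) := fun δ hδ => by
  refine ⟨0, fun c c' e hc hc' he u hu => ?_⟩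
  have : ((fun k => (1 : Matrix c'.ι c'.ι ℝ) k (e u))
      - extendZero e (fun k => (1 : Matrix c.ι c.ι ℝ) k u)) = 0 := by
    have h1 : ∀ c : Config d, ∀ u : c.ι, (fun k => (1 : Matrix c.ι c.ι ℝ) k u) = Pi.single u 1 :=
      fun c u => by ext k; simp [Matrix.one_apply, Pi.single_apply]
    rw [h1, h1, extendZero_single he.inj, sub_self]
  rw [this, l2_zero]
  exact hδ.le

/-- The defect of a product column is `F c'` applied to the defect of the `G` column, plus `T g`,
where `T` measures how far `F` is from commuting with extension by zero and `g` is the column of `G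
c`. Locality of `G` lets `g` be replaced by a vector carried by the boundedly many sites near `u`.
On each coordinate vector there, `T` is a column defect of `F`. The two radii add up. -/
lemma ColLocal.mul {F G : MatFun d} {C C' : ℝ} (hFb : UnifBound F C) (hGb : UnifBound G C')
    (hF : ColLocal F) (hG : ColLocal G) : ColLocal (fun c => F c * G c) := by
  -- The bounds may be enlarged, so they are taken positive in order to divide by them.
  wlog hC : 0 < C generalizing C
  · exact this (C := |C| + 1)
      (fun c hc => (hFb c hc).mono ((le_abs_self C).trans (by linarith))) (by positivity)
  wlog hC' : 0 < C' generalizing C'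
  · exact this (C' := |C'| + 1)
      (fun c hc => (hGb c hc).mono ((le_abs_self C').trans (by linarith))) (by positivity)
  intro δ hδ
  -- Error budget: `δ/4` for the defect of `G`, `2C · δ/(4C) = δ/2` for truncating `g`, and `δ/4`
  -- for at most `(2 r₁ + 1) ^ d` column defects of `F`, each with coefficient at most `C'`.
  obtain ⟨r₁, hr₁⟩ := hG (δ / (4 * C)) (by positivity)
  have hB : (0 : ℝ) < ((2 * r₁ + 1) ^ d : ℕ) := by positivity
  obtain ⟨r₂, hr₂⟩ := hF (δ / (4 * C' * ((2 * r₁ + 1) ^ d : ℕ))) (by positivity)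
  refine ⟨r₁ + r₂, fun c c' e hc hc' he u hu => ?_⟩
  set g : c.ι → ℝ := fun k => G c k u with hg
  -- the intertwining defect
  set T : (c.ι → ℝ) → (c'.ι → ℝ) := fun φ => F c' *ᵥ extendZero e φ - extendZero e (F c *ᵥ φ)
    with hT
  have hTb : ∀ φ, l2 (T φ) ≤ 2 * C * l2 φ := fun φ => by
    have h1 := hFb c' hc' (extendZero e φ)
    have h2 := hFb c hc φ
    rw [l2_extendZero he.inj] at h1
    have h3 := l2_sub_le (F c' *ᵥ extendZero e φ) (extendZero e (F c *ᵥ φ))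
    rw [l2_extendZero he.inj] at h3
    simp only [hT]; linarith
  have hTadd : ∀ φ ψ, T (φ + ψ) = T φ + T ψ := fun φ ψ => by
    simp only [hT, extendZero_add, mulVec_add]; abel
  have hTsmul : ∀ (a : ℝ) φ, T (a • φ) = a • T φ := fun a φ => by
    simp only [hT, extendZero_smul, mulVec_smul, smul_sub]
  let Tl : (c.ι → ℝ) →ₗ[ℝ] (c'.ι → ℝ) := { toFun := T, map_add' := hTadd, map_smul' := hTsmul }
  have hu1 : ∀ k : c'.ι, ‖c'.site k - c'.site (e u)‖ ≤ r₁ → k ∈ Set.range e := fun k hk =>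
    hu k (hk.trans (by push_cast; linarith [(Nat.cast_nonneg r₂ : (0 : ℝ) ≤ r₂)]))
  have e1 : ((fun k => (F c' * G c') k (e u)) - extendZero e (fun k => (F c * G c) k u))
      = F c' *ᵥ ((fun k => G c' k (e u)) - extendZero e g) + T g := by
    have h1 : (fun k => (F c' * G c') k (e u)) = F c' *ᵥ (fun k => G c' k (e u)) := rfl
    have h2 : (fun k => (F c * G c) k u) = F c *ᵥ g := rfl
    rw [h1, h2, mulVec_sub]; simp only [hT]; abel
  have b1 : l2 (F c' *ᵥ ((fun k => G c' k (e u)) - extendZero e g)) ≤ δ / 4 := by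
    refine (hFb c' hc' _).trans ?_
    have := hr₁ c c' e hc hc' he u hu1
    calc C * l2 ((fun k => G c' k (e u)) - extendZero e g) ≤ C * (δ / (4 * C)) := by gcongr
      _ = δ / 4 := by field_simp
  -- truncation of `g`
  set w : c.near u r₁ |>.ι := ⟨u, by simp⟩ with hw
  set g₀ : (c.near u r₁).ι → ℝ := fun k => G (c.near u r₁) k w with hg₀
  have b2 : l2 (g - extendZero (c.nearVal u r₁) g₀) ≤ δ / (4 * C) :=
    hr₁ (c.near u r₁) c (c.nearVal u r₁) (hc.near u r₁) hc (c.isEmb_near u r₁) w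
      fun k hk => ⟨⟨k, hk⟩, rfl⟩
  have hg₀b : ∀ k, |g₀ k| ≤ C' := fun k => (hGb _ (hc.near u r₁)).abs_apply_le k w
  have b3 : l2 (T (extendZero (c.nearVal u r₁) g₀)) ≤ δ / 4 := by
    have h1 : extendZero (c.nearVal u r₁) g₀
        = ∑ k, g₀ k • (Pi.single (c.nearVal u r₁ k) 1 : c.ι → ℝ) := by
      conv_lhs => rw [← Finset.univ_sum_single g₀, extendZero_sum]
      refine Finset.sum_congr rfl fun k _ => ?_
      rw [extendZero_single (c.nearVal_injective u r₁), ← Pi.single_smul, smul_eq_mul, mul_one]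
    have h2 : T (extendZero (c.nearVal u r₁) g₀)
        = ∑ k, g₀ k • T (Pi.single (c.nearVal u r₁ k) 1) := by
      rw [h1]
      change Tl _ = _
      rw [map_sum]
      simp only [map_smul]; rfl
    have h3 : ∀ k : (c.near u r₁).ι, l2 (T (Pi.single (c.nearVal u r₁ k) 1))
        ≤ δ / (4 * C' * ((2 * r₁ + 1) ^ d : ℕ)) := fun k => by
      have := hr₂ c c' e hc hc' he (c.nearVal u r₁ k) fun k' hk' => hu k' (by
        have e2 : c'.site k' - c'.site (e u) = (c'.site k' - c'.site (e (c.nearVal u r₁ k)))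
          + (c.site (c.nearVal u r₁ k) - c.site u) := by rw [← he.site]; abel
        rw [e2]
        refine (norm_add_le _ _).trans ?_
        push_cast
        linarith [c.norm_nearVal_le u r₁ k])
      simp only [hT]
      rw [extendZero_single he.inj, mulVec_single_one, mulVec_single_one]
      exact this
    rw [h2]
    refine (l2_sum_le _ _).trans ?_
    calc ∑ k, l2 (g₀ k • T (Pi.single (c.nearVal u r₁ k) 1))
        ≤ ∑ k : (c.near u r₁).ι, C' * (δ / (4 * C' * ((2 * r₁ + 1) ^ d : ℕ))) := by
          refine Finset.sum_le_sum fun k _ => ?_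
          rw [l2_smul]
          exact mul_le_mul (hg₀b k) (h3 k) (l2_nonneg _) hC'.le
      _ = (Fintype.card (c.near u r₁).ι : ℝ) * (C' * (δ / (4 * C' * ((2 * r₁ + 1) ^ d : ℕ)))) := by
          rw [Finset.sum_const, nsmul_eq_mul, Finset.card_univ]
      _ ≤ ((2 * r₁ + 1) ^ d : ℕ) * (C' * (δ / (4 * C' * ((2 * r₁ + 1) ^ d : ℕ)))) := by
          gcongr
          exact hc.card_near_le u r₁
      _ = δ / 4 := by field_simp
  have b4 : l2 (T g) ≤ 3 * δ / 4 := by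
    have h1 : T g = T (g - extendZero (c.nearVal u r₁) g₀)
        + T (extendZero (c.nearVal u r₁) g₀) := by
      rw [← hTadd, sub_add_cancel]
    have h2 := hTb (g - extendZero (c.nearVal u r₁) g₀)
    have h3 : 2 * C * l2 (g - extendZero (c.nearVal u r₁) g₀)
        ≤ 2 * C * (δ / (4 * C)) := by gcongr
    have h4 : 2 * C * (δ / (4 * C)) = δ / 2 := by field_simp; ring
    have h5 := l2_add_le (T (g - extendZero (c.nearVal u r₁) g₀))
      (T (extendZero (c.nearVal u r₁) g₀))
    rw [h1]; linarith
  rw [e1]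
  linarith [l2_add_le (F c' *ᵥ ((fun k => G c' k (e u)) - extendZero e g)) (T g)]

/-- Operator norms bound columns, so a uniform approximation costs `δ/3` in each of the two
configurations and the approximant another `δ/3`. -/
lemma ColLocal.of_approx {F : MatFun d}
    (h : ∀ δ > (0 : ℝ), ∃ G : MatFun d, ColLocal G ∧ UnifBound (fun c => F c - G c) δ) :
    ColLocal F := fun δ hδ => by
  obtain ⟨G, hG, hFG⟩ := h (δ / 3) (by positivity)
  obtain ⟨r, hr⟩ := hG (δ / 3) (by positivity)
  refine ⟨r, fun c c' e hc hc' he u hu => ?_⟩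
  have h1 := hr c c' e hc hc' he u hu
  have h2 := (hFG c' hc').col (e u)
  have h3 := (hFG c hc).col u
  have e1 : ((fun k => F c' k (e u)) - extendZero e (fun k => F c k u))
      = ((fun k => (F c' - G c') k (e u)) - extendZero e (fun k => (F c - G c) k u))
        + ((fun k => G c' k (e u)) - extendZero e (fun k => G c k u)) := by
    have : (fun k => (F c - G c) k u) = (fun k => F c k u) - (fun k => G c k u) := rfl
    rw [this, extendZero_sub]
    ext k
    simp only [Pi.sub_apply, Pi.add_apply, Matrix.sub_apply]; ring
  have h4 := l2_sub_le (fun k => (F c' - G c') k (e u)) (extendZero e (fun k => (F c - G c) k u))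
  rw [l2_extendZero he.inj] at h4
  rw [e1]
  linarith [l2_add_le
    ((fun k => (F c' - G c') k (e u)) - extendZero e (fun k => (F c - G c) k u))
    ((fun k => G c' k (e u)) - extendZero e (fun k => G c k u))]

/-- A column of the diagonal part has a single entry, and its defect is one coordinate of the defect
of the full column. -/
lemma ColLocal.diag {F : MatFun d} (hF : ColLocal F) :
    ColLocal (fun c => diagonal (F c).diag) := fun δ hδ => by
  obtain ⟨r, hr⟩ := hF δ hδ
  refine ⟨r, fun c c' e hc hc' he u hu => ?_⟩
  have h0 : ∀ (c : Config d) (u : c.ι), (fun k => diagonal (F c).diag k u)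
      = Pi.single u (F c u u) := fun c u => by
    ext k
    by_cases h : k = u
    · subst h; simp
    · simp [h]
  rw [h0, h0, extendZero_single he.inj, ← Pi.single_sub, l2_single]
  have h1 := abs_apply_le_l2 ((fun k => F c' k (e u)) - extendZero e (fun k => F c k u)) (e u)
  rw [Pi.sub_apply, extendZero_apply he.inj] at h1
  exact h1.trans (hr c c' e hc hc' he u hu)

/-- Matrices attached to configurations that are bounded, that depend measurably on the
perturbations, and whose rows and columns essentially depend on the sites that are close to the
row and column indices. -/
structure IsLocal (F : MatFun d) : Prop where
  bound : ∃ C, UnifBound F C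
  col : ColLocal F
  row : ColLocal (fun c => (F c)ᵀ)
  meas : ∀ (ι : Type) [Fintype ι] [DecidableEq ι] (s : ι → Fin d → ℤ) (k l : ι),
    Measurable fun x : ι → EuclideanSpace ℝ (Fin d) => F ⟨ι, s, x⟩ k l

lemma IsLocal.bound_pos {F : MatFun d} (h : IsLocal F) : ∃ C, 0 < C ∧ UnifBound F C := by
  obtain ⟨C, hC⟩ := h.bound
  exact ⟨|C| + 1, by positivity, fun c hc => (hC c hc).mono (by linarith [le_abs_self C])⟩

namespace IsLocal

variable {F G : MatFun d}

lemma transpose (hF : IsLocal F) : IsLocal (fun c => (F c)ᵀ) where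
  bound := by
    obtain ⟨C, hC0, hC⟩ := hF.bound_pos
    exact ⟨C, fun c hc => (hC c hc).transpose hC0.le⟩
  col := hF.row
  row := by simpa using hF.col
  meas := fun ι _ _ s k l => hF.meas ι s l k

lemma add (hF : IsLocal F) (hG : IsLocal G) : IsLocal (fun c => F c + G c) where
  bound := by
    obtain ⟨C, hC⟩ := hF.bound
    obtain ⟨C', hC'⟩ := hG.bound
    exact ⟨C + C', fun c hc => (hC c hc).add (hC' c hc)⟩
  col := hF.col.add hG.col
  row := by simpa using hF.row.add hG.row
  meas := fun ι _ _ s k l => (hF.meas ι s k l).add (hG.meas ι s k l)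

lemma smul (a : ℝ) (hF : IsLocal F) : IsLocal (fun c => a • F c) where
  bound := by
    obtain ⟨C, hC⟩ := hF.bound
    exact ⟨|a| * C, fun c hc => (hC c hc).smul a⟩
  col := hF.col.smul a
  row := by simpa using hF.row.smul a
  meas := fun ι _ _ s k l => (hF.meas ι s k l).const_mul a

lemma sub (hF : IsLocal F) (hG : IsLocal G) : IsLocal (fun c => F c - G c) := by
  simpa [sub_eq_add_neg] using hF.add (hG.smul (-1))

lemma one : IsLocal (d := d) (fun _ => 1) where
  bound := ⟨1, fun _ _ => OpBound.one⟩
  col := ColLocal.one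
  row := by simpa using ColLocal.one
  meas := fun ι _ _ s k l => measurable_const (a := (1 : Matrix ι ι ℝ) k l)

lemma mul (hF : IsLocal F) (hG : IsLocal G) : IsLocal (fun c => F c * G c) := by
  obtain ⟨C, hC0, hC⟩ := hF.bound_pos
  obtain ⟨C', hC0', hC'⟩ := hG.bound_pos
  refine ⟨⟨C * C', fun c hc => (hC c hc).mul hC0.le (hC' c hc)⟩, hF.col.mul hC hC' hG.col, ?_, ?_⟩
  · simp only [transpose_mul]
    exact hG.row.mul (fun c hc => (hC' c hc).transpose hC0'.le)
      (fun c hc => (hC c hc).transpose hC0.le) hF.row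
  · intro ι _ _ s k l
    simp only [mul_apply]
    exact Finset.measurable_fun_sum (Finset.univ : Finset ι) fun j _ =>
      (hF.meas ι s k j).fun_mul (hG.meas ι s j l)

lemma pow (hF : IsLocal F) (j : ℕ) : IsLocal (fun c => F c ^ j) := by
  induction j with
  | zero => simpa using one
  | succ j ih => simpa [pow_succ] using ih.mul hF

lemma sum {α : Type*} {s : Finset α} {H : α → MatFun d} (h : ∀ a ∈ s, IsLocal (H a)) :
    IsLocal (fun c => ∑ a ∈ s, H a c) := by
  classical
  induction s using Finset.induction_on with
  | empty => simpa using one.smul 0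
  | insert a s ha ih =>
    simp only [Finset.sum_insert ha]
    exact (h a (by simp)).add (ih fun b hb => h b (by simp [hb]))

lemma diag (hF : IsLocal F) : IsLocal (fun c => diagonal (F c).diag) where
  bound := by
    obtain ⟨C, hC0, hC⟩ := hF.bound_pos
    exact ⟨C, fun c hc => opBound_diagonal hC0.le fun k => (hC c hc).abs_apply_le k k⟩
  col := hF.col.diag
  row := by simpa using hF.col.diag
  meas := fun ι _ _ s k l => by
    by_cases h : k = l
    · subst h; simpa using hF.meas ι s k k
    · simp [h]

/-- The partial Neumann sums are polynomials in a local matrix, hence local, and they approximate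
the inverse uniformly: the remainder is at most `q^J / m` with the same `q < 1` for all valid
configurations. -/
lemma colLocal_inv {m : ℝ} (hm : 0 < m) (hF : IsLocal F)
    (hc : ∀ c : Config d, c.Valid → Coercive m (F c)) : ColLocal (fun c => (F c)⁻¹) := by
  obtain ⟨C, hC0, hC⟩ := hF.bound_pos
  -- Enlarging `C` to at least `m` keeps `1 - m²/M²` nonnegative.
  set M := max C m
  have hM : UnifBound F M := fun c hc => (hC c hc).mono (le_max_left _ _)
  have hmM : m ≤ M := le_max_right _ _
  have hM0 : 0 < M := hm.trans_le hmM
  set q := √(1 - m ^ 2 / M ^ 2)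
  have hq : q < 1 := by
    rw [Real.sqrt_lt' one_pos]
    have : 0 < m ^ 2 / M ^ 2 := by positivity
    linarith
  have hq0 : 0 ≤ q := Real.sqrt_nonneg _
  refine ColLocal.of_approx fun δ hδ => ?_
  obtain ⟨J, hJ⟩ := exists_pow_lt_of_lt_one (show 0 < δ * m by positivity) hq
  refine ⟨fun c => (m / M ^ 2) • ∑ j ∈ Finset.range J, (1 - (m / M ^ 2) • F c) ^ j, ?_, ?_⟩
  · exact ((sum fun j _ => (one.sub (hF.smul _)).pow j).smul _).col
  · intro c hcv
    simp only [inv_sub_neumann hm (hc c hcv)]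
    refine (((hc c hcv).opBound_inv hm).mul (by positivity)
      ((OpBound.sub_smul hm hmM (hc c hcv) (hM c hcv)).pow hq0 J)).mono ?_
    rw [one_div_mul_eq_div, div_le_iff₀ hm]
    exact hJ.le

lemma coercive_transpose {ι : Type*} [Fintype ι] {A : Matrix ι ι ℝ} {m : ℝ} (h : Coercive m A) :
    Coercive m Aᵀ := fun φ => by
  rw [mulVec_transpose, dotProduct_comm φ (φ ᵥ* A), ← dotProduct_mulVec]
  exact h φ

lemma inv {m : ℝ} (hm : 0 < m) (hF : IsLocal F)
    (hc : ∀ c : Config d, c.Valid → Coercive m (F c)) : IsLocal (fun c => (F c)⁻¹) where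
  bound := ⟨1 / m, fun c hcv => (hc c hcv).opBound_inv hm⟩
  col := hF.colLocal_inv hm hc
  row := by
    simp only [transpose_nonsing_inv]
    exact hF.transpose.colLocal_inv hm fun c hcv => coercive_transpose (hc c hcv)
  meas := fun ι _ _ s k l => by
    have hdet : ∀ B : (ι → EuclideanSpace ℝ (Fin d)) → Matrix ι ι ℝ,
        (∀ k l, Measurable fun x => B x k l) → Measurable fun x => (B x).det := fun B hB => by
      simp only [det_apply]
      exact Finset.measurable_fun_sum _ fun σ _ =>
        (Finset.measurable_fun_prod _ fun i _ => hB _ _).const_smul _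
    -- Cramer's rule makes each entry of the inverse a quotient of determinants, hence measurable,
    -- also where the matrix is singular.
    have h1 : ∀ x : ι → EuclideanSpace ℝ (Fin d), (F ⟨ι, s, x⟩)⁻¹ k l
        = ((F ⟨ι, s, x⟩).det)⁻¹ * ((F ⟨ι, s, x⟩).updateRow l (Pi.single k 1)).det := fun x => by
      rw [inv_def, Ring.inverse_eq_inv', Matrix.smul_apply, adjugate_apply, smul_eq_mul]
    simp only [h1]
    refine (hdet (fun x => F ⟨ι, s, x⟩) (hF.meas ι s)).inv.mul (hdet _ fun i j => ?_)
    by_cases h : i = l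
    · subst h; simp
    · simpa [updateRow_apply, h] using hF.meas ι s i j

end IsLocal

end

/-! ### Decaying functions on perturbed lattices give local matrices. -/

section

open Matrix

variable {d : ℕ}

/-- Comparison with the lattice sum of `‖s‖^{-(d+1)}`, whose exponent exceeds the rank `d`. The
comparison leaves out the origin, where the inverse norm takes the value `0`. -/
lemma summable_inv_one_add_norm_pow (d : ℕ) :
    Summable fun s : Fin d → ℤ => 1 / (1 + ‖s‖ ^ (d + 1)) := by
  let Λ : Submodule ℤ (Fin d → ℝ) := Submodule.span ℤ (Set.range (Pi.basisFun ℝ (Fin d)))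
  have hrank : Module.finrank ℤ Λ = d := by
    have := ZLattice.rank ℝ Λ
    simpa using this
  have hmem : ∀ s : Fin d → ℤ, (fun j => (s j : ℝ)) ∈ Λ := fun s => by
    have : (fun j => (s j : ℝ)) = ∑ j, s j • Pi.basisFun ℝ (Fin d) j := by
      ext i
      simp [Finset.sum_apply, Pi.single_apply]
    rw [this]
    exact Submodule.sum_mem _ fun j _ => Submodule.smul_mem _ _ (Submodule.subset_span ⟨j, rfl⟩)
  have hnorm : ∀ s : Fin d → ℤ, ‖(⟨fun j => (s j : ℝ), hmem s⟩ : Λ)‖ = ‖s‖ := fun s => by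
    change ‖(fun j => (s j : ℝ))‖ = ‖s‖
    simp [Pi.norm_def, nnnorm, Int.norm_eq_abs, Real.norm_eq_abs]
  have h1 := ZLattice.summable_norm_pow_inv Λ (d + 1) (by omega)
  have h2 : Summable fun s : Fin d → ℤ => ‖s‖⁻¹ ^ (d + 1) := by
    have := h1.comp_injective (i := fun s : Fin d → ℤ => (⟨fun j => (s j : ℝ), hmem s⟩ : Λ))
      (fun s t hst => by
        ext j
        have h := congrFun (congrArg Subtype.val hst) j
        exact Int.cast_injective (α := ℝ) h)
    simpa only [Function.comp_def, hnorm] using this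
  refine Summable.of_norm_bounded_eventually h2 ?_
  rw [Filter.eventually_cofinite]
  refine (Set.finite_singleton (0 : Fin d → ℤ)).subset fun s hs => ?_
  by_contra h
  refine hs ?_
  have hpos : 0 < ‖s‖ := norm_pos_iff.2 h
  rw [Real.norm_of_nonneg (by positivity), inv_pow, one_div]
  gcongr
  linarith

/-- A lattice site as a point of the Euclidean space. -/
def intPoint (s : Fin d → ℤ) : EuclideanSpace ℝ (Fin d) := WithLp.toLp 2 fun j => (s j : ℝ)

/-- The difference of the perturbed positions of two sites. -/
def Config.disp (c : Config d) (ε : ℝ) (k l : c.ι) : EuclideanSpace ℝ (Fin d) :=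
  intPoint (c.site k - c.site l) + ε • (c.pt k - c.pt l)

/-- In each coordinate an integer `z ≠ 0` is moved by at most `2ε ≤ 2ε|z|`, so at least `(1 -
2ε)|z|` remains. The left norm is the sup norm of the lattice, the right one is Euclidean. This is
where `ε < 1/2` keeps the points apart. -/
lemma Config.Valid.norm_disp_ge {c : Config d} (hc : c.Valid) {ε : ℝ}
    (hε : ε ∈ Set.Ico (0 : ℝ) (1 / 2)) (k l : c.ι) :
    (1 - 2 * ε) * ‖c.site k - c.site l‖ ≤ ‖c.disp ε k l‖ := by
  have hε0 : 0 < 1 - 2 * ε := by linarith [hε.2]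
  rw [mul_comm, ← le_div_iff₀ hε0, pi_norm_le_iff_of_nonneg (by positivity)]
  intro j
  rw [le_div_iff₀ hε0]
  refine le_trans ?_ (PiLp.norm_apply_le (c.disp ε k l) j)
  have e1 : (c.disp ε k l) j = ((c.site k j - c.site l j : ℤ) : ℝ) + ε * (c.pt k j - c.pt l j) := by
    simp [Config.disp, intPoint]
  rw [e1, Pi.sub_apply, Int.norm_eq_abs, Real.norm_eq_abs]
  set z : ℤ := c.site k j - c.site l j
  have hk := hc.mem k j
  have hl := hc.mem l j
  have h2 : |ε * (c.pt k j - c.pt l j)| ≤ 2 * ε := by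
    rw [abs_mul, abs_of_nonneg hε.1, mul_comm]
    refine mul_le_mul_of_nonneg_right ?_ hε.1
    rw [abs_le]
    constructor <;> linarith [hk.1, hk.2, hl.1, hl.2]
  by_cases hz : z = 0
  · rw [hz]; simp; positivity
  · have h1 : (1 : ℝ) ≤ |(z : ℝ)| := by exact_mod_cast Int.one_le_abs hz
    have h3 : |(z : ℝ)| - |ε * (c.pt k j - c.pt l j)| ≤ |(z : ℝ) + ε * (c.pt k j - c.pt l j)| := by
      have := abs_sub_abs_le_abs_sub (z : ℝ) (-(ε * (c.pt k j - c.pt l j)))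
      rwa [abs_neg, sub_neg_eq_add] at this
    nlinarith [hε.1]

/-- The covariance type matrices `(h(z_k - z_l))` of the perturbed positions. -/
def baseMat (h : EuclideanSpace ℝ (Fin d) → ℝ) (ε : ℝ) : MatFun d :=
  fun c => Matrix.of fun k l => h (c.disp ε k l)

lemma Config.IsEmb.disp {c c' : Config d} {e : c.ι → c'.ι} (he : Config.IsEmb e) (ε : ℝ)
    (k l : c.ι) : c'.disp ε (e k) (e l) = c.disp ε k l := by
  simp only [Config.disp, he.site, he.pt]

lemma Config.Valid.sum_le_tsum {c : Config d} (hc : c.Valid) (u : c.ι) {w : (Fin d → ℤ) → ℝ}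
    (hw : Summable w) (hw0 : ∀ s, 0 ≤ w s) : ∑ k, w (c.site k - c.site u) ≤ ∑' s, w s := by
  have hinj : Function.Injective fun k : c.ι => c.site k - c.site u :=
    fun k l hkl => hc.inj (sub_left_injective hkl)
  have := hw.sum_le_tsum (Finset.univ.map ⟨_, hinj⟩) fun s _ => hw0 s
  simpa [Finset.sum_map] using this

/-- The decay condition of the covariance functions and of their derivatives. -/
def HasDecay (h : EuclideanSpace ℝ (Fin d) → ℝ) : Prop :=
  ∃ C : ℝ, ∀ t, |h t| ≤ C / (1 + ‖t‖ ^ (d + 1))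

/-- Transfers the decay from the perturbed positions to the lattice sites, where it becomes
summable; the separation factor `1 - 2ε` is absorbed in the constant. -/
lemma HasDecay.exists_le {h : EuclideanSpace ℝ (Fin d) → ℝ} (hh : HasDecay h) {ε : ℝ}
    (hε : ε ∈ Set.Ico (0 : ℝ) (1 / 2)) : ∃ C, 0 < C ∧ ∀ (c : Config d), c.Valid → ∀ k l : c.ι,
      |h (c.disp ε k l)| ≤ C * (1 / (1 + ‖c.site k - c.site l‖ ^ (d + 1))) := by
  obtain ⟨C, hC⟩ := hh
  have hε0 : 0 < 1 - 2 * ε := by linarith [hε.2]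
  refine ⟨(|C| + 1) / (1 - 2 * ε) ^ (d + 1), by positivity, fun c hc k l => (hC _).trans ?_⟩
  have h1 := hc.norm_disp_ge hε k l
  have h2 : ((1 - 2 * ε) * ‖c.site k - c.site l‖) ^ (d + 1) ≤ ‖c.disp ε k l‖ ^ (d + 1) := by
    gcongr
  rw [mul_pow] at h2
  have h3 : (1 - 2 * ε) ^ (d + 1) ≤ 1 := pow_le_one₀ hε0.le (by linarith [hε.1])
  rw [div_mul_div_comm, mul_one]
  refine div_le_div₀ (by positivity) (by linarith [le_abs_self C]) (by positivity) ?_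
  rw [mul_add, mul_one]
  linarith

lemma disp_swap (c : Config d) (ε : ℝ) (k l : c.ι) : c.disp ε l k = -c.disp ε k l := by
  ext j
  simp [Config.disp, intPoint]
  ring

lemma HasDecay.neg {h : EuclideanSpace ℝ (Fin d) → ℝ} (hh : HasDecay h) :
    HasDecay fun t => h (-t) := by
  obtain ⟨C, hC⟩ := hh
  exact ⟨C, fun t => by simpa using hC (-t)⟩

lemma transpose_baseMat (h : EuclideanSpace ℝ (Fin d) → ℝ) (ε : ℝ) (c : Config d) :
    (baseMat h ε c)ᵀ = baseMat (fun t => h (-t)) ε c := by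
  ext k l
  simp [baseMat, disp_swap c ε k l]

/-- On the image of the embedding the entries coincide exactly, as they depend only on differences
of positions. The other entries lie beyond radius `r` and are controlled by the tail of the lattice
sum. -/
lemma HasDecay.colLocal {h : EuclideanSpace ℝ (Fin d) → ℝ} (hh : HasDecay h) {ε : ℝ}
    (hε : ε ∈ Set.Ico (0 : ℝ) (1 / 2)) : ColLocal (baseMat h ε) := by
  obtain ⟨C, hC0, hC⟩ := hh.exists_le hε
  intro δ hδ
  obtain ⟨T, hT⟩ := summable_iff_vanishing_norm.1 (summable_inv_one_add_norm_pow d) (δ / C)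
    (by positivity)
  obtain ⟨r, hr⟩ : ∃ r : ℕ, ∀ s ∈ T, ‖s‖ ≤ r := by
    obtain ⟨R, hR⟩ := (T.finite_toSet.image fun s => ‖s‖).bddAbove
    obtain ⟨r, hr⟩ := exists_nat_ge R
    exact ⟨r, fun s hs => (hR ⟨s, hs, rfl⟩).trans hr⟩
  refine ⟨r, fun c c' e hc hc' he u hu => ?_⟩
  classical
  have hinj : Function.Injective fun k : c'.ι => c'.site k - c'.site (e u) :=
    fun k l hkl => hc'.inj (sub_left_injective hkl)
  set S : Finset c'.ι := Finset.univ.filter fun k => k ∉ Set.range e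
  have h1 : ∀ k, |((fun k => baseMat h ε c' k (e u))
      - extendZero e (fun k => baseMat h ε c k u)) k|
      ≤ if k ∈ S then C * (1 / (1 + ‖c'.site k - c'.site (e u)‖ ^ (d + 1))) else 0 := fun k => by
    by_cases hk : k ∈ Set.range e
    · rw [if_neg (by simpa [S] using hk)]
      obtain ⟨k, rfl⟩ := hk
      rw [Pi.sub_apply, extendZero_apply he.inj]
      simp [baseMat, he.disp]
    · rw [if_pos (by simpa [S] using hk), Pi.sub_apply, extendZero_apply_of_notMem _ hk, sub_zero]
      exact hC c' hc' k (e u)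
  refine (l2_le_sum_abs _).trans ((Finset.sum_le_sum fun k _ => h1 k).trans ?_)
  rw [Finset.sum_ite_mem, Finset.univ_inter, ← Finset.mul_sum]
  have h2 := hT (S.map ⟨_, hinj⟩) (by
    rw [Finset.disjoint_left]
    intro s hs hsT
    simp only [Finset.mem_map, Function.Embedding.coeFn_mk] at hs
    obtain ⟨k, hk, rfl⟩ := hs
    have : k ∉ Set.range e := by simpa [S] using hk
    exact this (hu k (hr _ hsT)))
  rw [Finset.sum_map] at h2
  simp only [Function.Embedding.coeFn_mk] at h2
  rw [Real.norm_of_nonneg (Finset.sum_nonneg fun k _ => by positivity), lt_div_iff₀ hC0] at h2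
  linarith

lemma HasDecay.unifBound {h : EuclideanSpace ℝ (Fin d) → ℝ} (hh : HasDecay h) {ε : ℝ}
    (hε : ε ∈ Set.Ico (0 : ℝ) (1 / 2)) : ∃ C, UnifBound (baseMat h ε) C := by
  obtain ⟨C, hC0, hC⟩ := hh.exists_le hε
  have hs := summable_inv_one_add_norm_pow d
  refine ⟨C * ∑' s : Fin d → ℤ, 1 / (1 + ‖s‖ ^ (d + 1)), fun c hc => ?_⟩
  refine opBound_of_sum_le (mul_nonneg hC0.le (tsum_nonneg fun s => by positivity))
    (fun k => ?_) (fun l => ?_)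
  · refine (Finset.sum_le_sum fun l _ => hC c hc k l).trans ?_
    rw [← Finset.mul_sum]
    simp only [norm_sub_rev (c.site k)]
    exact mul_le_mul_of_nonneg_left (hc.sum_le_tsum k hs fun s => by positivity) hC0.le
  · refine (Finset.sum_le_sum fun k _ => hC c hc k l).trans ?_
    rw [← Finset.mul_sum]
    exact mul_le_mul_of_nonneg_left (hc.sum_le_tsum l hs fun s => by positivity) hC0.le

lemma HasDecay.isLocal {h : EuclideanSpace ℝ (Fin d) → ℝ} (hh : HasDecay h) (hm : Measurable h)
    {ε : ℝ} (hε : ε ∈ Set.Ico (0 : ℝ) (1 / 2)) : IsLocal (baseMat h ε) where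
  bound := hh.unifBound hε
  col := hh.colLocal hε
  row := by
    simp only [transpose_baseMat]
    exact hh.neg.colLocal hε
  meas := fun ι _ _ s k l => by
    simp only [baseMat, Matrix.of_apply, Config.disp]
    refine hm.comp ?_
    fun_prop

end

/-! ### Fourier lower bound: uniform coercivity of the covariance matrices. -/

section

open Matrix

variable {d : ℕ}

/-- The inverse Fourier transform `∫ H(f) e^{i f·t} df`. -/
def invFourier (H : EuclideanSpace ℝ (Fin d) → ℂ) (t : EuclideanSpace ℝ (Fin d)) : ℂ :=
  ∫ f, H f * Complex.exp (Complex.I * ((inner ℝ f t : ℝ) : ℂ))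

/-- The trigonometric polynomial `∑ α_k e^{i f·z_k}`. -/
def trigSum {ι : Type*} [Fintype ι] (α : ι → ℝ) (z : ι → EuclideanSpace ℝ (Fin d))
    (f : EuclideanSpace ℝ (Fin d)) : ℂ :=
  ∑ k, (α k : ℂ) * Complex.exp (Complex.I * ((inner ℝ f (z k) : ℝ) : ℂ))

lemma norm_exp_I_mul_ofReal_eq_one (x : ℝ) : ‖Complex.exp (Complex.I * (x : ℂ))‖ = 1 := by
  rw [mul_comm, Complex.norm_exp_ofReal_mul_I]

lemma integrable_mul_exp {H : EuclideanSpace ℝ (Fin d) → ℂ} (hH : Integrable H)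
    (t : EuclideanSpace ℝ (Fin d)) :
    Integrable fun f => H f * Complex.exp (Complex.I * ((inner ℝ f t : ℝ) : ℂ)) := by
  refine hH.mul_bdd (c := 1) ?_ ?_
  · exact Continuous.aestronglyMeasurable (by fun_prop)
  · exact Eventually.of_forall fun f => (norm_exp_I_mul_ofReal_eq_one _).le

lemma normSq_trigSum {ι : Type*} [Fintype ι] (α : ι → ℝ) (z : ι → EuclideanSpace ℝ (Fin d))
    (f : EuclideanSpace ℝ (Fin d)) : (Complex.normSq (trigSum α z f) : ℂ)
      = ∑ k, ∑ l, ((α k * α l : ℝ) : ℂ)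
        * Complex.exp (Complex.I * ((inner ℝ f (z k - z l) : ℝ) : ℂ)) := by
  rw [← Complex.mul_conj, trigSum, map_sum, Finset.sum_mul_sum]
  refine Finset.sum_congr rfl fun k _ => Finset.sum_congr rfl fun l _ => ?_
  rw [map_mul, Complex.conj_ofReal, ← Complex.exp_conj, map_mul, Complex.conj_I,
    Complex.conj_ofReal, inner_sub_right, Complex.ofReal_sub, mul_sub, sub_eq_add_neg,
    Complex.exp_add, neg_mul]
  push_cast
  ring

lemma quadForm_invFourier {ι : Type*} [Fintype ι] {H : EuclideanSpace ℝ (Fin d) → ℂ}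
    (hH : Integrable H) (α : ι → ℝ) (z : ι → EuclideanSpace ℝ (Fin d)) :
    ∑ k, ∑ l, ((α k * α l : ℝ) : ℂ) * invFourier H (z k - z l)
      = ∫ f, H f * (Complex.normSq (trigSum α z f) : ℂ) := by
  simp only [normSq_trigSum, Finset.mul_sum]
  rw [integral_finsetSum]
  · refine Finset.sum_congr rfl fun k _ => ?_
    rw [integral_finsetSum]
    · refine Finset.sum_congr rfl fun l _ => ?_
      rw [invFourier, ← integral_const_mul]
      congr 1 with f
      ring
    · intro l _
      refine ((integrable_mul_exp hH (z k - z l)).const_mul ((α k * α l : ℝ) : ℂ)).congr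
        (Eventually.of_forall fun f => ?_)
      simp only; ring
  · intro k _
    refine integrable_finsetSum _ fun l _ => ?_
    refine ((integrable_mul_exp hH (z k - z l)).const_mul ((α k * α l : ℝ) : ℂ)).congr
      (Eventually.of_forall fun f => ?_)
    simp only; ring

lemma continuous_normSq_trigSum {ι : Type*} [Fintype ι] (α : ι → ℝ)
    (z : ι → EuclideanSpace ℝ (Fin d)) : Continuous fun f => Complex.normSq (trigSum α z f) := by
  unfold trigSum
  exact Complex.continuous_normSq.comp (by fun_prop)

lemma normSq_trigSum_le {ι : Type*} [Fintype ι] (α : ι → ℝ) (z : ι → EuclideanSpace ℝ (Fin d))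
    (f : EuclideanSpace ℝ (Fin d)) : Complex.normSq (trigSum α z f) ≤ (∑ k, |α k|) ^ 2 := by
  rw [Complex.normSq_eq_norm_sq]
  gcongr
  refine (norm_sum_le _ _).trans (Finset.sum_le_sum fun k _ => ?_)
  rw [norm_mul, norm_exp_I_mul_ofReal_eq_one, mul_one, Complex.norm_real, Real.norm_eq_abs]

lemma integrable_mul_normSq {ι : Type*} [Fintype ι] {H : EuclideanSpace ℝ (Fin d) → ℂ}
    (hH : Integrable H) (α : ι → ℝ) (z : ι → EuclideanSpace ℝ (Fin d)) :
    Integrable fun f => H f * (Complex.normSq (trigSum α z f) : ℂ) := by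
  refine hH.mul_bdd (c := (∑ k, |α k|) ^ 2) ?_ ?_
  · exact (Complex.continuous_ofReal.comp (continuous_normSq_trigSum α z)).aestronglyMeasurable
  · refine Eventually.of_forall fun f => ?_
    rw [Complex.norm_real, Real.norm_of_nonneg (Complex.normSq_nonneg _)]
    exact normSq_trigSum_le α z f

/-- The quadratic form of an inverse Fourier transform, in real terms. -/
lemma quadForm_invFourier_re {ι : Type*} [Fintype ι] {H : EuclideanSpace ℝ (Fin d) → ℂ}
    (hH : Integrable H) (α : ι → ℝ) (z : ι → EuclideanSpace ℝ (Fin d)) :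
    ∑ k, ∑ l, α k * α l * (invFourier H (z k - z l)).re
      = ∫ f, (H f).re * Complex.normSq (trigSum α z f) := by
  have h := congrArg Complex.re (quadForm_invFourier hH α z)
  have h2 : (∫ f, H f * (Complex.normSq (trigSum α z f) : ℂ)).re
      = ∫ f, (H f * (Complex.normSq (trigSum α z f) : ℂ)).re :=
    (integral_re (integrable_mul_normSq hH α z)).symm
  rw [h2] at h
  simpa only [Complex.re_sum, Complex.re_ofReal_mul, Complex.re_mul_ofReal] using h

/-- A smooth nonnegative function with compact support has a rapidly decaying inverse Fourier
transform. -/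
lemma exists_norm_invFourier_le {g : EuclideanSpace ℝ (Fin d) → ℂ} (hg : HasCompactSupport g)
    (hs : ContDiff ℝ (⊤ : ℕ∞) g) (j : ℕ) : ∃ C, 0 < C ∧ ∀ t, ‖t‖ ^ j * ‖invFourier g t‖ ≤ C := by
  obtain ⟨C, hC0, hC⟩ := (FourierTransform.fourier (hg.toSchwartzMap hs)).decay j 0
  have hpi : 0 < 2 * Real.pi := by positivity
  refine ⟨(2 * Real.pi) ^ j * C, by positivity, fun t => ?_⟩
  -- Evaluation at `-t/(2π)` converts the kernel `e^{-2πi f·s}` of the library transform into `e^{i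
  -- f·t}`; this accounts for the factor `(2π)^j`.
  have h1 := hC (-(2 * Real.pi)⁻¹ • t)
  rw [norm_iteratedFDeriv_zero, SchwartzMap.fourier_coe, Real.fourier_eq', norm_smul, norm_neg,
    norm_inv, Real.norm_of_nonneg hpi.le, mul_pow, inv_pow] at h1
  have h2 : (∫ v, Complex.exp (((-2 * Real.pi * inner ℝ v (-(2 * Real.pi)⁻¹ • t) : ℝ) : ℂ)
      * Complex.I) • (hg.toSchwartzMap hs) v) = invFourier g t := by
    unfold invFourier
    congr 1 with v
    rw [inner_smul_right, smul_eq_mul, mul_comm]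
    have : -2 * Real.pi * (-(2 * Real.pi)⁻¹ * inner ℝ v t) = inner ℝ v t := by field_simp
    rw [this, mul_comm Complex.I]
    rfl
  rw [h2, mul_assoc, inv_mul_le_iff₀ (by positivity)] at h1
  exact h1

lemma invFourier_comp_inv_smul (g : EuclideanSpace ℝ (Fin d) → ℂ) {r : ℝ} (hr : 0 < r)
    (t : EuclideanSpace ℝ (Fin d)) :
    invFourier (fun f => g (r⁻¹ • f)) t = (r ^ d : ℝ) • invFourier g (r • t) := by
  unfold invFourier
  have := Measure.integral_comp_inv_smul_of_nonneg volume
    (fun f : EuclideanSpace ℝ (Fin d) => g f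
      * Complex.exp (Complex.I * ((inner ℝ f (r • t) : ℝ) : ℂ))) hr.le
  rw [finrank_euclideanSpace_fin] at this
  rw [← this]
  congr 1 with f
  rw [real_inner_smul_left, inner_smul_right, ← mul_assoc, inv_mul_cancel₀ hr.ne', one_mul]

/-- The perturbed position of a site. -/
def Config.pos (c : Config d) (ε : ℝ) (k : c.ι) : EuclideanSpace ℝ (Fin d) :=
  intPoint (c.site k) + ε • c.pt k

lemma Config.disp_eq (c : Config d) (ε : ℝ) (k l : c.ι) :
    c.disp ε k l = c.pos ε k - c.pos ε l := by
  ext j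
  simp [Config.disp, Config.pos, intPoint]
  ring

lemma quadForm_baseMat (h : EuclideanSpace ℝ (Fin d) → ℝ) (ε : ℝ) (c : Config d) (φ : c.ι → ℝ) :
    φ ⬝ᵥ (baseMat h ε c *ᵥ φ) = ∑ k, ∑ l, φ k * φ l * h (c.pos ε k - c.pos ε l) := by
  simp only [dotProduct, mulVec, baseMat, Matrix.of_apply, Config.disp_eq, Finset.mul_sum]
  refine Finset.sum_congr rfl fun k _ => Finset.sum_congr rfl fun l _ => by ring

/-- A dilated rapidly decaying function gives diagonally dominant matrices. -/
lemma exists_coercive_of_decay {h : EuclideanSpace ℝ (Fin d) → ℝ} (h0 : 0 < h 0) {C : ℝ}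
    (hC0 : 0 < C) (hC : ∀ t, ‖t‖ ^ (d + 1) * |h t| ≤ C) {ε : ℝ}
    (hε : ε ∈ Set.Ico (0 : ℝ) (1 / 2)) :
    ∃ r : ℝ, 0 < r ∧ ∀ c : Config d, c.Valid → Coercive (h 0 / 2)
      (baseMat (fun t => h (r • t)) ε c) := by
  have hε0 : 0 < 1 - 2 * ε := by linarith [hε.2]
  set W : ℝ := ∑' s : Fin d → ℤ, 1 / (1 + ‖s‖ ^ (d + 1)) with hW
  have hs := summable_inv_one_add_norm_pow d
  have hW0 : 0 ≤ W := tsum_nonneg fun s => by positivity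
  set B : ℝ := 2 * C / (1 - 2 * ε) ^ (d + 1) with hB
  have hB0 : 0 < B := by positivity
  -- The row sums off the diagonal will be at most `B W / r`, and `r` is taken large enough to bring
  -- them below half of the diagonal value `h 0`.
  obtain ⟨r, hr⟩ := exists_gt (max 1 (2 * (B * W) / h 0))
  have hr1 : 1 < r := (le_max_left _ _).trans_lt hr
  have hr0 : 0 < r := by linarith
  have hr2 : B * W / r ≤ h 0 / 2 := by
    have := (le_max_right _ _).trans_lt hr
    rw [div_lt_iff₀ h0] at this
    rw [div_le_div_iff₀ hr0 two_pos]
    linarith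
  refine ⟨r, hr0, fun c hc => ?_⟩
  set D := baseMat (fun t => h (r • t)) ε c
  have hoff : ∀ k l, k ≠ l → |D k l| ≤ B / r * (1 / (1 + ‖c.site k - c.site l‖ ^ (d + 1))) := by
    intro k l hkl
    have h1 := hc.norm_disp_ge hε k l
    have hn : (1 : ℝ) ≤ ‖c.site k - c.site l‖ := by
      have hne : c.site k - c.site l ≠ 0 := sub_ne_zero.2 fun h => hkl (hc.inj h)
      obtain ⟨j, hj⟩ := Function.ne_iff.1 hne
      refine le_trans ?_ (norm_le_pi_norm _ j)
      rw [Int.norm_eq_abs]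
      exact_mod_cast Int.one_le_abs hj
    set s := ‖c.site k - c.site l‖
    have h2 := hC (r • c.disp ε k l)
    have h3 : r * ((1 - 2 * ε) * s) ≤ ‖r • c.disp ε k l‖ := by
      rw [norm_smul, Real.norm_of_nonneg hr0.le]
      gcongr
    have h4 : (r * ((1 - 2 * ε) * s)) ^ (d + 1) * |D k l| ≤ C := by
      exact le_trans (mul_le_mul_of_nonneg_right (pow_le_pow_left₀ (by positivity) h3 _)
        (abs_nonneg _)) h2
    -- Only one power of `r` is kept, by `r ≤ r^(d+1)`. The factor `2` in `B` comes from `s^(d+1) ≥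
    -- (1 + s^(d+1))/2`, valid since distinct sites satisfy `s ≥ 1`.
    have h5 : r * ((1 - 2 * ε) ^ (d + 1) * ((1 + s ^ (d + 1)) / 2))
        ≤ (r * ((1 - 2 * ε) * s)) ^ (d + 1) := by
      rw [mul_pow, mul_pow]
      have hr' : r ≤ r ^ (d + 1) := le_self_pow₀ hr1.le (by omega)
      have hs' : 1 ≤ s ^ (d + 1) := one_le_pow₀ hn
      gcongr
      linarith
    have h6 : r * ((1 - 2 * ε) ^ (d + 1) * ((1 + s ^ (d + 1)) / 2)) * |D k l| ≤ C :=
      le_trans (by gcongr) h4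
    have h7 : 0 < 1 + s ^ (d + 1) := by positivity
    have h8 : 0 < (1 - 2 * ε) ^ (d + 1) := by positivity
    rw [hB, div_div, div_mul_div_comm, mul_one, le_div_iff₀ (by positivity)]
    nlinarith
  set O : Matrix c.ι c.ι ℝ := Matrix.of fun k l => if k = l then 0 else D k l with hO
  have hOb : ∀ k l, |O k l| ≤ B / r * (1 / (1 + ‖c.site k - c.site l‖ ^ (d + 1))) := fun k l => by
    by_cases hkl : k = l
    · simp only [hO, Matrix.of_apply, if_pos hkl, abs_zero]
      positivity
    · simp only [hO, Matrix.of_apply, if_neg hkl]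
      exact hoff k l hkl
  have hOop : OpBound O (h 0 / 2) := by
    refine (opBound_of_sum_le (C := B / r * W) (by positivity) (fun k => ?_) (fun l => ?_)).mono
      (by rw [div_mul_eq_mul_div]; exact hr2)
    · refine (Finset.sum_le_sum fun l _ => hOb k l).trans ?_
      rw [← Finset.mul_sum]
      simp only [norm_sub_rev (c.site k)]
      exact mul_le_mul_of_nonneg_left (hc.sum_le_tsum k hs fun s => by positivity) (by positivity)
    · refine (Finset.sum_le_sum fun k _ => hOb k l).trans ?_
      rw [← Finset.mul_sum]
      exact mul_le_mul_of_nonneg_left (hc.sum_le_tsum l hs fun s => by positivity) (by positivity)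
  have hDO : D = h 0 • (1 : Matrix c.ι c.ι ℝ) + O := by
    ext k l
    by_cases hkl : k = l
    · subst hkl
      simp [hO, D, baseMat, Config.disp_eq]
    · simp [hO, hkl]
  intro φ
  have h1 := (neg_le_abs _).trans (abs_dotProduct_le_l2 φ (O *ᵥ φ))
  have h2 := hOop φ
  have h3 := l2_nonneg φ
  rw [hDO, add_mulVec, smul_mulVec, one_mulVec, dotProduct_add, dotProduct_smul, smul_eq_mul]
  rw [← l2_sq]
  nlinarith [mul_le_mul_of_nonneg_left h2 h3]

/-- A covariance function with a positive continuous spectral density gives uniformly positive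
definite matrices. -/
lemma exists_coercive {k : EuclideanSpace ℝ (Fin d) → ℝ} (hint : Integrable (fourierHat k))
    (hinv : ∀ t, (k t : ℂ) = invFourier (fourierHat k) t)
    (hcont : Continuous fun f => (fourierHat k f).re) (hpos : ∀ f, 0 < (fourierHat k f).re)
    {ε : ℝ} (hε : ε ∈ Set.Ico (0 : ℝ) (1 / 2)) :
    ∃ m, 0 < m ∧ ∀ c : Config d, c.Valid → Coercive m (baseMat k ε c) := by
  -- Only smoothness, compact support and positive integral matter: the integral is the value at `0`
  -- of the inverse transform, which becomes the diagonal of the comparison matrices.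
  let b : ContDiffBump (0 : EuclideanSpace ℝ (Fin d)) := ⟨1, 2, one_pos, one_lt_two⟩
  set g : EuclideanSpace ℝ (Fin d) → ℂ := fun f => ((b f : ℝ) : ℂ) with hg
  have hgs : ContDiff ℝ (⊤ : ℕ∞) g := Complex.ofRealCLM.contDiff.comp b.contDiff
  have hgc : HasCompactSupport g := b.hasCompactSupport.comp_left Complex.ofReal_zero
  obtain ⟨C, hC0, hC⟩ := exists_norm_invFourier_le hgc hgs (d + 1)
  have h0 : 0 < (invFourier g 0).re := by
    have h1 : invFourier g 0 = ((∫ f, b f : ℝ) : ℂ) := by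
      rw [invFourier, ← integral_complex_ofReal]
      congr 1 with f
      simp [hg]
    rw [h1, Complex.ofReal_re]
    exact b.integral_pos
  obtain ⟨r, hr0, hr⟩ := exists_coercive_of_decay (h := fun t => (invFourier g t).re) h0 hC0
    (fun t => le_trans (by gcongr; exact Complex.abs_re_le_norm _) (hC t)) hε
  set gr : EuclideanSpace ℝ (Fin d) → ℂ := fun f => g (r⁻¹ • f) with hgr
  have hgri : Integrable gr :=
    (hgs.continuous.integrable_of_hasCompactSupport hgc).comp_smul (inv_ne_zero hr0.ne')
  -- The dilated bump is at most `1` and vanishes outside the ball of radius `2r`, so `m` times it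
  -- lies below the spectral density as soon as `m` is the minimum of the density on that compact
  -- ball.
  obtain ⟨f₀, -, hf₀⟩ := (isCompact_closedBall (0 : EuclideanSpace ℝ (Fin d))
    (2 * r)).exists_isMinOn ⟨0, by simp; positivity⟩ hcont.continuousOn
  set m := (fourierHat k f₀).re with hm
  have hm0 : 0 < m := hpos f₀
  have hle : ∀ f, m * (gr f).re ≤ (fourierHat k f).re := fun f => by
    by_cases hf : f ∈ Metric.closedBall (0 : EuclideanSpace ℝ (Fin d)) (2 * r)
    · have h1 : (gr f).re ≤ 1 := by simpa [hgr, hg] using b.le_one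
      have h2 : m ≤ (fourierHat k f).re := hf₀ hf
      nlinarith
    · have h1 : (gr f).re = 0 := by
        simp only [hgr, hg, Complex.ofReal_re]
        refine b.zero_of_le_dist ?_
        rw [dist_zero_right, norm_smul, norm_inv, Real.norm_of_nonneg hr0.le, inv_mul_eq_div,
          le_div_iff₀ hr0]
        simp only [Metric.mem_closedBall, dist_zero_right, not_le] at hf
        exact hf.le
      rw [h1, mul_zero]
      exact (hpos f).le
  -- The factor `r ^ d` is the Jacobian of the dilation in the inverse Fourier transform.
  refine ⟨m * (r ^ d * ((invFourier g 0).re / 2)), by positivity, fun c hc φ => ?_⟩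
  have hk : ∀ t, k t = (invFourier (fourierHat k) t).re := fun t => by
    rw [← hinv, Complex.ofReal_re]
  have hgr' : ∀ t, (invFourier gr t).re = r ^ d * (invFourier g (r • t)).re := fun t => by
    rw [hgr, invFourier_comp_inv_smul g hr0, Complex.real_smul, Complex.re_ofReal_mul]
  have h1 := hr c hc φ
  rw [quadForm_baseMat] at h1 ⊢
  have h2 := quadForm_invFourier_re hgri φ (c.pos ε)
  have h3 := quadForm_invFourier_re hint φ (c.pos ε)
  simp only [hk]
  rw [h3]
  have hre : ∀ H : EuclideanSpace ℝ (Fin d) → ℂ, Integrable H →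
      Integrable fun f => (H f).re * Complex.normSq (trigSum φ (c.pos ε) f) := fun H hH => by
    have := (integrable_mul_normSq hH φ (c.pos ε)).re
    simpa using this
  calc m * (r ^ d * ((invFourier g 0).re / 2)) * φ ⬝ᵥ φ
      ≤ m * (r ^ d * ∑ k, ∑ l, φ k * φ l * (invFourier g (r • (c.pos ε k - c.pos ε l))).re) := by
        rw [mul_assoc, mul_assoc]
        gcongr
    _ = m * ∫ f, (gr f).re * Complex.normSq (trigSum φ (c.pos ε) f) := by
        rw [← h2, Finset.mul_sum]
        congr 1
        refine Finset.sum_congr rfl fun k _ => ?_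
        rw [Finset.mul_sum]
        refine Finset.sum_congr rfl fun l _ => ?_
        rw [hgr']; ring
    _ = ∫ f, m * ((gr f).re * Complex.normSq (trigSum φ (c.pos ε) f)) := by
        rw [integral_const_mul]
    _ ≤ _ := by
        refine integral_mono ((hre gr hgri).const_mul m) (hre _ hint) fun f => ?_
        simp only
        rw [← mul_assoc]
        exact mul_le_mul_of_nonneg_right (hle f) (Complex.normSq_nonneg _)

end

/-! ### A strong law of large numbers for locally dependent bounded variables. -/

section

section LLN

variable {Ω : Type*} [MeasurableSpace Ω] {μ : Measure Ω}

/-- The series of the `f n` has finite expectation, so it converges almost surely and its terms tend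
to zero. -/
lemma ae_tendsto_zero_of_summable_integral {f : ℕ → Ω → ℝ} (hint : ∀ n, Integrable (f n) μ)
    (h0 : ∀ n ω, 0 ≤ f n ω) (hs : Summable fun n => ∫ ω, f n ω ∂μ) :
    ∀ᵐ ω ∂μ, Tendsto (fun n => f n ω) atTop (𝓝 0) := by
  have h1 : ∫⁻ ω, ∑' n, ENNReal.ofReal (f n ω) ∂μ ≠ ⊤ := by
    rw [lintegral_tsum fun n => (hint n).aemeasurable.ennreal_ofReal]
    have : ∀ n, ∫⁻ ω, ENNReal.ofReal (f n ω) ∂μ = ENNReal.ofReal (∫ ω, f n ω ∂μ) := fun n =>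
      (ofReal_integral_eq_lintegral_ofReal (hint n) (Eventually.of_forall (h0 n))).symm
    simp only [this]
    exact hs.tsum_ofReal_ne_top
  have h2 : AEMeasurable (fun ω => ∑' n, ENNReal.ofReal (f n ω)) μ :=
    AEMeasurable.tsum fun n => (hint n).aemeasurable.ennreal_ofReal
  filter_upwards [ae_lt_top' h2 h1] with ω hω
  have h3 := ENNReal.tendsto_atTop_zero_of_tsum_ne_top hω.ne
  have h4 := (ENNReal.tendsto_toReal ENNReal.zero_ne_top).comp h3
  simpa [Function.comp_def, ENNReal.toReal_ofReal (h0 _ ω)] using h4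

/-- A law of large numbers for bounded variables whose partial sums have a variance of linear
order. -/
lemma ae_tendsto_average_zero [IsProbabilityMeasure μ] {η : ℕ → Ω → ℝ} {B C : ℝ}
    (hm : ∀ k, Measurable (η k)) (hB : ∀ k, ∀ᵐ ω ∂μ, |η k ω| ≤ B)
    (hC : ∀ n : ℕ, ∫ ω, (∑ k ∈ Finset.range n, η k ω) ^ 2 ∂μ ≤ C * n) :
    ∀ᵐ ω ∂μ, Tendsto (fun n : ℕ => (1 / (n : ℝ)) * ∑ k ∈ Finset.range n, η k ω) atTop (𝓝 0) := by
  have hB' := ae_all_iff.2 hB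
  set S : ℕ → Ω → ℝ := fun n ω => ∑ k ∈ Finset.range n, η k ω with hS
  have hSm : ∀ n, Measurable (S n) := fun n => Finset.measurable_fun_sum _ fun k _ => hm k
  have hSb : ∀ n, ∀ᵐ ω ∂μ, |S n ω| ≤ n * B := fun n => by
    filter_upwards [hB'] with ω hω
    refine (Finset.abs_sum_le_sum_abs _ _).trans ?_
    refine (Finset.sum_le_sum fun k _ => hω k).trans ?_
    simp
  -- Along the squares the second moment of the average is at most `C / m²`, which is summable.
  set f : ℕ → Ω → ℝ := fun m ω => (S (m ^ 2) ω / (m ^ 2 : ℕ)) ^ 2 with hf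
  have hfi : ∀ m, Integrable (f m) μ := fun m => by
    refine Integrable.of_bound (C := ((m ^ 2 : ℕ) * B / (m ^ 2 : ℕ)) ^ 2)
      (((hSm _).div_const _).pow_const 2).aestronglyMeasurable ?_
    filter_upwards [hSb (m ^ 2)] with ω hω
    rw [Real.norm_of_nonneg (sq_nonneg _), div_pow, div_pow, ← sq_abs (S (m ^ 2) ω)]
    gcongr
  have hfs : Summable fun m => ∫ ω, f m ω ∂μ := by
    have h2 : Summable fun m : ℕ => C * (1 / (m : ℝ) ^ 2) :=
      (Real.summable_one_div_nat_pow.2 one_lt_two).mul_left C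
    refine Summable.of_nonneg_of_le (fun m => integral_nonneg fun ω => sq_nonneg _) (fun m => ?_) h2
    have e : ∫ ω, f m ω ∂μ = (∫ ω, S (m ^ 2) ω ^ 2 ∂μ) / ((m ^ 2 : ℕ) : ℝ) ^ 2 := by
      rw [← integral_div]
      simp only [hf, div_pow]
    rw [e]
    rcases Nat.eq_zero_or_pos m with rfl | hm0
    · simp
    · have hm1 : (0 : ℝ) < ((m ^ 2 : ℕ) : ℝ) := by positivity
      rw [div_le_iff₀ (by positivity)]
      refine (hC (m ^ 2)).trans (le_of_eq ?_)
      push_cast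
      field_simp
  filter_upwards [ae_tendsto_zero_of_summable_integral hfi (fun m ω => sq_nonneg _) hfs, hB']
    with ω hω hb
  have hsq : Tendsto (fun m : ℕ => |S (m ^ 2) ω| / (m ^ 2 : ℕ)) atTop (𝓝 0) := by
    have := (Real.continuous_sqrt.tendsto 0).comp hω
    rw [Real.sqrt_zero] at this
    refine this.congr fun m => ?_
    simp only [hf, Function.comp_apply, Real.sqrt_sq_eq_abs, abs_div, Nat.abs_cast]
  have hB0 : 0 ≤ B := (abs_nonneg _).trans (hb 0)
  have hsqrt : Tendsto Nat.sqrt atTop atTop := by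
    refine tendsto_atTop.2 fun b => ?_
    filter_upwards [eventually_ge_atTop (b * b)] with n hn
    exact Nat.le_sqrt.2 hn
  have h1 : Tendsto (fun n : ℕ => |S (n.sqrt ^ 2) ω| / (n.sqrt ^ 2 : ℕ)
      + 2 * B * (1 / (n.sqrt : ℝ))) atTop (𝓝 0) := by
    have h2 := (tendsto_one_div_atTop_nhds_zero_nat (𝕜 := ℝ)).const_mul (2 * B)
    rw [mul_zero] at h2
    simpa [Function.comp_def] using (hsq.add h2).comp hsqrt
  refine squeeze_zero_norm' ?_ h1
  filter_upwards [eventually_ge_atTop 1] with n hn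
  -- Between consecutive squares at most `2m` bounded terms are added, so the average changes by at
  -- most `2B / m`.
  set m := n.sqrt
  have hm0 : 0 < m := Nat.sqrt_pos.2 hn
  have hmn : m ^ 2 ≤ n := Nat.sqrt_le' n
  have hnm : n ≤ m ^ 2 + 2 * m := by
    have := Nat.sqrt_le_add n
    have h3 : n ≤ m * m + m + m := this
    nlinarith
  have hsub : |S n ω| ≤ |S (m ^ 2) ω| + 2 * m * B := by
    have e : S n ω = S (m ^ 2) ω + ∑ k ∈ Finset.Ico (m ^ 2) n, η k ω := by
      simp only [hS]
      rw [Finset.range_eq_Ico, Finset.range_eq_Ico, Finset.sum_Ico_consecutive _ (by omega) hmn]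
    rw [e]
    refine (abs_add_le _ _).trans (add_le_add le_rfl ?_)
    refine (Finset.abs_sum_le_sum_abs _ _).trans ((Finset.sum_le_sum fun k _ => hb k).trans ?_)
    rw [Finset.sum_const, Nat.card_Ico, nsmul_eq_mul]
    refine mul_le_mul_of_nonneg_right ?_ hB0
    have : n - m ^ 2 ≤ 2 * m := by omega
    exact_mod_cast this
  have hmR : (0 : ℝ) < m := by exact_mod_cast hm0
  have hmnR : ((m ^ 2 : ℕ) : ℝ) ≤ n := by exact_mod_cast hmn
  have hm2 : (0 : ℝ) < ((m ^ 2 : ℕ) : ℝ) := by positivity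
  rw [Real.norm_eq_abs, abs_mul, abs_of_nonneg (by positivity : (0 : ℝ) ≤ 1 / n),
    one_div_mul_eq_div]
  calc |S n ω| / n ≤ (|S (m ^ 2) ω| + 2 * m * B) / n := by gcongr
    _ ≤ (|S (m ^ 2) ω| + 2 * m * B) / (m ^ 2 : ℕ) := by gcongr
    _ = _ := by
      push_cast
      field_simp

/-- In the expanded square of the partial sum only the pairs with `l ∈ N k` contribute, at most `D
n` of them, each at most `B²`. -/
lemma ae_tendsto_average_zero_of_local [IsProbabilityMeasure μ] {η : ℕ → Ω → ℝ} {B : ℝ} {D : ℕ}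
    (hm : ∀ k, Measurable (η k)) (hB : ∀ k, ∀ᵐ ω ∂μ, |η k ω| ≤ B) (N : ℕ → Finset ℕ)
    (hN : ∀ k, (N k).card ≤ D) (h0 : ∀ k, ∀ l ∉ N k, ∫ ω, η k ω * η l ω ∂μ = 0) :
    ∀ᵐ ω ∂μ, Tendsto (fun n : ℕ => (1 / (n : ℝ)) * ∑ k ∈ Finset.range n, η k ω) atTop (𝓝 0) := by
  refine ae_tendsto_average_zero (C := D * (B * B)) hm hB fun n => ?_
  have hprod : ∀ k l, ∀ᵐ ω ∂μ, ‖η k ω * η l ω‖ ≤ B * B := fun k l => by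
    filter_upwards [hB k, hB l] with ω h1 h2
    rw [Real.norm_eq_abs, abs_mul]
    exact mul_le_mul h1 h2 (abs_nonneg _) ((abs_nonneg _).trans h1)
  have hint : ∀ k l, Integrable (fun ω => η k ω * η l ω) μ := fun k l =>
    Integrable.of_bound ((hm k).mul (hm l)).aestronglyMeasurable _ (hprod k l)
  have hle : ∀ k l, ∫ ω, η k ω * η l ω ∂μ ≤ B * B := fun k l => by
    have := norm_integral_le_of_norm_le_const (hprod k l)
    simp only [probReal_univ, mul_one] at this
    exact (le_abs_self _).trans this
  have hBB : 0 ≤ B * B := mul_self_nonneg B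
  simp only [sq, Finset.sum_mul_sum]
  rw [integral_finsetSum _ fun k _ => integrable_finsetSum _ fun l _ => hint k l]
  calc ∑ k ∈ Finset.range n, ∫ ω, ∑ l ∈ Finset.range n, η k ω * η l ω ∂μ
      ≤ ∑ k ∈ Finset.range n, (D : ℝ) * (B * B) := by
        refine Finset.sum_le_sum fun k _ => ?_
        rw [integral_finsetSum _ fun l _ => hint k l]
        calc ∑ l ∈ Finset.range n, ∫ ω, η k ω * η l ω ∂μ
            ≤ ∑ l ∈ Finset.range n, if l ∈ N k then B * B else 0 := by
              refine Finset.sum_le_sum fun l _ => ?_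
              by_cases hl : l ∈ N k
              · rw [if_pos hl]; exact hle k l
              · rw [if_neg hl, h0 k l hl]
          _ = ((Finset.range n ∩ N k).card : ℝ) * (B * B) := by
              rw [Finset.sum_ite_mem, Finset.sum_const, nsmul_eq_mul]
          _ ≤ D * (B * B) := by
              gcongr
              exact (Finset.card_le_card Finset.inter_subset_right).trans (hN k)
    _ = D * (B * B) * n := by simp; ring

end LLN

end

/-! ### Boxes, their expected central entries, and the boundary of the grid. -/

section

variable {d : ℕ}

/-- The sites of the cube `[-r, r]^d`. -/
def box (d r : ℕ) : Finset (Fin d → ℤ) := Fintype.piFinset fun _ => Finset.Icc (-(r : ℤ)) r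

lemma mem_box {r : ℕ} {s : Fin d → ℤ} : s ∈ box d r ↔ ‖s‖ ≤ r := by
  rw [box, Fintype.mem_piFinset, pi_norm_le_iff_of_nonneg (by positivity)]
  refine forall_congr' fun j => ?_
  rw [Finset.mem_Icc, ← abs_le, Int.norm_eq_abs]
  exact_mod_cast Iff.rfl

lemma zero_mem_box (d r : ℕ) : (0 : Fin d → ℤ) ∈ box d r := mem_box.2 (by simp)

lemma card_box (d r : ℕ) : (box d r).card = (2 * r + 1) ^ d := by
  simp only [box, Fintype.card_piFinset, Int.card_Icc, Finset.prod_const, Finset.card_univ,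
    Fintype.card_fin]
  congr 1
  omega

/-- The configuration of all the sites of a box. -/
def boxConfig (r : ℕ) (x : box d r → EuclideanSpace ℝ (Fin d)) : Config d where
  ι := box d r
  site := Subtype.val
  pt := x

/-- The central diagonal coefficient for a box configuration. -/
def center (F : MatFun d) (r : ℕ) (x : box d r → EuclideanSpace ℝ (Fin d)) : ℝ :=
  F (boxConfig r x) (⟨0, zero_mem_box d r⟩ : box d r) (⟨0, zero_mem_box d r⟩ : box d r)

/-- The cube `[-1, 1]^d`. -/
def unitCube (d : ℕ) : Set (EuclideanSpace ℝ (Fin d)) := {t | ∀ j, t j ∈ Set.Icc (-1 : ℝ) 1}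

lemma valid_boxConfig {r : ℕ} {x : box d r → EuclideanSpace ℝ (Fin d)}
    (hx : ∀ j, x j ∈ unitCube d) : (boxConfig r x).Valid := ⟨Subtype.val_injective, hx⟩

lemma IsLocal.measurable_center {F : MatFun d} (hF : IsLocal F) (r : ℕ) :
    Measurable (center F r) := hF.meas _ _ _ _

lemma abs_center_le {F : MatFun d} {C : ℝ} (hC : UnifBound F C) {r : ℕ}
    {x : box d r → EuclideanSpace ℝ (Fin d)} (hx : ∀ j, x j ∈ unitCube d) :
    |center F r x| ≤ C := (hC _ (valid_boxConfig hx)).abs_apply_le _ _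

lemma IsPerturbationLaw.ae_mem {L : Measure (EuclideanSpace ℝ (Fin d))}
    (hL : IsPerturbationLaw L) : ∀ᵐ t ∂L, t ∈ L.support := by
  have := hL.prob
  exact Measure.support_mem_ae

lemma IsPerturbationLaw.ae_mem_cube {L : Measure (EuclideanSpace ℝ (Fin d))}
    (hL : IsPerturbationLaw L) : ∀ᵐ t ∂L, t ∈ unitCube d :=
  hL.ae_mem.mono fun t ht => hL.support_subset t ht

/-- The expected central diagonal coefficient of a box. -/
def meanCenter (F : MatFun d) (L : Measure (EuclideanSpace ℝ (Fin d))) (r : ℕ) : ℝ :=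
  ∫ x, center F r x ∂(Measure.pi fun _ : box d r => L)

lemma box_mono {r r' : ℕ} (h : r ≤ r') : box d r ⊆ box d r' := fun s hs =>
  mem_box.2 ((mem_box.1 hs).trans (by exact_mod_cast h))

lemma abs_sub_le_of_l2_col {c c' : Config d} {F : MatFun d} {e : c.ι → c'.ι}
    (he : Config.IsEmb e) {u : c.ι} {δ : ℝ}
    (h : l2 ((fun k => F c' k (e u)) - extendZero e (fun k => F c k u)) ≤ δ) :
    |F c' (e u) (e u) - F c u u| ≤ δ := by
  have h1 := abs_apply_le_l2 ((fun k => F c' k (e u)) - extendZero e (fun k => F c k u)) (e u)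
  rw [Pi.sub_apply, extendZero_apply he.inj] at h1
  exact h1.trans h

/-- All boxes are coupled by restricting a single i.i.d. sample on the whole lattice. Locality then
compares the central entries of two large nested boxes sample by sample, so the expectations form a
Cauchy sequence. -/
lemma IsLocal.exists_tendsto_meanCenter {F : MatFun d} (hF : IsLocal F)
    {L : Measure (EuclideanSpace ℝ (Fin d))} (hL : IsPerturbationLaw L) :
    ∃ s, Tendsto (meanCenter F L) atTop (𝓝 s) := by
  have := hL.prob
  refine cauchySeq_tendsto_of_complete (Metric.cauchySeq_iff'.2 fun δ hδ => ?_)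
  obtain ⟨r, hr⟩ := hF.col (δ / 2) (half_pos hδ)
  obtain ⟨C, hC0, hC⟩ := hF.bound_pos
  refine ⟨r, fun r' hr' => ?_⟩
  set ν := Measure.infinitePi fun _ : Fin d → ℤ => L
  have hmap : ∀ q, meanCenter F L q = ∫ x, center F q ((box d q).restrict x) ∂ν := fun q => by
    rw [meanCenter, ← Measure.infinitePi_map_restrict (μ := fun _ : Fin d → ℤ => L)
      (I := box d q), integral_map]
    · exact (Finset.measurable_restrict _).aemeasurable
    · exact (hF.measurable_center q).aestronglyMeasurable
  have hae : ∀ᵐ x ∂ν, ∀ s, x s ∈ unitCube d := by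
    refine ae_all_iff.2 fun s => ?_
    have h1 : ν.map (fun x => x s) = L := Measure.infinitePi_map_eval _ s
    have h2 := hL.ae_mem_cube
    rw [← h1] at h2
    exact ae_of_ae_map (measurable_pi_apply s).aemeasurable h2
  have hint : ∀ q, Integrable (fun x => center F q ((box d q).restrict x)) ν := fun q => by
    refine Integrable.of_bound (C := C) ((hF.measurable_center q).comp
      (Finset.measurable_restrict _)).aestronglyMeasurable ?_
    filter_upwards [hae] with x hx
    exact abs_center_le hC fun j => hx j
  rw [Real.dist_eq, hmap, hmap, ← integral_sub (hint _) (hint _), ← Real.norm_eq_abs]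
  refine lt_of_le_of_lt (norm_integral_le_of_norm_le_const (C := δ / 2) (μ := ν) ?_) ?_
  · filter_upwards [hae] with x hx
    have he : Config.IsEmb (c := boxConfig r ((box d r).restrict x))
        (c' := boxConfig r' ((box d r').restrict x)) 
        (fun k : box d r => (⟨k.1, box_mono hr' k.2⟩ : box d r')) :=
      ⟨fun k l hkl => Subtype.ext (congrArg (fun z : box d r' => z.1) hkl), fun _ _ => rfl,
        fun _ => rfl⟩
    exact abs_sub_le_of_l2_col he (hr _ _ _ (valid_boxConfig fun j => hx j)
      (valid_boxConfig fun j => hx j) he (⟨0, zero_mem_box d r⟩ : box d r) fun k hk =>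
        ⟨(⟨k.1, mem_box.2 (by simpa [boxConfig] using hk)⟩ : box d r), rfl⟩)
  · simp only [probReal_univ, mul_one]
    linarith

section Grid

variable {v : ℕ → Fin d → ℕ}

/-- The enumeration of the grid, with integer coordinates. -/
def intGrid (v : ℕ → Fin d → ℕ) (k : ℕ) : Fin d → ℤ := fun j => (v k j : ℤ)

/-- The first `N^d` indices are mapped onto a cube with exactly `N^d` points, which forces
injectivity on them. For `d ≥ 1` any two indices are below `N^d` with `N = k + l + 1`. -/
lemma IsGridEnumeration.injective (hd : 0 < d) (hv : IsGridEnumeration v) :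
    Function.Injective v := by
  intro k l hkl
  set N := k + l + 1 with hN
  have hlt : ∀ i ≤ k + l, i < N ^ d := fun i hi =>
    lt_of_lt_of_le (by omega) (Nat.le_self_pow hd.ne' N)
  have himg : (Finset.range (N ^ d)).image v = Fintype.piFinset fun _ => Finset.Icc 1 N := by
    apply Finset.coe_injective
    rw [Finset.coe_image, Fintype.coe_piFinset]
    have h := hv N (by omega)
    have h1 : ((Finset.range (N ^ d) : Finset ℕ) : Set ℕ) = {i | i < N ^ d} := by ext; simp
    rw [h1, h]
    ext u
    simp [Pi.le_def, forall_and]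
  have hcard : ((Finset.range (N ^ d)).image v).card = (Finset.range (N ^ d)).card := by
    rw [himg]
    simp
  exact Finset.injOn_of_card_image_eq hcard (by simpa using hlt k (by omega))
    (by simpa using hlt l (by omega)) hkl

lemma IsGridEnumeration.injective_intGrid (hd : 0 < d) (hv : IsGridEnumeration v) :
    Function.Injective (intGrid v) := fun k l hkl => hv.injective hd (by
  ext j
  exact Int.ofNat_inj.1 (congrFun hkl j))

/-- All the sites at distance at most `r` of the `k`-th one are among the first `n` ones. -/
def IsBulk (v : ℕ → Fin d → ℕ) (r n k : ℕ) : Prop :=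
  ∀ s ∈ box d r, ∃ i < n, intGrid v i = intGrid v k + s

open Classical in
/-- The number of sites that are close to the boundary. -/
def boundaryCard (v : ℕ → Fin d → ℕ) (r n : ℕ) : ℕ :=
  ((Finset.range n).filter fun k => ¬ IsBulk v r n k).card

/-- The points of `{r+1, …, N-r}^d` have all their neighbors within distance `r` in `{1, …, N}^d`,
whose points are already enumerated. The subtraction `N - 2 * r` is truncated at zero. -/
lemma boundaryCard_le (hv : IsGridEnumeration v) {r n N : ℕ} (hN : 1 ≤ N) (hn : N ^ d ≤ n) :
    boundaryCard v r n + (N - 2 * r) ^ d ≤ n := by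
  classical
  have h1 : (Fintype.piFinset fun _ : Fin d => Finset.Icc (r + 1) (N - r)).card
      ≤ ((Finset.range n).filter fun k => IsBulk v r n k).card := by
    refine le_trans (Finset.card_le_card (t := ((Finset.range n).filter
      fun k => IsBulk v r n k).image v) fun u hu => ?_) Finset.card_image_le
    simp only [Fintype.mem_piFinset, Finset.mem_Icc] at hu
    have hmem : ∀ u' : Fin d → ℕ, (∀ k, 1 ≤ u' k ∧ u' k ≤ N) → ∃ i < N ^ d, v i = u' :=
      fun u' hu' => by
        have : u' ∈ v '' {i | i < N ^ d} := by rw [hv N hN]; exact hu'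
        exact this
    obtain ⟨i, hi, hiu⟩ := hmem u fun k => by have := hu k; omega
    refine Finset.mem_image.2 ⟨i, Finset.mem_filter.2 ⟨by simp; omega, fun s hs => ?_⟩, hiu⟩
    simp only [box, Fintype.mem_piFinset, Finset.mem_Icc] at hs
    obtain ⟨i', hi', hiu'⟩ := hmem (fun k => ((u k : ℤ) + s k).toNat) fun k => by
      have := hu k
      have := hs k
      omega
    refine ⟨i', by omega, ?_⟩
    ext k
    have := hu k
    have := hs k
    simp only [intGrid, hiu', hiu, Pi.add_apply]
    omega
  have h2 : (Fintype.piFinset fun _ : Fin d => Finset.Icc (r + 1) (N - r)).card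
      = (N - 2 * r) ^ d := by
    simp only [Fintype.card_piFinset, Nat.card_Icc, Finset.prod_const, Finset.card_univ,
      Fintype.card_fin]
    congr 1
    omega
  have h3 := Finset.card_filter_add_card_filter_not (s := Finset.range n)
    (fun k => IsBulk v r n k)
  rw [Finset.card_range] at h3
  rw [boundaryCard]
  omega

/-- With `N` the largest integer such that `N^d ≤ n`, so that `n < (N+1)^d`, the proportion of
boundary sites is at most `1 - ((N - 2r)/(N + 1))^d`. -/
lemma tendsto_boundaryCard (hd : 0 < d) (hv : IsGridEnumeration v) (r : ℕ) :
    Tendsto (fun n : ℕ => (boundaryCard v r n : ℝ) / n) atTop (𝓝 0) := by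
  set N : ℕ → ℕ := fun n => Nat.findGreatest (fun N => N ^ d ≤ n) n with hN
  have hN1 : ∀ n, N n ^ d ≤ n := fun n =>
    Nat.findGreatest_spec (P := fun N => N ^ d ≤ n) (Nat.zero_le n) (by simp [hd.ne'])
  have hN2 : ∀ n, n < (N n + 1) ^ d := fun n => by
    by_contra! h
    have h1 : N n + 1 ≤ n := (Nat.le_self_pow hd.ne' _).trans h
    exact absurd (Nat.le_findGreatest (P := fun N => N ^ d ≤ n) h1 h) (Nat.not_succ_le_self _)
  have hN3 : Tendsto N atTop atTop := tendsto_atTop.2 fun M => by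
    filter_upwards [eventually_ge_atTop (M ^ d)] with n hn
    exact Nat.le_findGreatest ((Nat.le_self_pow hd.ne' _).trans hn) hn
  have hlim : Tendsto (fun n => 1 - (1 - (2 * r + 1 : ℝ) * (1 / ((N n : ℝ) + 1))) ^ d) atTop
      (𝓝 0) := by
    have h1 := (tendsto_one_div_add_atTop_nhds_zero_nat (𝕜 := ℝ)).comp hN3
    have h2 := ((h1.const_mul (2 * r + 1 : ℝ)).const_sub 1).pow d
    have h3 := h2.const_sub 1
    simpa [Function.comp_def] using h3
  refine squeeze_zero' (Eventually.of_forall fun n => by positivity) ?_ hlim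
  filter_upwards [hN3.eventually_ge_atTop (2 * r + 1), eventually_ge_atTop 1] with n hn hn1
  have h1 := boundaryCard_le hv (r := r) (by omega : 1 ≤ N n) (hN1 n)
  have hn0 : (0 : ℝ) < n := by exact_mod_cast hn1
  have h2 : (boundaryCard v r n : ℝ) ≤ n - ((N n : ℝ) - 2 * r) ^ d := by
    have : ((N n - 2 * r : ℕ) : ℝ) = (N n : ℝ) - 2 * r := by
      rw [Nat.cast_sub (by omega)]; push_cast; ring
    rw [← this]
    have h3 : ((boundaryCard v r n + (N n - 2 * r) ^ d : ℕ) : ℝ) ≤ n := by exact_mod_cast h1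
    push_cast at h3 ⊢
    linarith
  have hNr : (0 : ℝ) ≤ (N n : ℝ) - 2 * r := by
    have : ((2 * r + 1 : ℕ) : ℝ) ≤ N n := by exact_mod_cast hn
    push_cast at this; linarith
  have h4 : (1 - (2 * r + 1 : ℝ) * (1 / ((N n : ℝ) + 1))) = ((N n : ℝ) - 2 * r) / (N n + 1) := by
    field_simp; ring
  have h5 : (n : ℝ) ≤ ((N n : ℝ) + 1) ^ d := by exact_mod_cast (hN2 n).le
  rw [h4, div_pow, div_le_iff₀ hn0, sub_mul, one_mul]
  refine h2.trans (sub_le_sub_left ?_ _)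
  rw [div_mul_eq_mul_div, div_le_iff₀ (by positivity)]
  gcongr

end Grid

end

/-! ### Windows around sites and convergence of the normalized traces. -/

section

variable {d : ℕ}

section Window

variable {v : ℕ → Fin d → ℕ}

/-- The configuration of the first `n` sites of the grid. -/
def gridConfig (v : ℕ → Fin d → ℕ) (n : ℕ) (x : Fin n → EuclideanSpace ℝ (Fin d)) : Config d where
  ι := Fin n
  site := fun k => intGrid v k
  pt := x

lemma valid_gridConfig (hd : 0 < d) (hv : IsGridEnumeration v) {n : ℕ}
    {x : Fin n → EuclideanSpace ℝ (Fin d)} (hx : ∀ k, x k ∈ unitCube d) :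
    (gridConfig v n x).Valid :=
  ⟨fun _ _ h => Fin.ext (hv.injective_intGrid hd h), hx⟩

/-- All the sites at distance at most `r` of the `k`-th one belong to the grid. -/
def IsInner (v : ℕ → Fin d → ℕ) (r k : ℕ) : Prop :=
  ∀ s ∈ box d r, ∃ i, intGrid v i = intGrid v k + s

lemma IsBulk.isInner {r n k : ℕ} (h : IsBulk v r n k) : IsInner v r k := fun s hs => by
  obtain ⟨i, -, hi⟩ := h s hs
  exact ⟨i, hi⟩

/-- The indices of the sites at distance at most `r` of the `k`-th one. -/
def window (v : ℕ → Fin d → ℕ) (r k : ℕ) (s : box d r) : ℕ :=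
  Function.invFun (intGrid v) (intGrid v k + s.1)

lemma IsInner.intGrid_window {r k : ℕ} (h : IsInner v r k) (s : box d r) :
    intGrid v (window v r k s) = intGrid v k + s.1 := Function.invFun_eq (h s.1 s.2)

lemma IsInner.window_injective {r k : ℕ} (h : IsInner v r k) :
    Function.Injective (window v r k) := fun s t hst => by
  have h1 := h.intGrid_window s
  rw [hst, h.intGrid_window t] at h1
  exact Subtype.ext (add_left_cancel h1).symm

/-- A common site would be within `r` of both centers, which would then be within `2r` of each
other. -/
lemma IsInner.disjoint_window {r k l : ℕ} (hk : IsInner v r k) (hl : IsInner v r l)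
    (h : intGrid v l - intGrid v k ∉ box d (2 * r)) (s t : box d r) :
    window v r k s ≠ window v r l t := fun hst => by
  refine h (mem_box.2 ?_)
  have h1 := hk.intGrid_window s
  rw [hst, hl.intGrid_window t] at h1
  have h2 : intGrid v l - intGrid v k = s.1 - t.1 := by
    rw [sub_eq_sub_iff_add_eq_add, h1, add_comm]
  rw [h2]
  refine (norm_sub_le _ _).trans ?_
  have hs := mem_box.1 s.2
  have ht := mem_box.1 t.2
  push_cast
  linarith

open Classical in
/-- The indices of the sites at distance at most `r` of the `k`-th one, as a finite set. -/
def neighbors (v : ℕ → Fin d → ℕ) (hv : Function.Injective (intGrid v)) (r k : ℕ) : Finset ℕ :=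
  (box d r).preimage (fun l => intGrid v l - intGrid v k)
    (fun _ _ _ _ h => hv (sub_left_injective h))

lemma mem_neighbors (hv : Function.Injective (intGrid v)) {r k l : ℕ} :
    l ∈ neighbors v hv r k ↔ intGrid v l - intGrid v k ∈ box d r := by
  unfold neighbors
  exact Finset.mem_preimage (f := fun l => intGrid v l - intGrid v k)

lemma card_neighbors_le (hv : Function.Injective (intGrid v)) (r k : ℕ) :
    (neighbors v hv r k).card ≤ (2 * r + 1) ^ d := by
  rw [← card_box]
  exact Finset.card_le_card_of_injOn (fun l => intGrid v l - intGrid v k)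
    (fun l hl => (mem_neighbors hv).1 hl) (fun _ _ _ _ h => hv (sub_left_injective h))

end Window

section Convergence

variable {v : ℕ → Fin d → ℕ} {ΩX : Type*} [MeasurableSpace ΩX] {PX : Measure ΩX}
  {X : ℕ → ΩX → EuclideanSpace ℝ (Fin d)} {F : MatFun d}
  {L : Measure (EuclideanSpace ℝ (Fin d))}

lemma ae_mem_of_law (hL : IsPerturbationLaw L) (hXm : ∀ k, Measurable (X k))
    (hXL : ∀ k, PX.map (X k) = L) : ∀ᵐ ω ∂PX, ∀ k, X k ω ∈ L.support := by
  refine ae_all_iff.2 fun k => ?_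
  have h2 := hL.ae_mem
  rw [← hXL k] at h2 ⊢
  exact ae_of_ae_map (hXm k).aemeasurable h2

/-- The central coefficient for the window around the `k`-th site. -/
def windowVar (F : MatFun d) (v : ℕ → Fin d → ℕ) (X : ℕ → ΩX → EuclideanSpace ℝ (Fin d))
    (r k : ℕ) (ω : ΩX) : ℝ := center F r fun s => X (window v r k s) ω

/-- For an inner site the window indices are distinct, so the perturbations read there have the
product law of the box, whatever the site. -/
lemma integral_windowVar (hF : IsLocal F) (hXm : ∀ k, Measurable (X k))
    (hXL : ∀ k, PX.map (X k) = L) (hind : iIndepFun X PX) {r k : ℕ} (hk : IsInner v r k) :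
    ∫ ω, windowVar F v X r k ω ∂PX = meanCenter F L r := by
  have h1 := iIndepFun.map_fun_eq_pi_map (fun s => (hXm (window v r k s)).aemeasurable)
    (hind.precomp hk.window_injective)
  simp only [hXL] at h1
  rw [meanCenter, ← h1, integral_map]
  · rfl
  · exact (measurable_pi_lambda _ fun s => hXm _).aemeasurable
  · exact (hF.measurable_center r).aestronglyMeasurable

lemma measurable_windowVar (hF : IsLocal F) (hXm : ∀ k, Measurable (X k)) (r k : ℕ) :
    Measurable (windowVar F v X r k) :=
  (hF.measurable_center r).comp (measurable_pi_lambda _ fun _ => hXm _)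

/-- The two variables are measurable functions of an independent family over disjoint finite index
sets. -/
lemma indepFun_windowVar (hF : IsLocal F) (hXm : ∀ k, Measurable (X k)) (hind : iIndepFun X PX)
    {r k l : ℕ} (h : ∀ s t, window v r k s ≠ window v r l t) :
    IndepFun (windowVar F v X r k) (windowVar F v X r l) PX := by
  classical
  set S := Finset.univ.image (window v r k)
  set T := Finset.univ.image (window v r l)
  have hST : Disjoint S T := by
    rw [Finset.disjoint_left]
    intro i hi hi'
    obtain ⟨s, -, rfl⟩ := Finset.mem_image.1 hi
    obtain ⟨t, -, ht⟩ := Finset.mem_image.1 hi'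
    exact h s t ht.symm
  have hS : ∀ s, window v r k s ∈ S := fun s => Finset.mem_image_of_mem _ (Finset.mem_univ s)
  have hT : ∀ s, window v r l s ∈ T := fun s => Finset.mem_image_of_mem _ (Finset.mem_univ s)
  have h1 := hind.indepFun_finset S T hST hXm
  exact h1.comp (φ := fun y => center F r fun s => y ⟨window v r k s, hS s⟩)
    (ψ := fun y => center F r fun s => y ⟨window v r l s, hT s⟩)
    ((hF.measurable_center r).comp (measurable_pi_lambda _ fun s => measurable_pi_apply _))
    ((hF.measurable_center r).comp (measurable_pi_lambda _ fun s => measurable_pi_apply _))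

open Classical in
/-- The centered window variable, set to zero near the boundary of the grid. -/
def centeredVar (F : MatFun d) (L : Measure (EuclideanSpace ℝ (Fin d))) (v : ℕ → Fin d → ℕ)
    (X : ℕ → ΩX → EuclideanSpace ℝ (Fin d)) (r k : ℕ) (ω : ΩX) : ℝ :=
  if IsInner v r k then windowVar F v X r k ω - meanCenter F L r else 0

lemma abs_meanCenter_le {C : ℝ} (hC : UnifBound F C) (hL : IsPerturbationLaw L) (r : ℕ) :
    |meanCenter F L r| ≤ C := by
  have := hL.prob
  have hae : ∀ᵐ x ∂(Measure.pi fun _ : box d r => L), ∀ s, x s ∈ unitCube d :=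
    ae_all_iff.2 fun s => (Measure.tendsto_eval_ae_ae).eventually hL.ae_mem_cube
  have := norm_integral_le_of_norm_le_const (μ := Measure.pi fun _ : box d r => L)
    (f := center F r) (C := C) (hae.mono fun x hx => abs_center_le hC hx)
  simpa [meanCenter] using this

omit [MeasurableSpace ΩX] in
lemma abs_centeredVar_le {C : ℝ} (hC0 : 0 ≤ C) (hC : UnifBound F C) (hL : IsPerturbationLaw L)
    {ω : ΩX} (hω : ∀ k, X k ω ∈ L.support) (r k : ℕ) : |centeredVar F L v X r k ω| ≤ 2 * C := by
  rw [centeredVar]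
  split_ifs
  · have h1 := abs_meanCenter_le hC hL r
    have h2 : |windowVar F v X r k ω| ≤ C :=
      abs_center_le hC fun s => hL.support_subset _ (hω _)
    linarith [abs_sub (windowVar F v X r k ω) (meanCenter F L r)]
  · rw [abs_zero]; positivity

variable [IsProbabilityMeasure PX]

/-- Centered window variables are uncorrelated once their sites differ by more than `2r`, and each
site has at most `(4r + 1)^d` closer ones, so the law for locally dependent variables applies. -/
lemma ae_tendsto_average_centeredVar (hd : 0 < d) (hv : IsGridEnumeration v) (hF : IsLocal F)
    (hL : IsPerturbationLaw L) (hXm : ∀ k, Measurable (X k)) (hXL : ∀ k, PX.map (X k) = L)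
    (hind : iIndepFun X PX) (r : ℕ) :
    ∀ᵐ ω ∂PX, Tendsto (fun n : ℕ => (1 / (n : ℝ))
      * ∑ k ∈ Finset.range n, centeredVar F L v X r k ω) atTop (𝓝 0) := by
  obtain ⟨C, hC0, hC⟩ := hF.bound_pos
  have hae := ae_mem_of_law hL hXm hXL
  have hm : ∀ k, Measurable (centeredVar F L v X r k) := fun k => by
    unfold centeredVar
    split_ifs
    · exact (measurable_windowVar hF hXm r k).sub_const _
    · exact measurable_const
  have hB : ∀ k, ∀ᵐ ω ∂PX, |centeredVar F L v X r k ω| ≤ 2 * C := fun k =>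
    hae.mono fun ω hω => abs_centeredVar_le hC0.le hC hL hω r k
  refine ae_tendsto_average_zero_of_local hm hB (neighbors v (hv.injective_intGrid hd) (2 * r))
    (fun k => card_neighbors_le _ _ _) fun k l hl => ?_
  by_cases hk : IsInner v r k
  swap
  · simp [centeredVar, hk]
  by_cases hl' : IsInner v r l
  swap
  · simp [centeredVar, hl']
  have hfar : intGrid v l - intGrid v k ∉ box d (2 * r) := fun h => hl ((mem_neighbors _).2 h)
  have h1 := (indepFun_windowVar hF hXm hind (hk.disjoint_window hl' hfar)).comp
    (measurable_id.sub_const (meanCenter F L r)) (measurable_id.sub_const (meanCenter F L r))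
  have hint : ∀ k, Integrable (windowVar F v X r k) PX := fun k => by
    refine Integrable.of_bound (C := C) (measurable_windowVar hF hXm r k).aestronglyMeasurable ?_
    filter_upwards [hae] with ω hω
    exact abs_center_le hC fun s => hL.support_subset _ (hω _)
  have h2 := h1.integral_fun_mul_eq_mul_integral
    ((measurable_windowVar hF hXm r k).sub_const _).aestronglyMeasurable
    ((measurable_windowVar hF hXm r l).sub_const _).aestronglyMeasurable
  have h3 : ∫ ω, (windowVar F v X r k ω - meanCenter F L r) ∂PX = 0 := by
    rw [integral_sub (hint k) (integrable_const _), integral_windowVar hF hXm hXL hind hk]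
    simp
  simp only [centeredVar, if_pos hk, if_pos hl']
  refine h2.trans ?_
  simp only [Function.comp_def, id]
  rw [h3, zero_mul]

-- The box embeds in the grid as the window around a bulk site, up to a translation of sites, and it
-- contains every site within distance `r`. Locality therefore compares the two diagonal entries.
omit [MeasurableSpace ΩX] in
lemma abs_sub_windowVar_le (hd : 0 < d) (hv : IsGridEnumeration v) {δ : ℝ} {r : ℕ}
    (hr : ∀ (c c' : Config d) (e : c.ι → c'.ι), c.Valid → c'.Valid → Config.IsEmb e → ∀ u : c.ι,
      (∀ k : c'.ι, ‖c'.site k - c'.site (e u)‖ ≤ r → k ∈ Set.range e) →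
      l2 ((fun k => F c' k (e u)) - extendZero e (fun k => F c k u)) ≤ δ)
    {ω : ΩX} (hω : ∀ k, X k ω ∈ unitCube d) {n : ℕ} (k : Fin n) (hk : IsBulk v r n k) :
    |F (gridConfig v n (firstPerturbations X n ω)) k k - windowVar F v X r k ω| ≤ δ := by
  have hin := hk.isInner
  have hinj := hv.injective_intGrid hd
  have hlt : ∀ s, window v r k s < n := fun s => by
    obtain ⟨i, hi, his⟩ := hk s.1 s.2
    rw [← hin.intGrid_window s, hinj.eq_iff] at his
    exact his ▸ hi
  have hdiff : ∀ s t, intGrid v (window v r k s) - intGrid v (window v r k t) = s.1 - t.1 :=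
    fun s t => by rw [hin.intGrid_window, hin.intGrid_window, add_sub_add_left_eq_sub]
  set c := boxConfig r (fun s => X (window v r k s) ω) with hc
  set c' := gridConfig v n (firstPerturbations X n ω) with hc'
  let e : box d r → Fin n := fun s => ⟨window v r k s, hlt s⟩
  have he : Config.IsEmb (c := c) (c' := c') e := by
    exact ⟨fun s t hst => hin.window_injective (congrArg Fin.val hst), hdiff, fun s => rfl⟩
  have he0 : e ⟨0, zero_mem_box d r⟩ = k := by
    refine Fin.ext (hinj ?_)
    change intGrid v (window v r k _) = _
    rw [hin.intGrid_window, add_zero]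
  have hcv : c.Valid := valid_boxConfig fun s => hω _
  have hcv' : c'.Valid := valid_gridConfig hd hv fun k => hω _
  have h := abs_sub_le_of_l2_col he (hr c c' e hcv hcv' he (⟨0, zero_mem_box d r⟩ : box d r)
    fun l hl => by
      change ‖intGrid v l.1 - intGrid v (e ⟨0, zero_mem_box d r⟩).1‖ ≤ r at hl
      rw [he0] at hl
      refine ⟨(⟨_, mem_box.2 hl⟩ : box d r), Fin.ext (hinj ?_)⟩
      change intGrid v (window v r k _) = _
      rw [hin.intGrid_window]
      simp)
  rw [he0] at h
  exact h

/-- The normalized traces of local matrices converge almost surely to the limit of the expected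
central coefficients of the boxes. -/
theorem IsLocal.ae_tendsto_trace (hd : 0 < d) (hv : IsGridEnumeration v) (hF : IsLocal F)
    (hL : IsPerturbationLaw L) (hXm : ∀ k, Measurable (X k)) (hXL : ∀ k, PX.map (X k) = L)
    (hind : iIndepFun X PX) {s : ℝ} (hs : Tendsto (meanCenter F L) atTop (𝓝 s)) :
    ∀ᵐ ω ∂PX, Tendsto (fun n : ℕ => (1 / (n : ℝ))
      * (F (gridConfig v n (firstPerturbations X n ω))).trace) atTop (𝓝 s) := by
  obtain ⟨C, hC0, hC⟩ := hF.bound_pos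
  have hall : ∀ᵐ ω ∂PX, ∀ r, Tendsto (fun n : ℕ => (1 / (n : ℝ))
      * ∑ k ∈ Finset.range n, centeredVar F L v X r k ω) atTop (𝓝 0) :=
    ae_all_iff.2 fun r => ae_tendsto_average_centeredVar hd hv hF hL hXm hXL hind r
  filter_upwards [hall, ae_mem_of_law hL hXm hXL] with ω h1 hω
  rw [Metric.tendsto_atTop']
  intro δ hδ
  -- One share `δ/5` goes to each of four errors: locality, distance of the box mean to its limit,
  -- boundary sites, and the law of large numbers. The radius is fixed before `n` grows.
  obtain ⟨r₀, hr₀⟩ := hF.col (δ / 5) (by positivity)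
  obtain ⟨r₁, hr₁⟩ := (Metric.tendsto_atTop.1 hs) (δ / 5) (by positivity)
  set r := max r₀ r₁
  have hr : ∀ (c c' : Config d) (e : c.ι → c'.ι), c.Valid → c'.Valid → Config.IsEmb e →
      ∀ u : c.ι, (∀ k : c'.ι, ‖c'.site k - c'.site (e u)‖ ≤ r → k ∈ Set.range e) →
      l2 ((fun k => F c' k (e u)) - extendZero e (fun k => F c k u)) ≤ δ / 5 :=
    fun c c' e hc hc' he u hu => hr₀ c c' e hc hc' he u fun k hk => hu k (hk.trans (by simp [r]))
  have hsr := hr₁ r (le_max_right _ _)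
  rw [Real.dist_eq] at hsr
  have h2 := (tendsto_boundaryCard hd hv r).const_mul (4 * C)
  rw [mul_zero] at h2
  obtain ⟨n₁, hn₁⟩ := (Metric.tendsto_atTop.1 h2) (δ / 5) (by positivity)
  obtain ⟨n₂, hn₂⟩ := (Metric.tendsto_atTop.1 (h1 r)) (δ / 5) (by positivity)
  refine ⟨max 1 (max n₁ n₂), fun n hn => ?_⟩
  have hn0 : 0 < n := by have := le_max_left 1 (max n₁ n₂); omega
  have hnR : (0 : ℝ) < n := by exact_mod_cast hn0
  have a1 := hn₁ n (by have := le_max_right 1 (max n₁ n₂); have := le_max_left n₁ n₂; omega)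
  have a2 := hn₂ n (by have := le_max_right 1 (max n₁ n₂); have := le_max_right n₁ n₂; omega)
  rw [Real.dist_eq, sub_zero] at a1 a2
  classical
  set G := F (gridConfig v n (firstPerturbations X n ω)) with hG
  have hcube : ∀ k, X k ω ∈ unitCube d := fun k => hL.support_subset _ (hω k)
  -- At a boundary site the crude bound is `C + C + 2C`, for the entry, the mean and the centered
  -- variable.
  have hterm : ∀ k : Fin n, |G k k - meanCenter F L r - centeredVar F L v X r k ω|
      ≤ δ / 5 + if IsBulk v r n k then 0 else 4 * C := fun k => by
    by_cases hk : IsBulk v r n k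
    · rw [if_pos hk, add_zero, centeredVar, if_pos hk.isInner]
      have := abs_sub_windowVar_le hd hv hr hcube k hk
      rwa [sub_sub, add_sub_cancel]
    · rw [if_neg hk]
      have b1 : |G k k| ≤ C :=
        (hC (gridConfig v n (firstPerturbations X n ω))
          (valid_gridConfig hd hv fun k => hcube _)).abs_apply_le k k
      have b2 := abs_meanCenter_le hC hL r
      have b3 := abs_centeredVar_le (v := v) hC0.le hC hL hω r k
      have b4 := abs_sub (G k k - meanCenter F L r) (centeredVar F L v X r k ω)
      have b5 := abs_sub (G k k) (meanCenter F L r)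
      linarith
  have hsum : |G.trace - n * meanCenter F L r - ∑ k ∈ Finset.range n, centeredVar F L v X r k ω|
      ≤ n * (δ / 5) + 4 * C * boundaryCard v r n := by
    have e1 : G.trace - n * meanCenter F L r - ∑ k ∈ Finset.range n, centeredVar F L v X r k ω
        = ∑ k : Fin n, (G k k - meanCenter F L r - centeredVar F L v X r k ω) := by
      rw [Finset.sum_sub_distrib, Finset.sum_sub_distrib, Finset.sum_const, Finset.card_univ,
        Fintype.card_fin, nsmul_eq_mul, Finset.sum_range]
      rfl
    rw [e1]
    refine (Finset.abs_sum_le_sum_abs _ _).trans ((Finset.sum_le_sum fun k _ => hterm k).trans ?_)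
    rw [Finset.sum_add_distrib, Finset.sum_const, Finset.card_univ, Fintype.card_fin, nsmul_eq_mul,
      ← Finset.sum_range fun k => if IsBulk v r n k then (0 : ℝ) else 4 * C]
    refine add_le_add le_rfl (le_of_eq ?_)
    rw [boundaryCard, Finset.card_filter, Nat.cast_sum, Finset.mul_sum]
    refine Finset.sum_congr rfl fun k _ => ?_
    by_cases hk : IsBulk v r n k <;> simp [hk]
  have hfin : |1 / (n : ℝ) * G.trace - meanCenter F L r
      - 1 / (n : ℝ) * ∑ k ∈ Finset.range n, centeredVar F L v X r k ω|
      ≤ δ / 5 + 4 * C * (boundaryCard v r n / n) := by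
    have e1 : 1 / (n : ℝ) * G.trace - meanCenter F L r
      - 1 / (n : ℝ) * ∑ k ∈ Finset.range n, centeredVar F L v X r k ω
      = (G.trace - n * meanCenter F L r - ∑ k ∈ Finset.range n, centeredVar F L v X r k ω) / n := by
      field_simp
    rw [e1, abs_div, abs_of_pos hnR, div_le_iff₀ hnR]
    refine hsum.trans (le_of_eq ?_)
    field_simp
  rw [Real.dist_eq]
  rw [abs_lt] at a1 a2 hsr ⊢
  rw [abs_le] at hfin
  constructor <;> linarith

end Convergence

end

/-! ### Entrywise matrix calculus: gradient, Hessian and the trace identity. -/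

section

section MatrixCalculus

open Matrix

/-- The entrywise derivative of a matrix valued function. -/
def HasMatDeriv {ι : Type*} (F : ℝ → Matrix ι ι ℝ) (F' : Matrix ι ι ℝ) (S : Set ℝ) (s : ℝ) : Prop :=
  ∀ k l, HasDerivWithinAt (fun t => F t k l) (F' k l) S s

namespace HasMatDeriv

variable {ι : Type*} {F G : ℝ → Matrix ι ι ℝ} {F' G' : Matrix ι ι ℝ} {S : Set ℝ} {s : ℝ}

lemma sub (hF : HasMatDeriv F F' S s) (hG : HasMatDeriv G G' S s) :
    HasMatDeriv (fun t => F t - G t) (F' - G') S s := fun k l => (hF k l).sub (hG k l)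

lemma diagonal [DecidableEq ι] (hF : HasMatDeriv F F' S s) :
    HasMatDeriv (fun t => Matrix.diagonal (F t).diag) (Matrix.diagonal F'.diag) S s := fun k l => by
  by_cases h : k = l
  · subst h; simpa using hF k k
  · simpa [h] using hasDerivWithinAt_const s S (0 : ℝ)

lemma congr_deriv {F'' : Matrix ι ι ℝ} (hF : HasMatDeriv F F' S s) (h : F' = F'') :
    HasMatDeriv F F'' S s := h ▸ hF

variable [Fintype ι]

lemma mul (hF : HasMatDeriv F F' S s) (hG : HasMatDeriv G G' S s) :
    HasMatDeriv (fun t => F t * G t) (F' * G s + F s * G') S s := fun k l => by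
  simp only [Matrix.mul_apply, Matrix.add_apply, ← Finset.sum_add_distrib]
  exact HasDerivWithinAt.fun_sum fun j _ => (hF k j).mul (hG j l)

lemma dotProduct_mulVec (hF : HasMatDeriv F F' S s) (y : ι → ℝ) :
    HasDerivWithinAt (fun t => y ⬝ᵥ (F t *ᵥ y)) (y ⬝ᵥ (F' *ᵥ y)) S s := by
  simp only [dotProduct, mulVec]
  exact HasDerivWithinAt.fun_sum fun k _ =>
    (HasDerivWithinAt.fun_sum fun l _ => (hF k l).mul_const (y l)).const_mul (y k)

lemma differentiableWithinAt_det [DecidableEq ι] (hF : HasMatDeriv F F' S s) :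
    DifferentiableWithinAt ℝ (fun t => (F t).det) S s := by
  simp only [det_apply]
  refine DifferentiableWithinAt.fun_sum fun σ _ => DifferentiableWithinAt.const_smul ?_ _
  exact DifferentiableWithinAt.fun_finsetProd fun i _ => (hF _ _).differentiableWithinAt

/-- Cramer's rule gives differentiability of the entries; the value then follows by differentiating
`F F⁻¹ = 1` and using uniqueness of the derivative within `S`. -/
lemma inv [DecidableEq ι] (hF : HasMatDeriv F F' S s) (hs : s ∈ S) (hS : UniqueDiffWithinAt ℝ S s)
    (hu : ∀ t ∈ S, IsUnit (F t)) :
    HasMatDeriv (fun t => (F t)⁻¹) (-((F s)⁻¹ * F' * (F s)⁻¹)) S s := by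
  have hdet : ∀ t ∈ S, IsUnit (F t).det := fun t ht => (isUnit_iff_isUnit_det _).1 (hu t ht)
  have hdiff : ∀ k l, DifferentiableWithinAt ℝ (fun t => (F t)⁻¹ k l) S s := fun k l => by
    have h1 : ∀ t, (F t)⁻¹ k l
        = ((F t).det)⁻¹ * ((F t).updateRow l (Pi.single k 1)).det := fun t => by
      rw [inv_def, Ring.inverse_eq_inv', Matrix.smul_apply, adjugate_apply, smul_eq_mul]
    simp only [h1]
    refine (hF.differentiableWithinAt_det.inv (hdet s hs).ne_zero).mul ?_
    have h2 : HasMatDeriv (fun t => (F t).updateRow l (Pi.single k 1)) (F'.updateRow l 0) S s :=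
        fun i j => by
      by_cases h : i = l
      · subst h
        simpa using hasDerivWithinAt_const s S ((Pi.single k 1 : ι → ℝ) j)
      · simpa [updateRow_apply, h] using hF i j
    exact h2.differentiableWithinAt_det
  set G' : Matrix ι ι ℝ := Matrix.of fun k l => derivWithin (fun t => (F t)⁻¹ k l) S s
  have hG : HasMatDeriv (fun t => (F t)⁻¹) G' S s := fun k l => (hdiff k l).hasDerivWithinAt
  have h0 : F' * (F s)⁻¹ + F s * G' = 0 := by
    ext k l
    refine hS.eq_deriv S ((hF.mul hG) k l) ?_
    refine (hasDerivWithinAt_const s S ((1 : Matrix ι ι ℝ) k l)).congr (fun t ht => ?_) ?_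
    · change (F t * (F t)⁻¹) k l = _
      rw [mul_nonsing_inv _ (hdet t ht)]
    · change (F s * (F s)⁻¹) k l = _
      rw [mul_nonsing_inv _ (hdet s hs)]
  have h1 : G' = -((F s)⁻¹ * F' * (F s)⁻¹) := by
    have h2 := congrArg (fun Z => (F s)⁻¹ * Z) h0
    simp only [mul_add, mul_zero, ← mul_assoc, nonsing_inv_mul _ (hdet s hs), one_mul] at h2
    exact eq_neg_of_add_eq_zero_right h2
  rw [← h1]
  exact hG

end HasMatDeriv

variable {n : ℕ}

/-- The gradient matrix, in terms of the inverse `A` of the covariance matrix and of the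
derivative `D` of the covariance matrix. -/
def gradOf (A D : Matrix (Fin n) (Fin n) ℝ) : Matrix (Fin n) (Fin n) ℝ :=
  A * (diagPart A)⁻¹ ^ 2 * (diagPart (A * D * A) * (diagPart A)⁻¹ - A * D) * A

/-- The derivative of the gradient matrix. -/
def hessOf (A Di Dj Dij : Matrix (Fin n) (Fin n) ℝ) : Matrix (Fin n) (Fin n) ℝ :=
  let B := (diagPart A)⁻¹
  let P := A * Di * A
  let Q := diagPart (A * Dj * A) * B - A * Dj
  let B' := B * diagPart P * B
  let Q' := diagPart (A * Dij * A - P * Dj * A - A * Dj * P) * B + diagPart (A * Dj * A) * B'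
    + P * Dj - A * Dij
  A * (B' * B + B * B') * Q * A + A * (B * B) * Q' * A - P * (B * B) * Q * A - A * (B * B) * Q * P

lemma diagPart_neg (A : Matrix (Fin n) (Fin n) ℝ) : diagPart (-A) = -diagPart A := by
  simp [diagPart]

section

variable {R E : ℝ → Matrix (Fin n) (Fin n) ℝ} {R' E' : Matrix (Fin n) (Fin n) ℝ} {S : Set ℝ}
  {s : ℝ}

lemma hasMatDeriv_inv_diagPart_inv (hR : HasMatDeriv R R' S s) (hs : s ∈ S)
    (hS : UniqueDiffWithinAt ℝ S s) (hu : ∀ t ∈ S, IsUnit (R t))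
    (hu' : ∀ t ∈ S, IsUnit (diagPart (R t)⁻¹)) :
    HasMatDeriv (fun t => (diagPart (R t)⁻¹)⁻¹) ((diagPart (R s)⁻¹)⁻¹
      * diagPart ((R s)⁻¹ * R' * (R s)⁻¹) * (diagPart (R s)⁻¹)⁻¹) S s := by
  refine ((hR.inv hs hS hu).diagonal.inv hs hS hu').congr_deriv ?_
  change -(_ * diagPart (-((R s)⁻¹ * R' * (R s)⁻¹)) * _) = _
  rw [diagPart_neg]
  simp only [mul_neg, neg_mul, neg_neg]
  rfl

/-- `E` plays the role of one first derivative of `R` while another coordinate moves, so `E'` is the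
mixed second derivative. -/
lemma hasMatDeriv_gradOf (hR : HasMatDeriv R R' S s) (hE : HasMatDeriv E E' S s) (hs : s ∈ S)
    (hS : UniqueDiffWithinAt ℝ S s) (hu : ∀ t ∈ S, IsUnit (R t))
    (hu' : ∀ t ∈ S, IsUnit (diagPart (R t)⁻¹)) :
    HasMatDeriv (fun t => gradOf (R t)⁻¹ (E t)) (hessOf (R s)⁻¹ R' (E s) E') S s := by
  have hA := hR.inv hs hS hu
  have hB := hasMatDeriv_inv_diagPart_inv hR hs hS hu hu'
  have hP := ((hA.mul hE).mul hA).diagonal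
  simp only [gradOf, sq]
  refine (((hA.mul (hB.mul hB)).mul ((hP.mul hB).sub (hA.mul hE))).mul hA).congr_deriv ?_
  have e1 : Matrix.diagonal ((-((R s)⁻¹ * R' * (R s)⁻¹) * E s + (R s)⁻¹ * E') * (R s)⁻¹
      + (R s)⁻¹ * E s * -((R s)⁻¹ * R' * (R s)⁻¹)).diag
      = diagPart ((R s)⁻¹ * E' * (R s)⁻¹ - ((R s)⁻¹ * R' * (R s)⁻¹) * E s * (R s)⁻¹
        - (R s)⁻¹ * E s * ((R s)⁻¹ * R' * (R s)⁻¹)) := by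
    unfold diagPart
    congr 2
    noncomm_ring
  rw [e1]
  simp only [hessOf, diagPart]
  noncomm_ring

/-- The product rule yields two terms from `R⁻¹` and two from the squared diagonal. Symmetry of `R`
and `R'` arranges them as a matrix plus its transpose, which accounts for the factor `2` in the
gradient. -/
lemma hasMatDeriv_criterion (hR : HasMatDeriv R R' S s) (hs : s ∈ S)
    (hS : UniqueDiffWithinAt ℝ S s) (hu : ∀ t ∈ S, IsUnit (R t))
    (hu' : ∀ t ∈ S, IsUnit (diagPart (R t)⁻¹)) (hRs : (R s)ᵀ = R s) (hR's : R'ᵀ = R') :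
    HasMatDeriv (fun t => (R t)⁻¹ * (diagPart (R t)⁻¹)⁻¹ ^ 2 * (R t)⁻¹)
      (gradOf (R s)⁻¹ R' + (gradOf (R s)⁻¹ R')ᵀ) S s := by
  have hA := hR.inv hs hS hu
  have hB := hasMatDeriv_inv_diagPart_inv hR hs hS hu hu'
  simp only [sq]
  refine ((hA.mul (hB.mul hB)).mul hA).congr_deriv ?_
  have hAs : ((R s)⁻¹)ᵀ = (R s)⁻¹ := by rw [transpose_nonsing_inv, hRs]
  have hBs : ((diagPart (R s)⁻¹)⁻¹)ᵀ = (diagPart (R s)⁻¹)⁻¹ := by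
    rw [transpose_nonsing_inv]; simp [diagPart]
  have hds : ∀ Z : Matrix (Fin n) (Fin n) ℝ, (diagPart Z)ᵀ = diagPart Z := by simp [diagPart]
  simp only [gradOf, transpose_mul, transpose_sub, hAs, hBs, hR's, hds, sq]
  noncomm_ring

end

lemma dotProduct_add_transpose_mulVec (M : Matrix (Fin n) (Fin n) ℝ) (y : Fin n → ℝ) :
    y ⬝ᵥ ((M + Mᵀ) *ᵥ y) = 2 * (y ⬝ᵥ (M *ᵥ y)) := by
  have : y ⬝ᵥ (Mᵀ *ᵥ y) = y ⬝ᵥ (M *ᵥ y) := by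
    rw [mulVec_transpose, dotProduct_comm, ← dotProduct_mulVec]
  rw [add_mulVec, dotProduct_add, this]
  ring

lemma inv_diagPart {A : Matrix (Fin n) (Fin n) ℝ} (hA : ∀ k, A k k ≠ 0) :
    (diagPart A)⁻¹ = diagonal fun k => (A k k)⁻¹ := by
  refine inv_eq_right_inv ?_
  rw [diagPart, diagonal_mul_diagonal, ← diagonal_one]
  congr 1 with k
  exact mul_inv_cancel₀ (hA k)

lemma trace_diagonal_mul (w : Fin n → ℝ) (Z : Matrix (Fin n) (Fin n) ℝ) :
    (diagonal w * Z).trace = ∑ k, w k * Z k k := by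
  simp [trace, diagonal_mul]

/-- The trace which gives the expectation of the second derivative of the criterion. -/
lemma trace_hessOf {R Di Dj : Matrix (Fin n) (Fin n) ℝ} (Dij : Matrix (Fin n) (Fin n) ℝ)
    (hR : Rᵀ = R) (hi : Diᵀ = Di) (hj : Djᵀ = Dj) (hu : IsUnit R) (hd : ∀ k, R⁻¹ k k ≠ 0) :
    2 * (hessOf R⁻¹ Di Dj Dij * R).trace
      = ((-8 : ℝ) • ((diagPart R⁻¹)⁻¹ ^ 3 * diagPart (R⁻¹ * Di * R⁻¹) * R⁻¹ * Dj * R⁻¹)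
        + (2 : ℝ) • ((diagPart R⁻¹)⁻¹ ^ 2 * R⁻¹ * Di * R⁻¹ * Dj * R⁻¹)
        + (6 : ℝ) • ((diagPart R⁻¹)⁻¹ ^ 4 * diagPart (R⁻¹ * Di * R⁻¹)
          * diagPart (R⁻¹ * Dj * R⁻¹) * R⁻¹)).trace := by
  have hAR : R⁻¹ * R = 1 := nonsing_inv_mul _ ((isUnit_iff_isUnit_det R).1 hu)
  have hAt : (R⁻¹)ᵀ = R⁻¹ := by rw [transpose_nonsing_inv, hR]
  set A := R⁻¹ with hA
  -- Transposition exchanges the roles of `Di` and `Dj` on the diagonal, since all factors are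
  -- symmetric.
  have hsym : ∀ k, (A * Di * A * Dj * A) k k = (A * Dj * A * Di * A) k k := fun k => by
    have : (A * Di * A * Dj * A)ᵀ = A * Dj * A * Di * A := by
      simp only [transpose_mul, hAt, hi, hj, mul_assoc]
    rw [← this, transpose_apply]
  have hAR' : ∀ Z : Matrix (Fin n) (Fin n) ℝ, Z * A * R = Z := fun Z => by
    rw [mul_assoc, hAR, mul_one]
  simp only [hessOf]
  rw [inv_diagPart hd]
  simp only [diagPart]
  set B : Matrix (Fin n) (Fin n) ℝ := diagonal fun k => (A k k)⁻¹ with hB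
  set P := A * Di * A with hP
  set p := P.diag with hp
  set q := (A * Dj * A).diag with hq
  set w := (A * Dij * A - P * Dj * A - A * Dj * P).diag with hw
  have hPR : P * R = A * Di := by rw [hP, hAR']
  -- the individual traces
  have hcyc : ∀ w (X Y : Matrix (Fin n) (Fin n) ℝ), (X * diagonal w * Y).trace
      = ∑ k, w k * (Y * X) k k := fun w X Y => by
    rw [mul_assoc, trace_mul_comm, mul_assoc, trace_diagonal_mul]
  have e0 : ∀ X Y Z W : Matrix (Fin n) (Fin n) ℝ, ((X + Y - Z - W) * R).trace
      = (X * R).trace + (Y * R).trace - (Z * R).trace - (W * R).trace := fun X Y Z W => by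
    simp only [sub_mul, add_mul, trace_sub, trace_add]
  rw [e0]
  have hBB : B * B = diagonal fun k => (A k k)⁻¹ * (A k k)⁻¹ := diagonal_mul_diagonal _ _
  have hB' : B * diagonal p * B * B + B * (B * diagonal p * B)
      = diagonal fun k => 2 * (A k k)⁻¹ ^ 3 * p k := by
    simp only [hB, diagonal_mul_diagonal, diagonal_add]
    congr 1 with k
    ring
  -- With `Q = diag(q) B - A Dj`, the diagonal of `Q A` vanishes: its entries are `q k (A k k)⁻¹ A k
  -- k - q k`.
  have t1 : (A * (B * diagonal p * B * B + B * (B * diagonal p * B)) * (diagonal q * B - A * Dj)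
      * A * R).trace = 0 := by
    rw [hAR', hB', hcyc]
    refine Finset.sum_eq_zero fun k _ => ?_
    rw [sub_mul, Matrix.sub_apply, hB, diagonal_mul_diagonal, diagonal_mul]
    have : (A * Dj * A) k k = q k := rfl
    rw [this]
    field_simp [hd k]
    ring
  have t3 : (P * (B * B) * (diagonal q * B - A * Dj) * A * R).trace
      = ∑ k, (A k k)⁻¹ ^ 2 * (q k * (A k k)⁻¹ * p k - (A * Dj * A * Di * A) k k) := by
    rw [hAR', hBB, hcyc]
    refine Finset.sum_congr rfl fun k _ => ?_
    rw [sub_mul, Matrix.sub_apply, hB, diagonal_mul_diagonal, diagonal_mul, hP]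
    have : A * Dj * (A * Di * A) = A * Dj * A * Di * A := by simp only [mul_assoc]
    rw [this, ← hP]
    have : P k k = p k := rfl
    rw [this]
    ring
  have t4 : (A * (B * B) * (diagonal q * B - A * Dj) * P * R).trace
      = (P * (B * B) * (diagonal q * B - A * Dj) * A * R).trace := by
    rw [hAR', mul_assoc _ P R, hPR, trace_mul_comm]
    simp only [hP, mul_assoc]
  -- Both `A Dij A` and `P Dj A` cancel on the diagonal, so the second derivative of the covariance
  -- disappears.
  have t2 : (A * (B * B) * (diagonal w * B + diagonal q * (B * diagonal p * B) + P * Dj - A * Dij)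
      * A * R).trace = ∑ k, ((A k k)⁻¹ ^ 2 * (- (A * Dj * A * Di * A) k k)
        + (A k k)⁻¹ ^ 3 * p k * q k) := by
    rw [hAR', hBB, hcyc]
    refine Finset.sum_congr rfl fun k _ => ?_
    rw [sub_mul, Matrix.sub_apply, add_mul, Matrix.add_apply, add_mul, Matrix.add_apply]
    simp only [hB, diagonal_mul_diagonal, diagonal_mul]
    have : w k = (A * Dij * A) k k - (P * Dj * A) k k - (A * Dj * A * Di * A) k k := by
      simp only [hw, hP, diag_apply, Matrix.sub_apply, mul_assoc]
    rw [this]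
    field_simp [hd k]
    ring
  rw [t1, t2, t4, t3]
  simp only [trace_add, trace_smul, smul_eq_mul]
  have s1 : (B ^ 3 * diagonal p * A * Dj * A).trace = ∑ k, (A k k)⁻¹ ^ 3 * p k * q k := by
    have : B ^ 3 * diagonal p * A * Dj * A
        = diagonal (fun k => (A k k)⁻¹ ^ 3 * p k) * (A * Dj * A) := by
      rw [hB, diagonal_pow, diagonal_mul_diagonal]
      simp only [mul_assoc]; rfl
    rw [this, trace_diagonal_mul]; rfl
  have s2 : (B ^ 2 * A * Di * A * Dj * A).trace
      = ∑ k, (A k k)⁻¹ ^ 2 * (A * Dj * A * Di * A) k k := by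
    have : B ^ 2 * A * Di * A * Dj * A
        = diagonal (fun k => (A k k)⁻¹ ^ 2) * (P * Dj * A) := by
      rw [hB, diagonal_pow, hP]
      simp only [mul_assoc]; rfl
    rw [this, trace_diagonal_mul]
    exact Finset.sum_congr rfl fun k _ => by rw [hsym]
  have s3 : (B ^ 4 * diagonal p * diagonal q * A).trace = ∑ k, (A k k)⁻¹ ^ 3 * p k * q k := by
    have : B ^ 4 * diagonal p * diagonal q * A
        = diagonal (fun k => (A k k)⁻¹ ^ 4 * p k * q k) * A := by
      rw [hB, diagonal_pow, diagonal_mul_diagonal, diagonal_mul_diagonal]; rfl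
    rw [this, trace_diagonal_mul]
    refine Finset.sum_congr rfl fun k _ => ?_
    field_simp [hd k]
  -- The terms with coefficients `-8` and `6` have the same trace; together they contribute `-2`, as
  -- the left side requires.
  rw [s1, s2, s3]
  simp only [Finset.mul_sum, ← Finset.sum_add_distrib]
  rw [zero_add, ← Finset.sum_sub_distrib, ← Finset.sum_sub_distrib, Finset.mul_sum]
  refine Finset.sum_congr rfl fun k _ => ?_
  ring

end MatrixCalculus

end

/-! ### Fourth moments of Gaussian families and moments of quadratic forms. -/

section

section GaussianMoments

/-- The function is the Gaussian moment generating function; each derivative is a polynomial times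
the same exponential, which `hp` updates. -/
lemma iteratedDeriv_four_exp_mul_sq (v : ℝ) :
    iteratedDeriv 4 (fun t : ℝ => Real.exp (v * t ^ 2 / 2)) 0 = 3 * v ^ 2 := by
  have h0 : ∀ t : ℝ, HasDerivAt (fun t : ℝ => Real.exp (v * t ^ 2 / 2))
      (v * t * Real.exp (v * t ^ 2 / 2)) t := fun t => by
    have h := ((((hasDerivAt_id t).pow 2).const_mul v).div_const 2).exp
    refine h.congr_deriv ?_
    simp
    ring
  have hp : ∀ (P : ℝ → ℝ) (P' : ℝ → ℝ), (∀ t, HasDerivAt P (P' t) t) →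
      deriv (fun t => P t * Real.exp (v * t ^ 2 / 2))
        = fun t => (P' t + P t * (v * t)) * Real.exp (v * t ^ 2 / 2) := fun P P' hP => by
    ext t
    rw [((hP t).fun_mul (h0 t)).deriv]
    ring
  have d1 : deriv (fun t : ℝ => Real.exp (v * t ^ 2 / 2))
      = fun t => (v * t) * Real.exp (v * t ^ 2 / 2) := by
    ext t
    rw [(h0 t).deriv]
  have q1 : ∀ t : ℝ, HasDerivAt (fun t : ℝ => v * t) v t := fun t => by
    simpa using (hasDerivAt_id t).const_mul v
  have q2 : ∀ t : ℝ, HasDerivAt (fun t : ℝ => v + v * t * (v * t)) (2 * v ^ 2 * t) t := fun t => by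
    refine (((q1 t).mul (q1 t)).const_add v).congr_deriv ?_
    ring
  have q3 : ∀ t : ℝ, HasDerivAt (fun t : ℝ => 2 * v ^ 2 * t + (v + v * t * (v * t)) * (v * t))
      (2 * v ^ 2 + (2 * v ^ 2 * t * (v * t) + (v + v * t * (v * t)) * v)) t := fun t => by
    have h1 : HasDerivAt (fun t : ℝ => 2 * v ^ 2 * t) (2 * v ^ 2) t := by
      simpa using (hasDerivAt_id t).const_mul (2 * v ^ 2)
    exact h1.add ((q2 t).mul (q1 t))
  rw [iteratedDeriv_succ, iteratedDeriv_succ, iteratedDeriv_succ, iteratedDeriv_one, d1,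
    hp _ _ q1, hp _ _ q2, hp _ _ q3]
  simp
  ring

lemma integral_pow_four_gaussianReal (v : NNReal) :
    ∫ x, x ^ 4 ∂(gaussianReal 0 v) = 3 * (v : ℝ) ^ 2 := by
  have h := iteratedDeriv_mgf_zero (X := id) (μ := gaussianReal 0 v)
    (by rw [integrableExpSet_id_gaussianReal]; simp) 4
  rw [mgf_id_gaussianReal] at h
  simp only [zero_mul, zero_add] at h
  rw [iteratedDeriv_four_exp_mul_sq] at h
  rw [h]
  rfl

variable {Ω : Type*} [MeasurableSpace Ω] {μ : Measure Ω}

lemma integral_pow_four_of_hasGaussianLaw {Z : Ω → ℝ} (hZ : HasGaussianLaw Z μ)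
    (h0 : ∫ ω, Z ω ∂μ = 0) : ∫ ω, Z ω ^ 4 ∂μ = 3 * (∫ ω, Z ω ^ 2 ∂μ) ^ 2 := by
  have := hZ.isProbabilityMeasure
  have hlaw := hZ.map_eq_gaussianReal
  rw [h0] at hlaw
  have h1 : ∫ ω, Z ω ^ 4 ∂μ = ∫ x, x ^ 4 ∂(μ.map Z) := by
    rw [integral_map hZ.aemeasurable (by fun_prop)]
  rw [h1, hlaw, integral_pow_four_gaussianReal, Real.coe_toNNReal _ (variance_nonneg _ _),
    variance_of_integral_eq_zero hZ.aemeasurable h0]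

/-- The fourth order moments of a centered Gaussian family. -/
lemma integral_mul_four {W : Fin 4 → Ω → ℝ}
    (hW : ∀ a : Fin 4 → ℝ, HasGaussianLaw (fun ω => ∑ i, a i * W i ω) μ)
    (h0 : ∀ i, ∫ ω, W i ω ∂μ = 0) {κ : Fin 4 → Fin 4 → ℝ}
    (hκ : ∀ i j, ∫ ω, W i ω * W j ω ∂μ = κ i j) :
    ∫ ω, W 0 ω * W 1 ω * W 2 ω * W 3 ω ∂μ
      = κ 0 1 * κ 2 3 + κ 0 2 * κ 1 3 + κ 0 3 * κ 1 2 := by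
  have hWi : ∀ i, HasGaussianLaw (W i) μ := fun i => by
    have := hW (Pi.single i 1)
    simpa [Pi.single_apply] using this
  have hsq : ∀ a : Fin 4 → ℝ, ∫ ω, (∑ i, a i * W i ω) ^ 2 ∂μ = ∑ i, ∑ j, a i * a j * κ i j := by
    intro a
    have hint : ∀ i j, Integrable (fun ω => a i * W i ω * (a j * W j ω)) μ := fun i j =>
      ((hWi i).memLp_two.const_mul (a i)).integrable_mul ((hWi j).memLp_two.const_mul (a j))
    simp only [sq, Finset.sum_mul_sum]
    rw [integral_finsetSum _ fun i _ => integrable_finsetSum _ fun j _ => hint i j]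
    refine Finset.sum_congr rfl fun i _ => ?_
    rw [integral_finsetSum _ fun j _ => hint i j]
    refine Finset.sum_congr rfl fun j _ => ?_
    rw [← hκ, ← integral_const_mul]
    congr 1 with ω
    ring
  have hfour : ∀ a : Fin 4 → ℝ, ∫ ω, (∑ i, a i * W i ω) ^ 4 ∂μ
      = 3 * (∑ i, ∑ j, a i * a j * κ i j) ^ 2 := fun a => by
    rw [integral_pow_four_of_hasGaussianLaw (hW a), hsq]
    rw [integral_finsetSum _ fun i _ => ((hWi i).integrable.const_mul (a i))]
    refine Finset.sum_eq_zero fun i _ => ?_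
    rw [integral_const_mul, h0, mul_zero]
  have hint4 : ∀ a : Fin 4 → ℝ, Integrable (fun ω => (∑ i, a i * W i ω) ^ 4) μ := fun a => by
    have h := ((hW a).memLp (p := (4 : ℕ)) (by simp)).integrable_norm_pow (by norm_num)
    refine h.congr (Eventually.of_forall fun ω => ?_)
    simp only [Real.norm_eq_abs]
    exact Even.pow_abs (by decide) _
  let s : Fin 2 → ℝ := ![1, -1]
  -- Polarization: summing over the eight sign choices isolates the multilinear term, with `192 = 8
  -- · 4!`. The mixed moment is thus reduced to fourth moments of linear combinations.
  have hpol : ∀ ω, W 0 ω * W 1 ω * W 2 ω * W 3 ω = ∑ i, ∑ j, ∑ k,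
      s i * s j * s k / 192 * (∑ l, (![1, s i, s j, s k] : Fin 4 → ℝ) l * W l ω) ^ 4 := fun ω => by
    simp only [Fin.sum_univ_two, Fin.sum_univ_four, s, Matrix.cons_val]
    ring
  have hsymm : ∀ i j, κ i j = κ j i := fun i j => by
    rw [← hκ, ← hκ]
    simp only [mul_comm]
  simp only [hpol]
  rw [integral_finsetSum _ fun i _ => integrable_finsetSum _ fun j _ =>
    integrable_finsetSum _ fun k _ => (hint4 _).const_mul _]
  have : ∀ i j k : Fin 2, ∫ ω, s i * s j * s k / 192
      * (∑ l, (![1, s i, s j, s k] : Fin 4 → ℝ) l * W l ω) ^ 4 ∂μ = s i * s j * s k / 192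
      * (3 * (∑ l, ∑ m, (![1, s i, s j, s k] : Fin 4 → ℝ) l
        * (![1, s i, s j, s k] : Fin 4 → ℝ) m * κ l m) ^ 2) := fun i j k => by
    rw [integral_const_mul, hfour]
  have h2 : ∀ i : Fin 2, ∫ ω, ∑ j, ∑ k, s i * s j * s k / 192
      * (∑ l, (![1, s i, s j, s k] : Fin 4 → ℝ) l * W l ω) ^ 4 ∂μ = ∑ j, ∑ k,
      s i * s j * s k / 192 * (3 * (∑ l, ∑ m, (![1, s i, s j, s k] : Fin 4 → ℝ) l
        * (![1, s i, s j, s k] : Fin 4 → ℝ) m * κ l m) ^ 2) := fun i => by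
    rw [integral_finsetSum _ fun j _ => integrable_finsetSum _ fun k _ => (hint4 _).const_mul _]
    refine Finset.sum_congr rfl fun j _ => ?_
    rw [integral_finsetSum _ fun k _ => (hint4 _).const_mul _]
    exact Finset.sum_congr rfl fun k _ => this i j k
  simp only [h2]
  simp only [Fin.sum_univ_two, Fin.sum_univ_four, s, Matrix.cons_val]
  rw [hsymm 1 0, hsymm 2 0, hsymm 3 0, hsymm 2 1, hsymm 3 1, hsymm 3 2]
  ring

/-- Passing to the finite set of distinct times allows repetitions among the `t i`, which the moment
formulas need. -/
lemma hasGaussianLaw_linear {T : Type*} {Y : T → Ω → ℝ} (hY : IsGaussianProcess Y μ) {m : ℕ}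
    (t : Fin m → T) (a : Fin m → ℝ) : HasGaussianLaw (fun ω => ∑ i, a i * Y (t i) ω) μ := by
  classical
  set I := Finset.univ.image t
  have ht : ∀ i, t i ∈ I := fun i => Finset.mem_image_of_mem _ (Finset.mem_univ i)
  have h := (hY.hasGaussianLaw I).map_fun
    (∑ i, a i • (ContinuousLinearMap.proj (R := ℝ) (φ := fun _ : I => ℝ) ⟨t i, ht i⟩))
  simpa using h

variable {T : Type*} {Y : T → Ω → ℝ} {κ : T → T → ℝ}

lemma integral_process_mul (h0 : ∀ t, ∫ ω, Y t ω ∂μ = 0)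
    (hκ : ∀ s t, cov[Y s, Y t; μ] = κ s t) (s t : T) : ∫ ω, Y s ω * Y t ω ∂μ = κ s t := by
  rw [← hκ, covariance]
  simp [h0]

lemma integral_process_mul_four (hY : IsGaussianProcess Y μ) (h0 : ∀ t, ∫ ω, Y t ω ∂μ = 0)
    (hκ : ∀ s t, cov[Y s, Y t; μ] = κ s t) (t₀ t₁ t₂ t₃ : T) :
    ∫ ω, Y t₀ ω * Y t₁ ω * Y t₂ ω * Y t₃ ω ∂μ
      = κ t₀ t₁ * κ t₂ t₃ + κ t₀ t₂ * κ t₁ t₃ + κ t₀ t₃ * κ t₁ t₂ := by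
  have := integral_mul_four (W := fun i => Y (![t₀, t₁, t₂, t₃] i))
    (hasGaussianLaw_linear hY ![t₀, t₁, t₂, t₃]) (fun i => h0 _)
    (κ := fun i j => κ (![t₀, t₁, t₂, t₃] i) (![t₀, t₁, t₂, t₃] j))
    (fun i j => integral_process_mul h0 hκ _ _)
  simpa only [Matrix.cons_val] using this

lemma memLp_process (hY : IsGaussianProcess Y μ) (t : T) {q : ENNReal} (hq : q ≠ ⊤) :
    MemLp (Y t) q μ := (hY.hasGaussianLaw_eval t).memLp hq

open Matrix

lemma quadForm_eq_sum {n : ℕ} (M : Matrix (Fin n) (Fin n) ℝ) (y : Fin n → ℝ) :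
    y ⬝ᵥ (M *ᵥ y) = ∑ k, ∑ l, M k l * (y k * y l) := by
  simp only [dotProduct, mulVec, Finset.mul_sum]
  exact Finset.sum_congr rfl fun k _ => Finset.sum_congr rfl fun l _ => by ring

/-- The expectation of a quadratic form in a centered Gaussian vector. -/
lemma integral_quadForm (hY : IsGaussianProcess Y μ) (h0 : ∀ t, ∫ ω, Y t ω ∂μ = 0)
    (hκ : ∀ s t, cov[Y s, Y t; μ] = κ s t) {n : ℕ} (t : Fin n → T)
    (M : Matrix (Fin n) (Fin n) ℝ) :
    ∫ ω, (fun k => Y (t k) ω) ⬝ᵥ (M *ᵥ fun k => Y (t k) ω) ∂μ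
      = (M * (Matrix.of fun k l => κ (t k) (t l))ᵀ).trace := by
  have := hY.isProbabilityMeasure
  have hint : ∀ k l, Integrable (fun ω => M k l * (Y (t k) ω * Y (t l) ω)) μ := fun k l =>
    ((memLp_process hY _ (by simp)).integrable_mul (q := 2) (p := 2)
      (memLp_process hY _ (by simp))).const_mul _
  simp only [quadForm_eq_sum]
  rw [integral_finsetSum _ fun k _ => integrable_finsetSum _ fun l _ => hint k l]
  simp only [trace, diag_apply, Matrix.mul_apply, transpose_apply, Matrix.of_apply]
  refine Finset.sum_congr rfl fun k _ => ?_
  rw [integral_finsetSum _ fun l _ => hint k l]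
  refine Finset.sum_congr rfl fun l _ => ?_
  rw [integral_const_mul, integral_process_mul h0 hκ]

lemma memLp_mul_process (hY : IsGaussianProcess Y μ) (s t : T) :
    MemLp (fun ω => Y s ω * Y t ω) 2 μ := by
  have : ENNReal.HolderTriple 4 4 2 := ⟨by
    rw [← ENNReal.toReal_eq_toReal_iff' (by simp) (by simp), ENNReal.toReal_add (by simp) (by simp)]
    simp only [ENNReal.toReal_inv, ENNReal.toReal_ofNat]
    norm_num⟩
  exact (memLp_process hY t (q := 4) (by simp)).mul' (memLp_process hY s (q := 4) (by simp))

/-- The second order moments of quadratic forms in a centered Gaussian vector. -/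
lemma integral_quadForm_mul_quadForm (hY : IsGaussianProcess Y μ) (h0 : ∀ t, ∫ ω, Y t ω ∂μ = 0)
    (hκ : ∀ s t, cov[Y s, Y t; μ] = κ s t) {n : ℕ} (t : Fin n → T)
    (M N R : Matrix (Fin n) (Fin n) ℝ) (hR : R = Matrix.of fun k l => κ (t k) (t l))
    (hRs : Rᵀ = R) :
    ∫ ω, ((fun k => Y (t k) ω) ⬝ᵥ (M *ᵥ fun k => Y (t k) ω))
      * ((fun k => Y (t k) ω) ⬝ᵥ (N *ᵥ fun k => Y (t k) ω)) ∂μ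
      = (M * R).trace * (N * R).trace + (M * R * Nᵀ * R).trace + (M * R * N * R).trace := by
  have hRe : ∀ k l, κ (t k) (t l) = R k l := fun k l => by rw [hR]; rfl
  have hRe' : ∀ k l, R k l = R l k := fun k l => by
    conv_lhs => rw [← hRs]
    rfl
  have hint : ∀ k l i j, Integrable (fun ω => M k l * (Y (t k) ω * Y (t l) ω)
      * (N i j * (Y (t i) ω * Y (t j) ω))) μ := fun k l i j =>
    ((memLp_mul_process hY (t k) (t l)).const_mul (M k l)).integrable_mul
      ((memLp_mul_process hY (t i) (t j)).const_mul (N i j))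
  have hval : ∀ k l i j, ∫ ω, M k l * (Y (t k) ω * Y (t l) ω)
      * (N i j * (Y (t i) ω * Y (t j) ω)) ∂μ
      = M k l * N i j * (R k l * R i j + R k i * R l j + R k j * R l i) := fun k l i j => by
    have := integral_process_mul_four hY h0 hκ (t k) (t l) (t i) (t j)
    simp only [hRe] at this
    rw [← this, ← integral_const_mul]
    congr 1 with ω
    ring
  simp only [quadForm_eq_sum, Finset.sum_mul_sum]
  rw [integral_finsetSum _ fun k _ => integrable_finsetSum _ fun i _ => integrable_finsetSum _
    fun l _ => integrable_finsetSum _ fun j _ => hint k l i j]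
  have hsum : ∀ k, ∫ ω, ∑ i, ∑ l, ∑ j, M k l * (Y (t k) ω * Y (t l) ω)
      * (N i j * (Y (t i) ω * Y (t j) ω)) ∂μ = ∑ i, ∑ l, ∑ j,
      M k l * N i j * (R k l * R i j + R k i * R l j + R k j * R l i) := fun k => by
    rw [integral_finsetSum _ fun i _ => integrable_finsetSum _
      fun l _ => integrable_finsetSum _ fun j _ => hint k l i j]
    refine Finset.sum_congr rfl fun i _ => ?_
    rw [integral_finsetSum _ fun l _ => integrable_finsetSum _ fun j _ => hint k l i j]
    refine Finset.sum_congr rfl fun l _ => ?_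
    rw [integral_finsetSum _ fun j _ => hint k l i j]
    exact Finset.sum_congr rfl fun j _ => hval k l i j
  simp only [hsum, mul_add, Finset.sum_add_distrib]
  -- The three Gaussian pairings are matched one by one with the three trace terms.
  congr 1
  · congr 1
    · simp only [trace, diag_apply, Matrix.mul_apply]
      rw [Finset.sum_mul_sum]
      refine Finset.sum_congr rfl fun k _ => Finset.sum_congr rfl fun i _ => ?_
      rw [Finset.sum_mul_sum]
      refine Finset.sum_congr rfl fun l _ => Finset.sum_congr rfl fun j _ => ?_
      rw [hRe' l k, hRe' j i]
      ring
    · simp only [trace, diag_apply, Matrix.mul_apply, transpose_apply, Finset.sum_mul]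
      refine Finset.sum_congr rfl fun k _ => Finset.sum_congr rfl fun i _ => ?_
      rw [Finset.sum_comm]
      refine Finset.sum_congr rfl fun j _ => Finset.sum_congr rfl fun l _ => ?_
      rw [hRe' k i]
      ring
  · simp only [trace, diag_apply, Matrix.mul_apply, Finset.sum_mul]
    refine Finset.sum_congr rfl fun k _ => ?_
    have : ∀ i, ∑ l, ∑ j, M k l * N i j * (R k j * R l i)
        = ∑ j, ∑ l, M k l * N i j * (R k j * R l i) := fun i => Finset.sum_comm
    simp only [this]
    rw [Finset.sum_comm]
    refine Finset.sum_congr rfl fun j _ => Finset.sum_congr rfl fun i _ =>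
      Finset.sum_congr rfl fun l _ => ?_
    rw [hRe' k j]
    ring

end GaussianMoments

end

/-! ### Conditioning on the perturbations in the product space. -/

section

section ProductSpace

variable {ΩX ΩY β : Type*} [MeasurableSpace ΩX] [MeasurableSpace ΩY] [mβ : MeasurableSpace β]
  {PX : Measure ΩX} {PY : Measure ΩY} [IsProbabilityMeasure PX] [IsProbabilityMeasure PY]

/-- On a product space, conditioning on a function of the first coordinate. -/
lemma condExp_prod_ae_eq {φ : ΩX → β} (hφ : Measurable φ) {W : ΩX × ΩY → ℝ}
    (hW : Integrable W (PX.prod PY)) {h : β → ℝ} (hh : Measurable h)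
    (heq : ∀ᵐ ω ∂PX, ∫ ω', W (ω, ω') ∂PY = h (φ ω)) :
    (PX.prod PY)[W | mβ.comap fun ω => φ ω.1] =ᵐ[PX.prod PY] fun ω => h (φ ω.1) := by
  have hφ' : Measurable fun ω : ΩX × ΩY => φ ω.1 := hφ.comp measurable_fst
  have hint : Integrable (fun ω => h (φ ω)) PX := (hW.integral_prod_left).congr heq
  have hint' : Integrable (fun ω : ΩX × ΩY => h (φ ω.1)) (PX.prod PY) := hint.comp_fst PY
  symm
  refine ae_eq_condExp_of_forall_setIntegral_eq hφ'.comap_le hW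
    (fun s _ _ => hint'.integrableOn) (fun s hs _ => ?_) ?_
  · obtain ⟨B, hB, rfl⟩ := hs
    -- The conditioning events are cylinders over the first coordinate, so Fubini reduces the claim
    -- to `heq`.
    have e : (fun ω : ΩX × ΩY => φ ω.1) ⁻¹' B = (φ ⁻¹' B) ×ˢ Set.univ := by
      ext ω; simp
    rw [e, setIntegral_prod _ hint'.integrableOn, setIntegral_prod _ hW.integrableOn]
    refine integral_congr_ae ((ae_restrict_of_ae heq).mono fun ω hω => ?_)
    simp only [setIntegral_univ]
    rw [hω]
    simp
  · refine (Measurable.stronglyMeasurable ?_).aestronglyMeasurable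
    exact hh.comp (comap_measurable _)

lemma condCov_congr {Ω : Type*} {m m₀ : MeasurableSpace Ω} {μ : Measure Ω} {U U' V V' : Ω → ℝ}
    (hU : U =ᵐ[μ] U') (hV : V =ᵐ[μ] V') : condCov m U V μ =ᵐ[μ] condCov m U' V' μ := by
  refine condExp_congr_ae ?_
  filter_upwards [hU, hV, condExp_congr_ae (m := m) hU, condExp_congr_ae (m := m) hV]
    with ω h1 h2 h3 h4
  simp only [Pi.mul_apply, Pi.sub_apply, h1, h2, h3, h4]

/-- On a product space, the conditional covariance given a function of the first coordinate. -/
lemma condCov_prod_ae_eq {φ : ΩX → β} (hφ : Measurable φ) {U V : ΩX × ΩY → ℝ}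
    (hU : MemLp U 2 (PX.prod PY)) (hV : MemLp V 2 (PX.prod PY)) {hu hv h : β → ℝ}
    (hum : Measurable hu) (hvm : Measurable hv) (hm : Measurable h)
    (hUeq : ∀ᵐ ω ∂PX, ∫ ω', U (ω, ω') ∂PY = hu (φ ω))
    (hVeq : ∀ᵐ ω ∂PX, ∫ ω', V (ω, ω') ∂PY = hv (φ ω))
    (heq : ∀ᵐ ω ∂PX, ∫ ω', (U (ω, ω') - hu (φ ω)) * (V (ω, ω') - hv (φ ω)) ∂PY = h (φ ω)) :
    condCov (mβ.comap fun ω => φ ω.1) U V (PX.prod PY) =ᵐ[PX.prod PY] fun ω => h (φ ω.1) := by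
  have hU' := condExp_prod_ae_eq hφ (hU.integrable (by norm_num)) hum hUeq
  have hV' := condExp_prod_ae_eq hφ (hV.integrable (by norm_num)) hvm hVeq
  -- Square integrability of the conditional means comes from that of conditional expectations of
  -- square integrable variables.
  have hu2 : MemLp (fun ω : ΩX × ΩY => hu (φ ω.1)) 2 (PX.prod PY) :=
    (memLp_congr_ae hU').1 (hU.condExp (by norm_num))
  have hv2 : MemLp (fun ω : ΩX × ΩY => hv (φ ω.1)) 2 (PX.prod PY) :=
    (memLp_congr_ae hV').1 (hV.condExp (by norm_num))
  have hcong : (U - (PX.prod PY)[U | mβ.comap fun ω => φ ω.1])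
      * (V - (PX.prod PY)[V | mβ.comap fun ω => φ ω.1])
      =ᵐ[PX.prod PY] fun ω => (U ω - hu (φ ω.1)) * (V ω - hv (φ ω.1)) := by
    filter_upwards [hU', hV'] with ω h1 h2
    simp only [Pi.mul_apply, Pi.sub_apply, h1, h2]
  refine (condExp_congr_ae hcong).trans (condExp_prod_ae_eq hφ ?_ hm heq)
  exact (hU.sub hu2).integrable_mul (hV.sub hv2)

end ProductSpace

section RandomQuadForm

open Matrix

variable {d n : ℕ} {ΩX ΩY : Type*} [MeasurableSpace ΩX] [MeasurableSpace ΩY]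
  {PX : Measure ΩX} {PY : Measure ΩY} [IsProbabilityMeasure PX] [IsProbabilityMeasure PY]
  {v : ℕ → Fin d → ℕ} {ε : ℝ} {X : ℕ → ΩX → EuclideanSpace ℝ (Fin d)}
  {Y : EuclideanSpace ℝ (Fin d) → ΩY → ℝ} {k₀ : EuclideanSpace ℝ (Fin d) → ℝ}

/-- The quadratic form of the observations with a matrix which depends on the perturbations. -/
def randomQuad (v : ℕ → Fin d → ℕ) (ε : ℝ) (X : ℕ → ΩX → EuclideanSpace ℝ (Fin d))
    (Y : EuclideanSpace ℝ (Fin d) → ΩY → ℝ)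
    (M : (Fin n → EuclideanSpace ℝ (Fin d)) → Matrix (Fin n) (Fin n) ℝ) (ω : ΩX × ΩY) : ℝ :=
  observations v ε X Y n ω ⬝ᵥ (M (firstPerturbations X n ω.1) *ᵥ observations v ε X Y n ω)

/-- The covariance matrix of the observations given the perturbations. -/
def kernelMat (k₀ : EuclideanSpace ℝ (Fin d) → ℝ) (v : ℕ → Fin d → ℕ) (ε : ℝ)
    (x : Fin n → EuclideanSpace ℝ (Fin d)) : Matrix (Fin n) (Fin n) ℝ :=
  Matrix.of fun k l => k₀ (gridPoint (v k) - gridPoint (v l) + ε • (x k - x l))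

lemma measurable_firstPerturbations (hX : ∀ k, Measurable (X k)) :
    Measurable (firstPerturbations X n) := measurable_pi_lambda _ fun k => hX k

lemma measurable_observation (hX : ∀ k, Measurable (X k)) (hYm : Measurable (Function.uncurry Y))
    (k : ℕ) : Measurable fun ω : ΩX × ΩY => Y (gridPoint (v k) + ε • X k ω.1) ω.2 := by
  refine hYm.comp (Measurable.prodMk ?_ measurable_snd)
  exact ((((hX k).comp measurable_fst).const_smul ε).const_add _)

/-- The law of `Y t` does not depend on `t`, so evaluating at a random point that lives on the other
factor keeps the law `N(0, k₀ 0)`, which has all moments. -/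
lemma memLp_observation (hX : ∀ k, Measurable (X k)) (hYm : Measurable (Function.uncurry Y))
    (hY : IsGaussianProcess Y PY) (h0 : ∀ t, ∫ ω, Y t ω ∂PY = 0)
    (hcov : ∀ s t, cov[Y s, Y t; PY] = k₀ (s - t)) (k : ℕ) {q : ENNReal} (hq : q ≠ ⊤) :
    MemLp (fun ω : ΩX × ΩY => Y (gridPoint (v k) + ε • X k ω.1) ω.2) q (PX.prod PY) := by
  have hm := measurable_observation (v := v) (ε := ε) (X := X) (Y := Y) hX hYm k
  have hlaw : ∀ t, PY.map (Y t) = gaussianReal 0 (k₀ 0).toNNReal := fun t => by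
    have h1 := (hY.hasGaussianLaw_eval t).map_eq_gaussianReal
    have h2 : Var[Y t; PY] = k₀ 0 := by
      rw [← covariance_self (hY.aemeasurable t), hcov, sub_self]
    rwa [h0, h2] at h1
  have hmap : (PX.prod PY).map (fun ω : ΩX × ΩY => Y (gridPoint (v k) + ε • X k ω.1) ω.2)
      = gaussianReal 0 (k₀ 0).toNNReal := by
    ext B hB
    rw [Measure.map_apply hm hB, Measure.prod_apply (hm hB)]
    have : ∀ ω, PY (Prod.mk ω ⁻¹' ((fun ω : ΩX × ΩY =>
        Y (gridPoint (v k) + ε • X k ω.1) ω.2) ⁻¹' B)) = gaussianReal 0 (k₀ 0).toNNReal B := by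
      intro ω
      rw [← hlaw (gridPoint (v k) + ε • X k ω), Measure.map_apply (hYm.of_uncurry_left) hB]
      rfl
    simp [this]
  have h := memLp_id_gaussianReal' (μ := 0) (v := (k₀ 0).toNNReal) q hq
  rw [← hmap] at h
  exact (memLp_map_measure_iff aestronglyMeasurable_id hm.aemeasurable).1 h

/-- A matrix valued function of the perturbations with measurable entries, bounded on the support
of the law. -/
structure IsTame (L : Measure (EuclideanSpace ℝ (Fin d)))
    (M : (Fin n → EuclideanSpace ℝ (Fin d)) → Matrix (Fin n) (Fin n) ℝ) : Prop where
  meas : ∀ k l, Measurable fun x => M x k l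
  bound : ∃ C : ℝ, ∀ x, (∀ k, x k ∈ L.support) → ∀ k l, |M x k l| ≤ C

variable {L : Measure (EuclideanSpace ℝ (Fin d))}
  {M N : (Fin n → EuclideanSpace ℝ (Fin d)) → Matrix (Fin n) (Fin n) ℝ}

/-- Almost surely bounded coefficients multiply products of two variables in `L⁴`. -/
lemma memLp_randomQuad (hL : IsPerturbationLaw L) (hX : ∀ k, Measurable (X k))
    (hXL : ∀ k, PX.map (X k) = L) (hYm : Measurable (Function.uncurry Y))
    (hY : IsGaussianProcess Y PY) (h0 : ∀ t, ∫ ω, Y t ω ∂PY = 0)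
    (hcov : ∀ s t, cov[Y s, Y t; PY] = k₀ (s - t)) (hM : IsTame L M) :
    MemLp (randomQuad v ε X Y M) 2 (PX.prod PY) := by
  have : ENNReal.HolderTriple 4 4 2 := ⟨by
    rw [← ENNReal.toReal_eq_toReal_iff' (by simp) (by simp), ENNReal.toReal_add (by simp) (by simp)]
    simp only [ENNReal.toReal_inv, ENNReal.toReal_ofNat]
    norm_num⟩
  obtain ⟨C, hC⟩ := hM.bound
  have hsupp : ∀ᵐ ω ∂(PX.prod PY), ∀ k, X k ω.1 ∈ L.support :=
    Measure.quasiMeasurePreserving_fst.ae (ae_mem_of_law hL hX hXL)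
  unfold randomQuad
  simp only [quadForm_eq_sum]
  refine memLp_finsetSum _ fun k _ => memLp_finsetSum _ fun l _ => ?_
  have h1 : MemLp (fun ω : ΩX × ΩY => M (firstPerturbations X n ω.1) k l) ⊤ (PX.prod PY) := by
    refine memLp_top_of_bound (C := C) (((hM.meas k l).comp (measurable_firstPerturbations hX)).comp
      measurable_fst).aestronglyMeasurable ?_
    filter_upwards [hsupp] with ω hω
    exact hC _ (fun k => hω k) k l
  have h2 : MemLp (fun ω : ΩX × ΩY => observations v ε X Y n ω k * observations v ε X Y n ω l) 2
      (PX.prod PY) :=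
    (memLp_observation hX hYm hY h0 hcov l (q := 4) (by simp)).mul'
      (memLp_observation hX hYm hY h0 hcov k (q := 4) (by simp))
  exact h2.mul' h1

lemma measurable_trace_mul {A B : (Fin n → EuclideanSpace ℝ (Fin d)) → Matrix (Fin n) (Fin n) ℝ}
    (hA : ∀ k l, Measurable fun x => A x k l) (hB : ∀ k l, Measurable fun x => B x k l) :
    Measurable fun x => (A x * B x).trace := by
  simp only [trace, diag_apply, Matrix.mul_apply]
  exact Finset.measurable_fun_sum _ fun k _ => Finset.measurable_fun_sum _ fun l _ =>
    (hA k l).fun_mul (hB l k)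

lemma measurable_mul_entries
    {A B : (Fin n → EuclideanSpace ℝ (Fin d)) → Matrix (Fin n) (Fin n) ℝ}
    (hA : ∀ k l, Measurable fun x => A x k l) (hB : ∀ k l, Measurable fun x => B x k l) (k l) :
    Measurable fun x => (A x * B x) k l := by
  simp only [Matrix.mul_apply]
  exact Finset.measurable_fun_sum _ fun j _ => (hA k j).fun_mul (hB j l)

lemma measurable_kernelMat (hk : Measurable k₀) (k l : Fin n) :
    Measurable fun x => kernelMat k₀ v ε x k l := by
  simp only [kernelMat, Matrix.of_apply]
  refine hk.comp ?_
  fun_prop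

omit [MeasurableSpace ΩX] in
lemma kernel_pos_diff (k l : ℕ) (ω : ΩX) : gridPoint (v k) + ε • X k ω
    - (gridPoint (v l) + ε • X l ω) = gridPoint (v k) - gridPoint (v l) + ε • (X k ω - X l ω) := by
  rw [smul_sub]; abel

lemma transpose_kernelMat (hks : ∀ t, k₀ (-t) = k₀ t) (x : Fin n → EuclideanSpace ℝ (Fin d)) :
    (kernelMat k₀ v ε x)ᵀ = kernelMat k₀ v ε x := by
  ext k l
  simp only [kernelMat, transpose_apply, Matrix.of_apply]
  rw [← hks]
  congr 1
  rw [smul_sub, smul_sub]; abel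

omit [MeasurableSpace ΩX] [IsProbabilityMeasure PY] in
lemma integral_randomQuad (hY : IsGaussianProcess Y PY) (h0 : ∀ t, ∫ ω, Y t ω ∂PY = 0)
    (hcov : ∀ s t, cov[Y s, Y t; PY] = k₀ (s - t)) (hks : ∀ t, k₀ (-t) = k₀ t) (ω : ΩX) :
    ∫ ω', randomQuad v ε X Y M (ω, ω') ∂PY = (M (firstPerturbations X n ω)
      * kernelMat k₀ v ε (firstPerturbations X n ω)).trace := by
  have := integral_quadForm hY h0 hcov (fun k : Fin n => gridPoint (v k) + ε • X k ω)
    (M (firstPerturbations X n ω))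
  simp only [kernel_pos_diff] at this
  rw [← transpose_kernelMat hks]
  exact this

lemma condExp_randomQuad (hL : IsPerturbationLaw L) (hX : ∀ k, Measurable (X k))
    (hXL : ∀ k, PX.map (X k) = L) (hYm : Measurable (Function.uncurry Y))
    (hY : IsGaussianProcess Y PY) (h0 : ∀ t, ∫ ω, Y t ω ∂PY = 0)
    (hcov : ∀ s t, cov[Y s, Y t; PY] = k₀ (s - t)) (hks : ∀ t, k₀ (-t) = k₀ t)
    (hk : Measurable k₀) (hM : IsTame L M) :
    (PX.prod PY)[randomQuad v ε X Y M | perturbationSigma ΩY X n] =ᵐ[PX.prod PY] fun ω =>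
      (M (firstPerturbations X n ω.1)
        * kernelMat k₀ v ε (firstPerturbations X n ω.1)).trace :=
  condExp_prod_ae_eq (h := fun x => (M x * kernelMat k₀ v ε x).trace)
    (measurable_firstPerturbations hX)
    ((memLp_randomQuad hL hX hXL hYm hY h0 hcov hM).integrable (by norm_num))
    (measurable_trace_mul hM.meas (measurable_kernelMat hk))
    (Eventually.of_forall fun ω => integral_randomQuad hY h0 hcov hks ω)

/-- For fixed perturbations, the first of the three Gaussian pairings is the product of the means
and is removed by centering. -/
lemma condCov_randomQuad (hL : IsPerturbationLaw L) (hX : ∀ k, Measurable (X k))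
    (hXL : ∀ k, PX.map (X k) = L) (hYm : Measurable (Function.uncurry Y))
    (hY : IsGaussianProcess Y PY) (h0 : ∀ t, ∫ ω, Y t ω ∂PY = 0)
    (hcov : ∀ s t, cov[Y s, Y t; PY] = k₀ (s - t)) (hks : ∀ t, k₀ (-t) = k₀ t)
    (hk : Measurable k₀) (hM : IsTame L M) (hN : IsTame L N) :
    condCov (perturbationSigma ΩY X n) (randomQuad v ε X Y M) (randomQuad v ε X Y N) (PX.prod PY)
      =ᵐ[PX.prod PY] fun ω =>
        (M (firstPerturbations X n ω.1) * kernelMat k₀ v ε (firstPerturbations X n ω.1)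
          * (N (firstPerturbations X n ω.1))ᵀ
          * kernelMat k₀ v ε (firstPerturbations X n ω.1)).trace
        + (M (firstPerturbations X n ω.1) * kernelMat k₀ v ε (firstPerturbations X n ω.1)
          * N (firstPerturbations X n ω.1)
          * kernelMat k₀ v ε (firstPerturbations X n ω.1)).trace := by
  have hR := measurable_kernelMat (v := v) (ε := ε) (n := n) hk
  refine condCov_prod_ae_eq (h := fun x => (M x * kernelMat k₀ v ε x * (N x)ᵀ
      * kernelMat k₀ v ε x).trace + (M x * kernelMat k₀ v ε x * N x * kernelMat k₀ v ε x).trace)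
    (hu := fun x => (M x * kernelMat k₀ v ε x).trace)
    (hv := fun x => (N x * kernelMat k₀ v ε x).trace)
    (measurable_firstPerturbations hX)
    (memLp_randomQuad hL hX hXL hYm hY h0 hcov hM) (memLp_randomQuad hL hX hXL hYm hY h0 hcov hN)
    (measurable_trace_mul hM.meas hR) (measurable_trace_mul hN.meas hR)
    ((measurable_trace_mul (measurable_mul_entries (measurable_mul_entries hM.meas hR)
      fun k l => hN.meas l k) hR).add
      (measurable_trace_mul (measurable_mul_entries (measurable_mul_entries hM.meas hR)
      hN.meas) hR))
    (Eventually.of_forall fun ω => integral_randomQuad hY h0 hcov hks ω)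
    (Eventually.of_forall fun ω => integral_randomQuad hY h0 hcov hks ω)
    (Eventually.of_forall fun ω => ?_)
  have e1 := integral_randomQuad (v := v) (ε := ε) (X := X) (M := M) hY h0 hcov hks ω
  have e2 := integral_randomQuad (v := v) (ε := ε) (X := X) (M := N) hY h0 hcov hks ω
  set x := firstPerturbations X n ω with hx
  set R := kernelMat k₀ v ε x with hRdef
  have hRs : Rᵀ = R := transpose_kernelMat hks x
  have hRe : R = Matrix.of fun k l : Fin n => k₀ (gridPoint (v k) + ε • X k ω
      - (gridPoint (v l) + ε • X l ω)) := by
    simp only [kernel_pos_diff]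
    rfl
  have h2 := integral_quadForm_mul_quadForm hY h0 hcov
    (fun k : Fin n => gridPoint (v k) + ε • X k ω) (M x) (N x) R hRe hRs
  have hsec : ∀ Z : (Fin n → EuclideanSpace ℝ (Fin d)) → Matrix (Fin n) (Fin n) ℝ,
      MemLp (fun ω' => randomQuad v ε X Y Z (ω, ω')) 2 PY := fun Z => by
    unfold randomQuad
    simp only [quadForm_eq_sum]
    refine memLp_finsetSum _ fun k _ => memLp_finsetSum _ fun l _ => ?_
    exact (memLp_mul_process hY (gridPoint (v k) + ε • X k ω)
      (gridPoint (v l) + ε • X l ω)).const_mul (Z (firstPerturbations X n ω) k l)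
  set U : ΩY → ℝ := fun ω' => randomQuad v ε X Y M (ω, ω') with hU
  set V : ΩY → ℝ := fun ω' => randomQuad v ε X Y N (ω, ω') with hV
  have hUV : ∫ ω', U ω' * V ω' ∂PY = (M x * R).trace * (N x * R).trace
      + (M x * R * (N x)ᵀ * R).trace + (M x * R * N x * R).trace := h2
  have hUi : Integrable U PY := (hsec M).integrable (by norm_num)
  have hVi : Integrable V PY := (hsec N).integrable (by norm_num)
  have i1 : Integrable (fun ω' => U ω' * V ω') PY := (hsec M).integrable_mul (hsec N)
  have i2 : Integrable (fun ω' => U ω' * V ω' - (N x * R).trace * U ω') PY :=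
    i1.sub (hUi.const_mul _)
  have i3 : Integrable (fun ω' => U ω' * V ω' - (N x * R).trace * U ω'
      - (M x * R).trace * V ω') PY := i2.sub (hVi.const_mul _)
  have hexp : ∀ ω', (U ω' - (M x * R).trace) * (V ω' - (N x * R).trace)
      = U ω' * V ω' - (N x * R).trace * U ω' - (M x * R).trace * V ω'
        + (M x * R).trace * (N x * R).trace := fun ω' => by ring
  change ∫ ω', (U ω' - (M x * R).trace) * (V ω' - (N x * R).trace) ∂PY = _
  simp only [hexp]
  rw [integral_add i3 (integrable_const _), integral_sub i2 (hVi.const_mul _),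
    integral_sub i1 (hUi.const_mul _), integral_const_mul, integral_const_mul, integral_const]
  rw [hUV, e1, e2]
  simp
  ring

end RandomQuadForm

end

/-! ### Regular families, and locality of the matrices of the criterion. -/

section

section RegularFamily

variable {d p : ℕ} {a b : ℝ} {K : (Fin p → ℝ) → EuclideanSpace ℝ (Fin d) → ℝ}

lemma update_mem_paramSet {θ : Fin p → ℝ} (hθ : θ ∈ paramSet a b) (i : Fin p) {s : ℝ}
    (hs : s ∈ Set.Icc a b) : Function.update θ i s ∈ paramSet a b := fun j => by
  by_cases h : j = i
  · subst h; simpa using hs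
  · simpa [h] using hθ j

lemma partialDeriv_congr {F G : (Fin p → ℝ) → ℝ} (h : ∀ θ ∈ paramSet a b, F θ = G θ) (i : Fin p)
    {θ : Fin p → ℝ} (hθ : θ ∈ paramSet a b) : partialDeriv a b i F θ = partialDeriv a b i G θ :=
  derivWithin_congr (fun _ hs => h _ (update_mem_paramSet hθ i hs))
    (by rw [Function.update_eq_self]; exact h _ hθ)

lemma IsStationaryCovariance.even {k : EuclideanSpace ℝ (Fin d) → ℝ}
    (hk : IsStationaryCovariance k) (t : EuclideanSpace ℝ (Fin d)) : k (-t) = k t := by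
  have h := (hk 2 ![t, 0]).1.apply 0 1
  simpa using h

namespace IsRegularFamily

variable (hK : IsRegularFamily a b K)
include hK

lemma continuous {θ : Fin p → ℝ} (hθ : θ ∈ paramSet a b) : Continuous (K θ) := by
  have h1 : Continuous fun t : EuclideanSpace ℝ (Fin d) =>
      ∫ f, fourierHat (K θ) f * Complex.exp (Complex.I * ((inner ℝ f t : ℝ) : ℂ)) := by
    refine continuous_of_dominated (bound := fun f => ‖fourierHat (K θ) f‖) (fun t => ?_)
      (fun t => Eventually.of_forall fun f => ?_) (hK.fourier_integrable θ hθ).norm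
      (Eventually.of_forall fun f => by fun_prop)
    · exact (hK.fourier_integrable θ hθ).aestronglyMeasurable.mul
        (Continuous.aestronglyMeasurable (by fun_prop))
    · rw [norm_mul, mul_comm Complex.I, Complex.norm_exp_ofReal_mul_I, mul_one]
  have h2 : K θ = fun t => (∫ f, fourierHat (K θ) f
      * Complex.exp (Complex.I * ((inner ℝ f t : ℝ) : ℂ))).re := by
    ext t
    rw [← hK.fourier_inversion θ hθ t, Complex.ofReal_re]
  rw [h2]
  exact Complex.continuous_re.comp h1

lemma exists_coercive {θ : Fin p → ℝ} (hθ : θ ∈ paramSet a b) {ε : ℝ}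
    (hε : ε ∈ Set.Ico (0 : ℝ) (1 / 2)) :
    ∃ m, 0 < m ∧ ∀ c : Config d, c.Valid → Coercive m (baseMat (K θ) ε c) := by
  refine KrigingCV.exists_coercive (hK.fourier_integrable θ hθ) (hK.fourier_inversion θ hθ) ?_
    (hK.fourier_pos θ hθ) hε
  have h := hK.fourier_continuous.comp_continuous
    (f := fun f : EuclideanSpace ℝ (Fin d) => (θ, f)) (by fun_prop) fun f => ⟨hθ, trivial⟩
  exact h

lemma even_iterPartialDeriv (I : List (Fin p)) (t : EuclideanSpace ℝ (Fin d)) :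
    ∀ θ ∈ paramSet a b, iterPartialDeriv a b I (fun ϑ => K ϑ (-t)) θ
      = iterPartialDeriv a b I (fun ϑ => K ϑ t) θ := by
  induction I with
  | nil => exact fun θ hθ => (hK.stationary θ hθ).even t
  | cons i I ih => exact fun θ hθ => partialDeriv_congr ih i hθ

/-- The derivative is the pointwise limit of difference quotients along one sequence of parameters
chosen before `t`. Since `a < b`, each coordinate of `θ` is an accumulation point of the interval.
-/
lemma measurable_iterPartialDeriv (hab : a < b) (I : List (Fin p)) (hI : I.length ≤ 3) :
    ∀ θ ∈ paramSet a b, Measurable fun t : EuclideanSpace ℝ (Fin d) =>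
      iterPartialDeriv a b I (fun ϑ => K ϑ t) θ := by
  induction I with
  | nil => exact fun θ hθ => (hK.continuous hθ).measurable
  | cons i I ih =>
    intro θ hθ
    have hI' : I.length < 3 := by simpa using hI
    have hne : (𝓝[Set.Icc a b \ {θ i}] θ i).NeBot :=
      (accPt_principal_iff_nhdsWithin).1 ((uniqueDiffOn_Icc hab _ (hθ i)).accPt)
    obtain ⟨u, hu⟩ := exists_seq_tendsto (𝓝[Set.Icc a b \ {θ i}] θ i)
    have hmem : ∀ᶠ n in atTop, u n ∈ Set.Icc a b \ {θ i} := hu.eventually self_mem_nhdsWithin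
    obtain ⟨N, hN⟩ := eventually_atTop.1 hmem
    refine measurable_of_tendsto_metrizable (f := fun n t => slope
      (fun s => iterPartialDeriv a b I (fun ϑ => K ϑ t) (Function.update θ i s)) (θ i) (u (n + N)))
      (fun n => ?_) (tendsto_pi_nhds.2 fun t => ?_)
    · simp only [slope_def_field]
      refine Measurable.div_const (Measurable.sub ?_ ?_) _
      · exact ih hI'.le _ (update_mem_paramSet hθ i (hN _ (by omega)).1)
      · exact ih hI'.le _ (update_mem_paramSet hθ i (hθ i))
    · have h := hasDerivWithinAt_iff_tendsto_slope.1
        (hK.differentiable I hI' i θ hθ t).hasDerivWithinAt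
      exact h.comp (hu.comp (tendsto_add_atTop_nat N))

lemma isLocal_baseMat (hab : a < b) (I : List (Fin p)) (hI : I.length ≤ 3) {θ : Fin p → ℝ}
    (hθ : θ ∈ paramSet a b) {ε : ℝ} (hε : ε ∈ Set.Ico (0 : ℝ) (1 / 2)) :
    IsLocal (baseMat (fun t : EuclideanSpace ℝ (Fin d) =>
      iterPartialDeriv a b I (fun ϑ => K ϑ t) θ) ε) := by
  obtain ⟨C, hC⟩ := hK.decay I hI
  exact HasDecay.isLocal ⟨C, hC θ hθ⟩ (hK.measurable_iterPartialDeriv hab I hI θ hθ) hε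

end IsRegularFamily

end RegularFamily

section LocalCriterion

open Matrix

variable {d : ℕ}

/-- The gradient matrix, at each configuration. -/
def gradFun (R D : MatFun d) : MatFun d := fun c =>
  (R c)⁻¹ * (diagonal (R c)⁻¹.diag)⁻¹ ^ 2 * (diagonal ((R c)⁻¹ * D c * (R c)⁻¹).diag
    * (diagonal (R c)⁻¹.diag)⁻¹ - (R c)⁻¹ * D c) * (R c)⁻¹

/-- The derivative of the gradient matrix, at each configuration. -/
def hessFun (R Di Dj Dij : MatFun d) : MatFun d := fun c =>
  let A := (R c)⁻¹
  let B := (diagonal A.diag)⁻¹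
  let P := A * Di c * A
  let Q := diagonal (A * Dj c * A).diag * B - A * Dj c
  let B' := B * diagonal P.diag * B
  let Q' := diagonal (A * Dij c * A - P * Dj c * A - A * Dj c * P).diag * B
    + diagonal (A * Dj c * A).diag * B' + P * Dj c - A * Dij c
  A * (B' * B + B * B') * Q * A + A * (B * B) * Q' * A - P * (B * B) * Q * A - A * (B * B) * Q * P

/-- The matrix of the conditional covariance of the gradient, at each configuration. -/
def covGradFun (R Di Dj : MatFun d) : MatFun d := fun c =>
  (2 : ℝ) • ((gradFun R Di c + (gradFun R Di c)ᵀ) * R c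
    * (gradFun R Dj c + (gradFun R Dj c)ᵀ) * R c)

/-- The matrix of the conditional mean of the Hessian, at each configuration. -/
def meanHessFun (R Di Dj : MatFun d) : MatFun d := fun c =>
  let A := (R c)⁻¹
  let B := (diagonal A.diag)⁻¹
  (-8 : ℝ) • (B ^ 3 * diagonal (A * Di c * A).diag * A * Dj c * A)
    + (2 : ℝ) • (B ^ 2 * A * Di c * A * Dj c * A)
    + (6 : ℝ) • (B ^ 4 * diagonal (A * Di c * A).diag * diagonal (A * Dj c * A).diag * A)

variable {R Di Dj Dij : MatFun d} {m : ℝ}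

/-- Coercivity of `R⁻¹` bounds its diagonal entries below by `m / C²`, so the diagonal part may be
inverted within the class of local matrices. -/
lemma IsLocal.exists_coercive_diag_inv (hm : 0 < m) (hR : IsLocal R)
    (hc : ∀ c : Config d, c.Valid → Coercive m (R c)) :
    ∃ q, 0 < q ∧ ∀ c : Config d, c.Valid → Coercive q (diagonal (R c)⁻¹.diag) := by
  obtain ⟨C, hC0, hC⟩ := hR.bound_pos
  exact ⟨m / C ^ 2, by positivity, fun c hv => coercive_diagonal fun k =>
    ((hc c hv).inv hm hC0 (hC c hv)).le_apply k⟩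

lemma IsLocal.inv_diag_inv (hm : 0 < m) (hR : IsLocal R)
    (hc : ∀ c : Config d, c.Valid → Coercive m (R c)) :
    IsLocal fun c => (diagonal (R c)⁻¹.diag)⁻¹ := by
  obtain ⟨q, hq, hqc⟩ := hR.exists_coercive_diag_inv hm hc
  exact (hR.inv hm hc).diag.inv hq hqc

lemma IsLocal.gradFun (hm : 0 < m) (hR : IsLocal R)
    (hc : ∀ c : Config d, c.Valid → Coercive m (R c)) (hi : IsLocal Di) :
    IsLocal (gradFun R Di) := by
  have hA := hR.inv hm hc
  have hB := hR.inv_diag_inv hm hc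
  exact ((hA.mul (hB.pow 2)).mul ((((hA.mul hi).mul hA).diag.mul hB).sub (hA.mul hi))).mul hA

lemma IsLocal.hessFun (hm : 0 < m) (hR : IsLocal R)
    (hc : ∀ c : Config d, c.Valid → Coercive m (R c)) (hi : IsLocal Di) (hj : IsLocal Dj)
    (hij : IsLocal Dij) : IsLocal (hessFun R Di Dj Dij) := by
  have hA := hR.inv hm hc
  have hB := hR.inv_diag_inv hm hc
  have hP := (hA.mul hi).mul hA
  have hAj := hA.mul hj
  have hQ := ((hAj.mul hA).diag.mul hB).sub hAj
  have hB' := (hB.mul hP.diag).mul hB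
  have hQ' := (((((((hA.mul hij).mul hA).sub ((hP.mul hj).mul hA)).sub (hAj.mul hP)).diag.mul
    hB).add ((hAj.mul hA).diag.mul hB')).add (hP.mul hj)).sub (hA.mul hij)
  have hBB := hB.mul hB
  exact ((((hA.mul ((hB'.mul hB).add (hB.mul hB'))).mul hQ).mul hA).add
    (((hA.mul hBB).mul hQ').mul hA)).sub (((hP.mul hBB).mul hQ).mul hA) |>.sub
    (((hA.mul hBB).mul hQ).mul hP)

lemma IsLocal.covGradFun (hm : 0 < m) (hR : IsLocal R)
    (hc : ∀ c : Config d, c.Valid → Coercive m (R c)) (hi : IsLocal Di) (hj : IsLocal Dj) :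
    IsLocal (covGradFun R Di Dj) := by
  have h1 := hR.gradFun hm hc hi
  have h2 := hR.gradFun hm hc hj
  exact ((((h1.add h1.transpose).mul hR).mul (h2.add h2.transpose)).mul hR).smul 2

lemma IsLocal.meanHessFun (hm : 0 < m) (hR : IsLocal R)
    (hc : ∀ c : Config d, c.Valid → Coercive m (R c)) (hi : IsLocal Di) (hj : IsLocal Dj) :
    IsLocal (meanHessFun R Di Dj) := by
  have hA := hR.inv hm hc
  have hB := hR.inv_diag_inv hm hc
  have hP := (hA.mul hi).mul hA
  have hP' := (hA.mul hj).mul hA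
  exact (((((((hB.pow 3).mul hP.diag).mul hA).mul hj).mul hA).smul (-8)).add
    (((((((hB.pow 2).mul hA).mul hi).mul hA).mul hj).mul hA).smul 2)).add
    (((((hB.pow 4).mul hP.diag).mul hP'.diag).mul hA).smul 6)

lemma IsLocal.isTame (hd : 0 < d) {v : ℕ → Fin d → ℕ} (hv : IsGridEnumeration v)
    {L : Measure (EuclideanSpace ℝ (Fin d))} (hL : IsPerturbationLaw L) (hR : IsLocal R) (n : ℕ) :
    IsTame (n := n) L fun x => R (gridConfig v n x) := by
  obtain ⟨C, hC0, hC⟩ := hR.bound_pos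
  exact ⟨fun k l => hR.meas (Fin n) (fun k => intGrid v k) k l, C, fun x hx k l =>
    (hC _ (valid_gridConfig hd hv fun k => hL.support_subset _ (hx k))).abs_apply_le k l⟩

end LocalCriterion

end

/-! ### Derivatives of the criterion, and its matrices as values of local ones. -/

section

section Derivatives

open Matrix

variable {d p n : ℕ} {a b : ℝ} {K : (Fin p → ℝ) → EuclideanSpace ℝ (Fin d) → ℝ}
  {v : ℕ → Fin d → ℕ} {ε : ℝ} {x : Fin n → EuclideanSpace ℝ (Fin d)}

lemma gridPoint_sub (v : ℕ → Fin d → ℕ) (k l : ℕ) :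
    gridPoint (v k) - gridPoint (v l) = intPoint (intGrid v k - intGrid v l) := by
  ext j
  simp [gridPoint, intPoint, intGrid]

lemma kernelMat_eq_baseMat (k₀ : EuclideanSpace ℝ (Fin d) → ℝ) (v : ℕ → Fin d → ℕ) (ε : ℝ)
    (x : Fin n → EuclideanSpace ℝ (Fin d)) :
    kernelMat k₀ v ε x = baseMat k₀ ε (gridConfig v n x) := by
  ext k l
  change k₀ _ = k₀ _
  rw [gridPoint_sub]
  rfl

variable (a b K v ε x) in
/-- The second order partial derivatives of the covariance matrix, entry by entry. -/
def ddCovMat (i j : Fin p) (θ : Fin p → ℝ) : Matrix (Fin n) (Fin n) ℝ :=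
  kernelMat (fun t => iterPartialDeriv a b [i, j] (fun ϑ => K ϑ t) θ) v ε x

variable (hK : IsRegularFamily a b K)
include hK

lemma transpose_covMat {θ : Fin p → ℝ} (hθ : θ ∈ paramSet a b) :
    (covMat K v ε x θ)ᵀ = covMat K v ε x θ :=
  transpose_kernelMat (hK.stationary θ hθ).even x

lemma transpose_dCovMat (i : Fin p) {θ : Fin p → ℝ} (hθ : θ ∈ paramSet a b) :
    (dCovMat a b K v ε x i θ)ᵀ = dCovMat a b K v ε x i θ :=
  transpose_kernelMat (k₀ := fun t => iterPartialDeriv a b [i] (fun ϑ => K ϑ t) θ)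
    (fun t => hK.even_iterPartialDeriv [i] t θ hθ) x

lemma hasMatDeriv_covMat (i : Fin p) {θ : Fin p → ℝ} (hθ : θ ∈ paramSet a b) :
    HasMatDeriv (fun s => covMat K v ε x (Function.update θ i s)) (dCovMat a b K v ε x i θ)
      (Set.Icc a b) (θ i) := fun _ _ =>
  (hK.differentiable [] (by simp) i θ hθ _).hasDerivWithinAt

lemma hasMatDeriv_dCovMat (i j : Fin p) {θ : Fin p → ℝ} (hθ : θ ∈ paramSet a b) :
    HasMatDeriv (fun s => dCovMat a b K v ε x j (Function.update θ i s))
      (ddCovMat a b K v ε x i j θ) (Set.Icc a b) (θ i) := fun _ _ =>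
  (hK.differentiable [j] (by simp) i θ hθ _).hasDerivWithinAt

variable (hd : 0 < d) (hv : IsGridEnumeration v) (hε : ε ∈ Set.Ico (0 : ℝ) (1 / 2))
  (hx : ∀ k, x k ∈ unitCube d)
include hd hv hε hx

lemma isUnit_covMat {θ : Fin p → ℝ} (hθ : θ ∈ paramSet a b) : IsUnit (covMat K v ε x θ) := by
  obtain ⟨m, hm, hc⟩ := hK.exists_coercive hθ hε
  have h := (hc _ (valid_gridConfig hd hv hx)).isUnit hm
  rw [← kernelMat_eq_baseMat] at h
  exact h

/-- The inverse of a bounded coercive matrix is coercive, and a diagonal entry is a value of its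
quadratic form. -/
lemma inv_covMat_apply_pos {θ : Fin p → ℝ} (hθ : θ ∈ paramSet a b) (k : Fin n) :
    0 < (covMat K v ε x θ)⁻¹ k k := by
  obtain ⟨m, hm, hc⟩ := hK.exists_coercive hθ hε
  obtain ⟨C, hC⟩ := hK.decay [] (by simp)
  obtain ⟨D, hD⟩ := HasDecay.unifBound (h := K θ) ⟨C, hC θ hθ⟩ hε
  have hval := valid_gridConfig hd hv hx
  have h := ((hc _ hval).inv hm (by positivity)
    ((hD _ hval).mono ((le_abs_self D).trans (lt_add_one _).le))).le_apply k
  rw [← kernelMat_eq_baseMat] at h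
  exact lt_of_lt_of_le (by positivity) h

lemma isUnit_diagPart_inv_covMat {θ : Fin p → ℝ} (hθ : θ ∈ paramSet a b) :
    IsUnit (diagPart (covMat K v ε x θ)⁻¹) := by
  rw [isUnit_iff_isUnit_det, diagPart, det_diagonal, isUnit_iff_ne_zero]
  exact Finset.prod_ne_zero_iff.2 fun k _ => (inv_covMat_apply_pos hK hd hv hε hx hθ k).ne'

variable (hab : a < b) (y : Fin n → ℝ)
include hab

lemma hasDerivWithinAt_cv (i : Fin p) {θ : Fin p → ℝ} (hθ : θ ∈ paramSet a b) :
    HasDerivWithinAt (fun s => cv K v ε x y (Function.update θ i s))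
      ((1 / (n : ℝ)) * (2 * (y ⬝ᵥ (gradMat a b K v ε x i θ *ᵥ y)))) (Set.Icc a b) (θ i) := by
  have hmem : ∀ s ∈ Set.Icc a b, Function.update θ i s ∈ paramSet a b :=
    fun s hs => update_mem_paramSet hθ i hs
  have h := hasMatDeriv_criterion (hasMatDeriv_covMat (v := v) (ε := ε) (x := x) hK i hθ) (hθ i)
    (uniqueDiffOn_Icc hab _ (hθ i)) (fun s hs => isUnit_covMat hK hd hv hε hx (hmem s hs))
    (fun s hs => isUnit_diagPart_inv_covMat hK hd hv hε hx (hmem s hs))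
    (transpose_covMat hK (hmem _ (hθ i))) (transpose_dCovMat hK i hθ)
  rw [Function.update_eq_self] at h
  have h2 := (h.dotProduct_mulVec y).const_mul (1 / (n : ℝ))
  rw [dotProduct_add_transpose_mulVec] at h2
  exact h2

lemma partialDeriv_cv (i : Fin p) {θ : Fin p → ℝ} (hθ : θ ∈ paramSet a b) :
    partialDeriv a b i (cv K v ε x y) θ
      = (1 / (n : ℝ)) * (2 * (y ⬝ᵥ (gradMat a b K v ε x i θ *ᵥ y))) :=
  (hasDerivWithinAt_cv hK hd hv hε hx hab y i hθ).derivWithin (uniqueDiffOn_Icc hab _ (hθ i))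

lemma hasDerivWithinAt_partialDeriv_cv (i j : Fin p) {θ : Fin p → ℝ} (hθ : θ ∈ paramSet a b) :
    HasDerivWithinAt (fun s => partialDeriv a b j (cv K v ε x y) (Function.update θ i s))
      ((1 / (n : ℝ)) * (2 * (y ⬝ᵥ (hessOf (covMat K v ε x θ)⁻¹ (dCovMat a b K v ε x i θ)
        (dCovMat a b K v ε x j θ) (ddCovMat a b K v ε x i j θ) *ᵥ y)))) (Set.Icc a b) (θ i) := by
  have hmem : ∀ s ∈ Set.Icc a b, Function.update θ i s ∈ paramSet a b :=
    fun s hs => update_mem_paramSet hθ i hs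
  have h := hasMatDeriv_gradOf (hasMatDeriv_covMat (v := v) (ε := ε) (x := x) hK i hθ)
    (hasMatDeriv_dCovMat (v := v) (ε := ε) (x := x) hK i j hθ) (hθ i)
    (uniqueDiffOn_Icc hab _ (hθ i)) (fun s hs => isUnit_covMat hK hd hv hε hx (hmem s hs))
    (fun s hs => isUnit_diagPart_inv_covMat hK hd hv hε hx (hmem s hs))
  rw [Function.update_eq_self] at h
  refine (((h.dotProduct_mulVec y).const_mul 2).const_mul (1 / (n : ℝ))).congr (fun s hs => ?_) ?_
  · exact partialDeriv_cv hK hd hv hε hx hab y j (hmem s hs)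
  · exact partialDeriv_cv hK hd hv hε hx hab y j (hmem _ (hθ i))

lemma iterPartialDeriv_cv (i j : Fin p) {θ : Fin p → ℝ} (hθ : θ ∈ paramSet a b) :
    iterPartialDeriv a b [i, j] (cv K v ε x y) θ
      = (1 / (n : ℝ)) * (2 * (y ⬝ᵥ (hessOf (covMat K v ε x θ)⁻¹ (dCovMat a b K v ε x i θ)
        (dCovMat a b K v ε x j θ) (ddCovMat a b K v ε x i j θ) *ᵥ y))) :=
  (hasDerivWithinAt_partialDeriv_cv hK hd hv hε hx hab y i j hθ).derivWithin
    (uniqueDiffOn_Icc hab _ (hθ i))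

end Derivatives

section Traces

open Matrix

variable {d p n : ℕ} {a b : ℝ} {K : (Fin p → ℝ) → EuclideanSpace ℝ (Fin d) → ℝ}

variable (a b K) in
/-- The partial derivatives of the covariance matrix, at each configuration. -/
def derivFun (I : List (Fin p)) (θ : Fin p → ℝ) (ε : ℝ) : MatFun d :=
  baseMat (fun t => iterPartialDeriv a b I (fun ϑ => K ϑ t) θ) ε

lemma covMat_eq (v : ℕ → Fin d → ℕ) (ε : ℝ) (x : Fin n → EuclideanSpace ℝ (Fin d))
    (θ : Fin p → ℝ) : covMat K v ε x θ = derivFun a b K [] θ ε (gridConfig v n x) :=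
  kernelMat_eq_baseMat (K θ) v ε x

lemma dCovMat_eq (v : ℕ → Fin d → ℕ) (ε : ℝ) (x : Fin n → EuclideanSpace ℝ (Fin d)) (i : Fin p)
    (θ : Fin p → ℝ) : dCovMat a b K v ε x i θ = derivFun a b K [i] θ ε (gridConfig v n x) :=
  kernelMat_eq_baseMat (fun t => iterPartialDeriv a b [i] (fun ϑ => K ϑ t) θ) v ε x

lemma ddCovMat_eq (v : ℕ → Fin d → ℕ) (ε : ℝ) (x : Fin n → EuclideanSpace ℝ (Fin d)) (i j : Fin p)
    (θ : Fin p → ℝ) :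
    ddCovMat a b K v ε x i j θ = derivFun a b K [i, j] θ ε (gridConfig v n x) :=
  kernelMat_eq_baseMat (fun t => iterPartialDeriv a b [i, j] (fun ϑ => K ϑ t) θ) v ε x

lemma gradMat_eq (v : ℕ → Fin d → ℕ) (ε : ℝ) (x : Fin n → EuclideanSpace ℝ (Fin d)) (i : Fin p)
    (θ : Fin p → ℝ) : gradMat a b K v ε x i θ
      = gradFun (derivFun a b K [] θ ε) (derivFun a b K [i] θ ε) (gridConfig v n x) := by
  simp only [gradMat, gradFun, ← dCovMat_eq, ← covMat_eq]
  rfl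

lemma hessOf_eq (v : ℕ → Fin d → ℕ) (ε : ℝ) (x : Fin n → EuclideanSpace ℝ (Fin d)) (i j : Fin p)
    (θ : Fin p → ℝ) : hessOf (covMat K v ε x θ)⁻¹ (dCovMat a b K v ε x i θ)
        (dCovMat a b K v ε x j θ) (ddCovMat a b K v ε x i j θ)
      = hessFun (derivFun a b K [] θ ε) (derivFun a b K [i] θ ε) (derivFun a b K [j] θ ε)
        (derivFun a b K [i, j] θ ε) (gridConfig v n x) := by
  simp only [hessOf, hessFun, ← dCovMat_eq, ← covMat_eq, ← ddCovMat_eq]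
  rfl

lemma mCV1_eq (v : ℕ → Fin d → ℕ) (ε : ℝ) (x : Fin n → EuclideanSpace ℝ (Fin d)) (i j : Fin p)
    (θ : Fin p → ℝ) : mCV1 a b K v ε x θ i j
      = covGradFun (derivFun a b K [] θ ε) (derivFun a b K [i] θ ε) (derivFun a b K [j] θ ε)
        (gridConfig v n x) := by
  simp only [mCV1, covGradFun, ← gradMat_eq, ← covMat_eq]
  rfl

lemma mCV2_eq (v : ℕ → Fin d → ℕ) (ε : ℝ) (x : Fin n → EuclideanSpace ℝ (Fin d)) (i j : Fin p)
    (θ : Fin p → ℝ) : mCV2 a b K v ε x θ i j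
      = meanHessFun (derivFun a b K [] θ ε) (derivFun a b K [i] θ ε) (derivFun a b K [j] θ ε)
        (gridConfig v n x) := by
  simp only [mCV2, meanHessFun, ← dCovMat_eq, ← covMat_eq]
  rfl

/-- The trace of the conditional covariance matrix of two quadratic forms. -/
lemma trace_add_transpose_mul {M N R : Matrix (Fin n) (Fin n) ℝ} (hR : Rᵀ = R) :
    ((M + Mᵀ) * R * (N + Nᵀ) * R).trace
      = 2 * ((M * R * Nᵀ * R).trace + (M * R * N * R).trace) := by
  -- A trace is unchanged by transposition and cyclic permutation, so transposing both `A` and `B`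
  -- has no effect.
  have h : ∀ A B : Matrix (Fin n) (Fin n) ℝ, (Aᵀ * R * Bᵀ * R).trace = (A * R * B * R).trace :=
      fun A B => by
    rw [← trace_transpose]
    simp only [transpose_mul, hR, transpose_transpose]
    rw [← mul_assoc, ← mul_assoc, trace_mul_comm, ← mul_assoc, ← mul_assoc,
      mul_assoc, trace_mul_comm, ← mul_assoc]
  have h1 := h M N
  have h2 := h M Nᵀ
  rw [transpose_transpose] at h2
  simp only [add_mul, mul_add, trace_add, h1, h2]
  ring

end Traces

end

/-! ### Conditional moments of the gradient and of the Hessian. -/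

section

section Moments

open Matrix

variable {d p : ℕ} {a b : ℝ} {K : (Fin p → ℝ) → EuclideanSpace ℝ (Fin d) → ℝ}
  {L : Measure (EuclideanSpace ℝ (Fin d))} {θ₀ : Fin p → ℝ} {ε : ℝ} {v : ℕ → Fin d → ℕ}
  {ΩX ΩY : Type*} [MeasurableSpace ΩX] [MeasurableSpace ΩY]
  {PX : Measure ΩX} {PY : Measure ΩY} [IsProbabilityMeasure PX] [IsProbabilityMeasure PY]
  {X : ℕ → ΩX → EuclideanSpace ℝ (Fin d)} {Y : EuclideanSpace ℝ (Fin d) → ΩY → ℝ}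

lemma mem_paramSet_of_Ioo (hθ₀ : ∀ i, θ₀ i ∈ Set.Ioo a b) : θ₀ ∈ paramSet a b :=
  fun i => Set.Ioo_subset_Icc_self (hθ₀ i)

lemma IsTame.smul {n : ℕ} {M : (Fin n → EuclideanSpace ℝ (Fin d)) → Matrix (Fin n) (Fin n) ℝ}
    (hM : IsTame L M) (r : ℝ) : IsTame L fun x => r • M x := by
  obtain ⟨C, hC⟩ := hM.bound
  refine ⟨fun k l => (hM.meas k l).const_mul r, |r| * C, fun x hx k l => ?_⟩
  rw [Matrix.smul_apply, smul_eq_mul, abs_mul]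
  exact mul_le_mul_of_nonneg_left (hC x hx k l) (abs_nonneg r)

variable (hd : 0 < d) (hK : IsRegularFamily a b K) (hθ₀ : ∀ i, θ₀ i ∈ Set.Ioo a b)
  (hL : IsPerturbationLaw L) (hε : ε ∈ Set.Ico (0 : ℝ) (1 / 2)) (hv : IsGridEnumeration v)
include hd hK hθ₀ hL hε hv

lemma isTame_gradMat (i : Fin p) (n : ℕ) :
    IsTame (n := n) L fun x => gradMat a b K v ε x i θ₀ := by
  have hab := (hθ₀ i).1.trans (hθ₀ i).2
  have hθ := mem_paramSet_of_Ioo hθ₀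
  obtain ⟨m, hm, hc⟩ := hK.exists_coercive hθ hε
  simp only [gradMat_eq]
  exact ((hK.isLocal_baseMat hab [] (by simp) hθ hε).gradFun hm hc
    (hK.isLocal_baseMat hab [i] (by simp) hθ hε)).isTame hd hv hL n

lemma isTame_hessOf (i j : Fin p) (n : ℕ) :
    IsTame (n := n) L fun x => hessOf (covMat K v ε x θ₀)⁻¹ (dCovMat a b K v ε x i θ₀)
        (dCovMat a b K v ε x j θ₀) (ddCovMat a b K v ε x i j θ₀) := by
  have hab := (hθ₀ i).1.trans (hθ₀ i).2
  have hθ := mem_paramSet_of_Ioo hθ₀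
  obtain ⟨m, hm, hc⟩ := hK.exists_coercive hθ hε
  simp only [hessOf_eq]
  exact ((hK.isLocal_baseMat hab [] (by simp) hθ hε).hessFun hm hc
    (hK.isLocal_baseMat hab [i] (by simp) hθ hε) (hK.isLocal_baseMat hab [j] (by simp) hθ hε)
    (hK.isLocal_baseMat hab [i, j] (by simp) hθ hε)).isTame hd hv hL n

variable (hX : ∀ k, Measurable (X k)) (hXL : ∀ k, PX.map (X k) = L) (n : ℕ)
include hX hXL

-- The identity holds almost surely only, as the derivative formula is used for perturbations in the
-- support of `L`.
omit [IsProbabilityMeasure PX] [IsProbabilityMeasure PY] in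
lemma ae_sqrt_mul_partialDeriv_eq (i : Fin p) :
    (fun ω => √(n : ℝ) * partialDeriv a b i (randomCV K v ε X Y n ω) θ₀) =ᵐ[PX.prod PY]
      randomQuad (n := n) v ε X Y fun x => (√(n : ℝ) * (1 / (n : ℝ) * 2)) • gradMat a b K v ε x i θ₀ := by
  have hab := (hθ₀ i).1.trans (hθ₀ i).2
  filter_upwards [Measure.quasiMeasurePreserving_fst.ae (ae_mem_of_law hL hX hXL)] with ω hω
  rw [randomCV, partialDeriv_cv (x := firstPerturbations X n ω.1) hK hd hv hε
    (fun k => hL.support_subset _ (hω k)) hab _ i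
    (mem_paramSet_of_Ioo hθ₀), randomQuad, smul_mulVec, dotProduct_smul, smul_eq_mul]
  ring

omit [IsProbabilityMeasure PX] [IsProbabilityMeasure PY] in
lemma ae_iterPartialDeriv_eq (i j : Fin p) :
    (fun ω => iterPartialDeriv a b [i, j] (randomCV K v ε X Y n ω) θ₀) =ᵐ[PX.prod PY]
      randomQuad (n := n) v ε X Y fun x => (1 / (n : ℝ) * 2) • hessOf (covMat K v ε x θ₀)⁻¹
        (dCovMat a b K v ε x i θ₀) (dCovMat a b K v ε x j θ₀) (ddCovMat a b K v ε x i j θ₀) := by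
  have hab := (hθ₀ i).1.trans (hθ₀ i).2
  filter_upwards [Measure.quasiMeasurePreserving_fst.ae (ae_mem_of_law hL hX hXL)] with ω hω
  rw [randomCV, iterPartialDeriv_cv (x := firstPerturbations X n ω.1) hK hd hv hε
    (fun k => hL.support_subset _ (hω k)) hab _ i j
    (mem_paramSet_of_Ioo hθ₀), randomQuad, smul_mulVec, dotProduct_smul, smul_eq_mul]
  ring

variable (hYm : Measurable (Function.uncurry Y)) (hY : IsGaussianProcess Y PY)
  (h0 : ∀ t, ∫ ω, Y t ω ∂PY = 0) (hcov : ∀ s t, cov[Y s, Y t; PY] = K θ₀ (s - t))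
include hYm hY h0 hcov

lemma memLp_sqrt_mul_partialDeriv (i : Fin p) :
    MemLp (fun ω => √(n : ℝ) * partialDeriv a b i (randomCV K v ε X Y n ω) θ₀) 2
      (PX.prod PY) :=
  (memLp_congr_ae (ae_sqrt_mul_partialDeriv_eq hd hK hθ₀ hL hε hv hX hXL n i)).2
    (memLp_randomQuad hL hX hXL hYm hY h0 hcov
      ((isTame_gradMat hd hK hθ₀ hL hε hv i n).smul _))

lemma integrable_iterPartialDeriv (i j : Fin p) :
    Integrable (fun ω => iterPartialDeriv a b [i, j] (randomCV K v ε X Y n ω) θ₀)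
      (PX.prod PY) :=
  ((memLp_randomQuad hL hX hXL hYm hY h0 hcov
    ((isTame_hessOf hd hK hθ₀ hL hε hv i j n).smul _)).integrable (by norm_num)).congr
    (ae_iterPartialDeriv_eq hd hK hθ₀ hL hε hv hX hXL n i j).symm

lemma condCov_gradient (hn : 1 ≤ n) (i j : Fin p) :
    condCov (perturbationSigma ΩY X n)
      (fun ω => √(n : ℝ) * partialDeriv a b i (randomCV K v ε X Y n ω) θ₀)
      (fun ω => √(n : ℝ) * partialDeriv a b j (randomCV K v ε X Y n ω) θ₀) (PX.prod PY)
    =ᵐ[PX.prod PY] fun ω => (1 / (n : ℝ)) *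
      (mCV1 a b K v ε (firstPerturbations X n ω.1) θ₀ i j).trace := by
  have hθ := mem_paramSet_of_Ioo hθ₀
  have hn0 : (n : ℝ) ≠ 0 := by positivity
  refine (condCov_congr (ae_sqrt_mul_partialDeriv_eq hd hK hθ₀ hL hε hv hX hXL n i)
    (ae_sqrt_mul_partialDeriv_eq hd hK hθ₀ hL hε hv hX hXL n j)).trans
    ((condCov_randomQuad hL hX hXL hYm hY h0 hcov (hK.stationary _ hθ).even
      (hK.continuous hθ).measurable ((isTame_gradMat hd hK hθ₀ hL hε hv i n).smul _)
      ((isTame_gradMat hd hK hθ₀ hL hε hv j n).smul _)).trans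
    (Eventually.of_forall fun ω => ?_))
  have hR : kernelMat (K θ₀) v ε (firstPerturbations X n ω.1)
      = covMat K v ε (firstPerturbations X n ω.1) θ₀ := rfl
  simp only [hR, mCV1, trace_smul, trace_add_transpose_mul (transpose_covMat hK hθ), transpose_smul,
    smul_mul_assoc, mul_smul_comm, smul_eq_mul]
  have hs : √(n : ℝ) * √(n : ℝ) = n := Real.mul_self_sqrt (Nat.cast_nonneg n)
  -- The squared scaling factor is `4 / n`; the `4` matches the `2` in `mCV1` times the `2` from
  -- `trace_add_transpose_mul`.
  have hs' : (√(n : ℝ) * (1 / (n : ℝ) * 2)) * (√(n : ℝ) * (1 / (n : ℝ) * 2))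
      = 1 / (n : ℝ) * 4 := by
    rw [show (√(n : ℝ) * (1 / (n : ℝ) * 2)) * (√(n : ℝ) * (1 / (n : ℝ) * 2))
      = (√(n : ℝ) * √(n : ℝ)) * (1 / (n : ℝ) * 2) ^ 2 by ring, hs]
    field_simp
    norm_num
  generalize √(n : ℝ) * (1 / (n : ℝ) * 2) = c at hs' ⊢
  rw [← mul_add, ← mul_add, ← mul_assoc c c, hs']
  ring

lemma condExp_hessian (i j : Fin p) :
    (PX.prod PY)[fun ω => iterPartialDeriv a b [i, j] (randomCV K v ε X Y n ω) θ₀ |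
      perturbationSigma ΩY X n]
    =ᵐ[PX.prod PY] fun ω => (1 / (n : ℝ)) *
      (mCV2 a b K v ε (firstPerturbations X n ω.1) θ₀ i j).trace := by
  have hθ := mem_paramSet_of_Ioo hθ₀
  have hquad := condExp_randomQuad (v := v) (ε := ε) (X := X) hL hX hXL hYm hY h0 hcov
    (hK.stationary _ hθ).even (hK.continuous hθ).measurable
    ((isTame_hessOf hd hK hθ₀ hL hε hv i j n).smul (1 / (n : ℝ) * 2))
  refine (condExp_congr_ae (ae_iterPartialDeriv_eq hd hK hθ₀ hL hε hv hX hXL n i j)).trans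
    (hquad.trans ?_)
  filter_upwards [Measure.quasiMeasurePreserving_fst.ae (ae_mem_of_law hL hX hXL)] with ω hω
  have hx : ∀ k, firstPerturbations X n ω.1 k ∈ unitCube d :=
    fun k => hL.support_subset _ (hω k)
  have hR : kernelMat (K θ₀) v ε (firstPerturbations X n ω.1)
      = covMat K v ε (firstPerturbations X n ω.1) θ₀ := rfl
  simp only [hR]
  rw [smul_mul_assoc, trace_smul, smul_eq_mul, mul_assoc, trace_hessOf _ (transpose_covMat hK hθ)
    (transpose_dCovMat hK i hθ) (transpose_dCovMat hK j hθ) (isUnit_covMat hK hd hv hε hx hθ)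
    fun k => (inv_covMat_apply_pos hK hd hv hε hx hθ k).ne']
  rfl

end Moments

end

end KrigingCV

end

theorem mainTheorem5 {d p : ℕ} (hd : 0 < d) (a b : ℝ)
    (K : (Fin p → ℝ) → EuclideanSpace ℝ (Fin d) → ℝ)
    (hK : KrigingCV.IsRegularFamily a b K)
    (θ₀ : Fin p → ℝ) (hθ₀ : ∀ i, θ₀ i ∈ Set.Ioo a b)
    (L : Measure (EuclideanSpace ℝ (Fin d))) (hL : KrigingCV.IsPerturbationLaw L) :
    -- the limit matrices are functions of `ε` alone, chosen before everything below
    ∃ S₁ S₂ : ℝ → Matrix (Fin p) (Fin p) ℝ,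
      ∀ ε ∈ Set.Ico (0 : ℝ) (1 / 2), ∀ v : ℕ → Fin d → ℕ, KrigingCV.IsGridEnumeration v →
        -- the gradient (and existence of the second order partial derivatives) on all of `Θ`
        (∀ n : ℕ, 1 ≤ n → ∀ x : Fin n → EuclideanSpace ℝ (Fin d), (∀ k, x k ∈ L.support) →
          ∀ θ ∈ KrigingCV.paramSet a b,
            IsUnit (KrigingCV.covMat K v ε x θ) ∧
            IsUnit (KrigingCV.diagPart (KrigingCV.covMat K v ε x θ)⁻¹) ∧
            ∀ y : Fin n → ℝ,
              (∀ i : Fin p, HasDerivWithinAt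
                (fun s => KrigingCV.cv K v ε x y (Function.update θ i s))
                ((1 / (n : ℝ)) *
                  (2 * (y ⬝ᵥ (KrigingCV.gradMat a b K v ε x i θ).mulVec y)))
                (Set.Icc a b) (θ i)) ∧
              (∀ i j : Fin p, DifferentiableWithinAt ℝ
                (fun s => KrigingCV.partialDeriv a b j (KrigingCV.cv K v ε x y)
                  (Function.update θ i s))
                (Set.Icc a b) (θ i))) ∧
        ∀ (ΩX : Type*) [MeasurableSpace ΩX] (PX : Measure ΩX) [IsProbabilityMeasure PX]
          (X : ℕ → ΩX → EuclideanSpace ℝ (Fin d)),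
          (∀ k, Measurable (X k)) → (∀ k, PX.map (X k) = L) → iIndepFun X PX →
          -- almost sure convergence of the normalized traces
          (∀ i j : Fin p,
            (∀ᵐ ω ∂PX, Tendsto
              (fun n : ℕ => (1 / (n : ℝ)) *
                (KrigingCV.mCV1 a b K v ε (KrigingCV.firstPerturbations X n ω) θ₀ i j).trace)
              atTop (𝓝 (S₁ ε i j))) ∧
            (∀ᵐ ω ∂PX, Tendsto
              (fun n : ℕ => (1 / (n : ℝ)) *
                (KrigingCV.mCV2 a b K v ε (KrigingCV.firstPerturbations X n ω) θ₀ i j).trace)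
              atTop (𝓝 (S₂ ε i j)))) ∧
          -- conditional moments, for a centered Gaussian process with covariance function `K θ₀`
          ∀ (ΩY : Type*) [MeasurableSpace ΩY] (PY : Measure ΩY) [IsProbabilityMeasure PY]
            (Y : EuclideanSpace ℝ (Fin d) → ΩY → ℝ),
            Measurable (Function.uncurry Y) → IsGaussianProcess Y PY →
            (∀ t, ∫ ω, Y t ω ∂PY = 0) → (∀ s t, cov[Y s, Y t; PY] = K θ₀ (s - t)) →
            ∀ n : ℕ, 1 ≤ n →
              (∀ i : Fin p, MemLp
                (fun ω => √(n : ℝ) * KrigingCV.partialDeriv a b i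
                  (KrigingCV.randomCV K v ε X Y n ω) θ₀) 2 (PX.prod PY)) ∧
              (∀ i j : Fin p,
                KrigingCV.condCov (KrigingCV.perturbationSigma ΩY X n)
                  (fun ω => √(n : ℝ) * KrigingCV.partialDeriv a b i
                    (KrigingCV.randomCV K v ε X Y n ω) θ₀)
                  (fun ω => √(n : ℝ) * KrigingCV.partialDeriv a b j
                    (KrigingCV.randomCV K v ε X Y n ω) θ₀)
                  (PX.prod PY)
                =ᵐ[PX.prod PY] fun ω => (1 / (n : ℝ)) *
                  (KrigingCV.mCV1 a b K v ε
                    (KrigingCV.firstPerturbations X n ω.1) θ₀ i j).trace) ∧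
              (∀ i j : Fin p, Integrable
                (fun ω => KrigingCV.iterPartialDeriv a b [i, j]
                  (KrigingCV.randomCV K v ε X Y n ω) θ₀) (PX.prod PY)) ∧
              (∀ i j : Fin p,
                (PX.prod PY)[fun ω => KrigingCV.iterPartialDeriv a b [i, j]
                    (KrigingCV.randomCV K v ε X Y n ω) θ₀ |
                  KrigingCV.perturbationSigma ΩY X n]
                =ᵐ[PX.prod PY] fun ω => (1 / (n : ℝ)) *
                  (KrigingCV.mCV2 a b K v ε
                    (KrigingCV.firstPerturbations X n ω.1) θ₀ i j).trace) := by
  classical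
  have hθ := KrigingCV.mem_paramSet_of_Ioo hθ₀
  have hlim : ∀ ε ∈ Set.Ico (0 : ℝ) (1 / 2), ∀ i j : Fin p,
      (KrigingCV.IsLocal (KrigingCV.covGradFun (KrigingCV.derivFun a b K [] θ₀ ε)
        (KrigingCV.derivFun a b K [i] θ₀ ε) (KrigingCV.derivFun a b K [j] θ₀ ε))) ∧
      (KrigingCV.IsLocal (KrigingCV.meanHessFun (KrigingCV.derivFun a b K [] θ₀ ε)
        (KrigingCV.derivFun a b K [i] θ₀ ε) (KrigingCV.derivFun a b K [j] θ₀ ε))) := by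
    intro ε hε i j
    -- An index `i` is at hand, so interiority of `θ₀` provides `a < b`; for `p = 0` there is
    -- nothing to prove.
    have hab := (hθ₀ i).1.trans (hθ₀ i).2
    obtain ⟨m, hm, hc⟩ := hK.exists_coercive hθ hε
    have h0 := hK.isLocal_baseMat hab [] (by simp) hθ hε
    have hi := hK.isLocal_baseMat hab [i] (by simp) hθ hε
    have hj := hK.isLocal_baseMat hab [j] (by simp) hθ hε
    exact ⟨h0.covGradFun hm hc hi hj, h0.meanHessFun hm hc hi hj⟩
  -- The limits are those of the expected central entries of boxes. They are chosen before any
  -- enumeration or probability space enters, which gives the dependence on `ε` alone.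
  choose S₁ hS₁ using fun (ε : Set.Ico (0 : ℝ) (1 / 2)) (i j : Fin p) =>
    (hlim ε ε.2 i j).1.exists_tendsto_meanCenter hL
  choose S₂ hS₂ using fun (ε : Set.Ico (0 : ℝ) (1 / 2)) (i j : Fin p) =>
    (hlim ε ε.2 i j).2.exists_tendsto_meanCenter hL
  -- Outside `[0, 1/2)` the value `0` is arbitrary.
  refine ⟨fun ε => if h : ε ∈ Set.Ico (0 : ℝ) (1 / 2) then Matrix.of (S₁ ⟨ε, h⟩) else 0,
    fun ε => if h : ε ∈ Set.Ico (0 : ℝ) (1 / 2) then Matrix.of (S₂ ⟨ε, h⟩) else 0,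
    fun ε hε v hv => ⟨fun n _ x hx θ hθ' => ?_, ?_⟩⟩
  · have hx' : ∀ k, x k ∈ KrigingCV.unitCube d := fun k => hL.support_subset _ (hx k)
    refine ⟨KrigingCV.isUnit_covMat hK hd hv hε hx' hθ',
      KrigingCV.isUnit_diagPart_inv_covMat hK hd hv hε hx' hθ', fun y => ⟨fun i => ?_,
      fun i j => ?_⟩⟩
    · exact KrigingCV.hasDerivWithinAt_cv hK hd hv hε hx' ((hθ₀ i).1.trans (hθ₀ i).2) y i hθ'
    · exact (KrigingCV.hasDerivWithinAt_partialDeriv_cv hK hd hv hε hx'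
        ((hθ₀ i).1.trans (hθ₀ i).2) y i j hθ').differentiableWithinAt
  · intro ΩX _ PX _ X hX hXL hind
    refine ⟨fun i j => ⟨?_, ?_⟩, fun ΩY _ PY _ Y hYm hY h0 hcov n hn => ⟨fun i => ?_, fun i j => ?_,
      fun i j => ?_, fun i j => ?_⟩⟩
    · simp only [dif_pos hε, Matrix.of_apply, KrigingCV.mCV1_eq]
      exact (hlim ε hε i j).1.ae_tendsto_trace hd hv hL hX hXL hind (hS₁ ⟨ε, hε⟩ i j)
    · simp only [dif_pos hε, Matrix.of_apply, KrigingCV.mCV2_eq]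
      exact (hlim ε hε i j).2.ae_tendsto_trace hd hv hL hX hXL hind (hS₂ ⟨ε, hε⟩ i j)
    · exact KrigingCV.memLp_sqrt_mul_partialDeriv hd hK hθ₀ hL hε hv hX hXL n hYm hY h0 hcov i
    · exact KrigingCV.condCov_gradient hd hK hθ₀ hL hε hv hX hXL n hYm hY h0 hcov hn i j
    · exact KrigingCV.integrable_iterPartialDeriv hd hK hθ₀ hL hε hv hX hXL n hYm hY h0 hcov i j
    · exact KrigingCV.condExp_hessian hd hK hθ₀ hL hε hv hX hXL n hYm hY h0 hcov i j
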